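/- All graphs are finite and simple. A graph $G$ is *chordal* if it has no induced cycle of length at least $4$. It is a *path graph* if there are a tree $T$, a collection $\mathcal P$ of paths of $T$ and a bijection $\phi:V(G)\to\mathcal P$ such that two distinct vertices $u,v$ are adjacent if and only if the vertex sets of $\phi(u)$ and $\phi(v)$ intersect. *Attachedness graphs.* A *clique separator* of $G$ is an inclusion-wise maximal clique $Q$ of $G$ such that $G-Q$ has at least two connected components. For a clique $Q$ of $G$ let $V_1,\dots,V_s$ be the vertex sets of the components of $G-Q$, let $\gamma_i=G[V_i\cup Q]$ and $\Gamma_Q=\{\gamma_1,\dots,\gamma_s\}$. A *relevant clique* of $\gamma\in\Gamma_Q$ is a maximal clique $K$ of $\gamma$ with $K\cap Q\ne\emptyset$ and $K\neq Q$; $\gamma$ is a *neighboring subgraph* of a vertex $v$ if $v$ lies in a relevant clique of $\gamma$. For $\gamma,\gamma'\in\Gamma_Q$ write - $\gamma\Join\gamma'$ (*attached*) if $K\cap K'\cap Q\neq\emptyset$ for some relevant cliques $K$ of $\gamma$ and $K'$ of $\gamma'$; - $\gamma\le\gamma'$ (*dominance*) if $\gamma\Join\gamma'$ and for each relevant clique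 $K'$ of $\gamma'$ either $K\cap Q\subseteq K'\cap Q$ for every relevant clique $K$ of $\gamma$, or $K\cap K'\cap Q=\emptyset$ for every relevant clique $K$ of $\gamma$; - $\gamma\leftrightarrow\gamma'$ (*antipodality*) if $\gamma\Join\gamma'$, $\gamma\not\le\gamma'$ and $\gamma'\not\le\gamma$. The *$Q$-attachedness graph* of $G$ has vertex set $\Gamma_Q$; distinct $\gamma,\gamma'$ are joined if $\gamma\Join\gamma'$, by an *antipodal* edge if $\gamma\leftrightarrow\gamma'$ and by a *dominance* edge otherwise. A *full antipodal triangle* consists of three distinct, pairwise antipodal members of $\Gamma_Q$ that are neighboring subgraphs of a common vertex of $Q$. *Forbidden graphs.* For $k\ge1$, $W^{(0)}_{2k+1}$ is the wheel whose rim is a cycle on $2k+1$ vertices, with all rim edges antipodal and all spokes dominance edges; $W^{(1)}_{2k+1}$ is obtained from it by making exactly one spoke antipodal. For $n\ge2$, $F_{2n+1}$ has vertices $0,1,\dots,2n$, the edges of the cycle $0,1,\dots,2n,0$ as antipodal edges, and the edges $0j$, $2\le j\le 2n-1$, as dominance edges; $\widetilde F_{2n+1}$ is $F_{2n+1}$ with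 the additional antipodal edge joining $1$ and $2n$; $DF_{2n+1}$ is $F_{2n+1}$ with the additional dominance edges $1j$, $3\le j\le 2n$. Let $$\mathcal F_0=\{W^{(0)}_{2k+1},W^{(1)}_{2k+1},F_{2n+1}\mid k\ge1,n\ge2\},\qquad \mathcal F=\mathcal F_0\cup\{\widetilde F_{2n+1},DF_{2n+1}\mid n\ge2\}.$$ Isomorphisms of 2-edge-colored graphs preserve edge colors. Finally, $G^+$ is obtained from $G$ by adding, for each $v\in V(G)$, a new vertex $v^+$ adjacent only to $v$. **Theorem.** Let $G$ be a chordal graph. The following are equivalent: (a) $G$ is a path graph; (b) for every clique separator $Q$ of $G$, the $Q$-attachedness graph of $G$ has no full antipodal triangle and no subgraph isomorphic to a graph in $\mathcal F_0$; (c) for every clique separator $Q$ of $G$, the $Q$-attachedness graph of $G^+$ has no subgraph isomorphic to a graph in $\mathcal F_0$; (d) for every clique separator $Q$ of $G$, the $Q$-attachedness graph of $G$ has no full antipodal triangle and no induced subgraph isomorphic to a graph in $\mathcal F$; (e) for every clique separator $Q$ of $G$, the $Q$-attachedness graph of $G^+$ has no induced subgraph isomorphic to a graph in $\mathcal F$.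 -/

import Mathlib

universe u

namespace PathGraphs

/-! ### Chordal graphs and path graphs -/

/-- A graph is chordal if it has no induced cycle of length at least four. -/
def IsChordal {V : Type u} (G : SimpleGraph V) : Prop :=
  ∀ n : ℕ, 4 ≤ n → IsEmpty (SimpleGraph.cycleGraph n ↪g G)

/-- `S` is the vertex set of a path of `T` (a single vertex is a path). -/
def IsPathSet {W : Type u} (T : SimpleGraph W) (S : Set W) : Prop :=
  ∃ (a b : W) (p : T.Walk a b), p.IsPath ∧ S = {x | x ∈ p.support}

/-- `G` is a path graph: there are a finite tree `T` and a bijection `φ` from the vertices of `G`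
to a collection of paths of `T` (the range of `φ`) such that two distinct vertices are adjacent
if and only if the vertex sets of their paths intersect. A path of a tree is determined by its
vertex set. -/
def IsPathGraph {V : Type u} (G : SimpleGraph V) : Prop :=
  ∃ (W : Type u) (_ : Finite W) (T : SimpleGraph W) (φ : V → Set W),
    T.IsTree ∧ (∀ v, IsPathSet T (φ v)) ∧ Function.Injective φ ∧
      ∀ v w, v ≠ w → (G.Adj v w ↔ (φ v ∩ φ w).Nonempty)

/-! ### Clique separators and the members of `Γ_Q` -/

/-- `K` is an inclusion-wise maximal clique of the subgraph of `G` induced by `S`. -/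
def IsMaxCliqueIn {V : Type u} (G : SimpleGraph V) (S K : Set V) : Prop :=
  Maximal (fun L : Set V => G.IsClique L ∧ L ⊆ S) K

/-- The connected components of `G - Q`. They index `Γ_Q`: the component `c` with vertex set `V_c`
stands for the member `γ_c = G[V_c ∪ Q]`, and distinct components give distinct members. -/
abbrev Comp {V : Type u} (G : SimpleGraph V) (Q : Set V) : Type u :=
  (G.induce Qᶜ).ConnectedComponent

/-- The vertex set `V_c ∪ Q` of `γ_c`. -/
def piece {V : Type u} (G : SimpleGraph V) (Q : Set V) (c : Comp G Q) : Set V :=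
  (Subtype.val '' c.supp) ∪ Q

/-- `Q` is a clique separator: a maximal clique of `G` such that `G - Q` has at least two connected
components. -/
def IsCliqueSeparator {V : Type u} (G : SimpleGraph V) (Q : Set V) : Prop :=
  IsMaxCliqueIn G Set.univ Q ∧ Nontrivial (Comp G Q)

/-- `K` is a relevant clique of `γ_c`: a maximal clique of `γ_c` that meets `Q` and is not `Q`. -/
def IsRelevant {V : Type u} (G : SimpleGraph V) (Q : Set V) (c : Comp G Q) (K : Set V) : Prop :=
  IsMaxCliqueIn G (piece G Q c) K ∧ (K ∩ Q).Nonempty ∧ K ≠ Q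

/-- `γ_c` is a neighboring subgraph of the vertex `v`. -/
def IsNeighboring {V : Type u} (G : SimpleGraph V) (Q : Set V) (c : Comp G Q) (v : V) : Prop :=
  ∃ K, IsRelevant G Q c K ∧ v ∈ K

/-- Attachedness. -/
def Attached {V : Type u} (G : SimpleGraph V) (Q : Set V) (c d : Comp G Q) : Prop :=
  ∃ K L, IsRelevant G Q c K ∧ IsRelevant G Q d L ∧ (K ∩ L ∩ Q).Nonempty

/-- Dominance: `γ_c ≤ γ_d`. -/
def Dominated {V : Type u} (G : SimpleGraph V) (Q : Set V) (c d : Comp G Q) : Prop :=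
  Attached G Q c d ∧ ∀ L, IsRelevant G Q d L →
    (∀ K, IsRelevant G Q c K → K ∩ Q ⊆ L ∩ Q) ∨ (∀ K, IsRelevant G Q c K → K ∩ L ∩ Q = ∅)

/-- Antipodality: `γ_c` and `γ_d` are attached and neither dominates the other, so that antipodal
and comparable pairs partition the attached pairs of distinct members. -/
def Antipodal {V : Type u} (G : SimpleGraph V) (Q : Set V) (c d : Comp G Q) : Prop :=
  Attached G Q c d ∧ ¬ Dominated G Q c d ∧ ¬ Dominated G Q d c

theorem Attached.symm {V : Type u} {G : SimpleGraph V} {Q : Set V} {c d : Comp G Q}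
    (h : Attached G Q c d) : Attached G Q d c := by
  obtain ⟨K, L, hK, hL, x, ⟨hx, hx'⟩, hxQ⟩ := h
  exact ⟨L, K, hL, hK, x, ⟨hx', hx⟩, hxQ⟩

/-! ### Two-edge-colored graphs -/

/-- A 2-edge-colored graph. The two colors are called antipodal (drawn solid) and dominance
(drawn dotted). -/
structure TwoColoredGraph (U : Type u) where
  antip : SimpleGraph U
  dom : SimpleGraph U
  disj : ∀ i j, antip.Adj i j → ¬ dom.Adj i j

/-- `M` has a (not necessarily induced) subgraph isomorphic to `S` as 2-edge-colored graph. -/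
def HasCopy {U : Type*} {W : Type*} (S : TwoColoredGraph U) (M : TwoColoredGraph W) : Prop :=
  ∃ f : U → W, Function.Injective f ∧
    (∀ i j, S.antip.Adj i j → M.antip.Adj (f i) (f j)) ∧
    (∀ i j, S.dom.Adj i j → M.dom.Adj (f i) (f j))

/-- `M` has an induced subgraph isomorphic to `S` as 2-edge-colored graph. -/
def HasInducedCopy {U : Type*} {W : Type*} (S : TwoColoredGraph U) (M : TwoColoredGraph W) :
    Prop :=
  ∃ f : U → W, Function.Injective f ∧
    (∀ i j, S.antip.Adj i j ↔ M.antip.Adj (f i) (f j)) ∧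
    (∀ i j, S.dom.Adj i j ↔ M.dom.Adj (f i) (f j))

/-- The `Q`-attachedness graph of `G`, 2-edge-colored by antipodality and dominance edges. -/
def attachednessGraph {V : Type u} (G : SimpleGraph V) (Q : Set V) :
    TwoColoredGraph (Comp G Q) where
  antip :=
    { Adj := fun c d => c ≠ d ∧ Antipodal G Q c d
      symm := ⟨fun _ _ h => ⟨h.1.symm, h.2.1.symm, h.2.2.2, h.2.2.1⟩⟩
      loopless := ⟨fun _ h => h.1 rfl⟩ }
  dom :=
    { Adj := fun c d => c ≠ d ∧ (Dominated G Q c d ∨ Dominated G Q d c)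
      symm := ⟨fun _ _ h => ⟨h.1.symm, h.2.symm⟩⟩
      loopless := ⟨fun _ h => h.1 rfl⟩ }
  disj := fun _ _ h h' => h'.2.elim h.2.2.1 h.2.2.2

/-- The `Q`-attachedness graph of `G` has a full antipodal triangle: three pairwise antipodal
members of `Γ_Q` that are neighboring subgraphs of a common vertex of `Q`. -/
def HasFullAntipodalTriangle {V : Type u} (G : SimpleGraph V) (Q : Set V) : Prop :=
  ∃ c₁ c₂ c₃ : Comp G Q,
    (attachednessGraph G Q).antip.Adj c₁ c₂ ∧
    (attachednessGraph G Q).antip.Adj c₂ c₃ ∧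
    (attachednessGraph G Q).antip.Adj c₁ c₃ ∧
    ∃ v ∈ Q, IsNeighboring G Q c₁ v ∧ IsNeighboring G Q c₂ v ∧ IsNeighboring G Q c₃ v

/-! ### The forbidden 2-edge-colored graphs -/

/-- The antipodal edges are those of `H`; the dominance edges are all other pairs of distinct
vertices with at least one end in `hubs`. -/
def withHubs {U : Type u} (H : SimpleGraph U) (hubs : Set U) : TwoColoredGraph U where
  antip := H
  dom :=
    { Adj := fun i j => i ≠ j ∧ (i ∈ hubs ∨ j ∈ hubs) ∧ ¬ H.Adj i j
      symm := ⟨fun _ _ h => ⟨h.1.symm, h.2.1.symm, fun h' => h.2.2 h'.symm⟩⟩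
      loopless := ⟨fun _ h => h.1 rfl⟩ }
  disj := fun _ _ h h' => h'.2.2 h

/-- The cycle on the `m` vertices `some i`, together with the isolated vertex `none`. -/
def rim (m : ℕ) : SimpleGraph (Option (Fin m)) :=
  (SimpleGraph.cycleGraph m).map Function.Embedding.some

/-- `W^(0)_{2k+1}`: the `(2k+1)`-wheel with antipodal rim and dominance spokes. -/
def wheelZero (k : ℕ) : TwoColoredGraph (Option (Fin (2 * k + 1))) :=
  withHubs (rim (2 * k + 1)) {none}

/-- `W^(1)_{2k+1}`: the `(2k+1)`-wheel with antipodal rim, exactly one antipodal spoke and all other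
spokes dominance edges. -/
def wheelOne (k : ℕ) : TwoColoredGraph (Option (Fin (2 * k + 1))) :=
  withHubs (rim (2 * k + 1) ⊔ SimpleGraph.edge none (some 0)) {none}

/-- `F_{2n+1}`: the `(2n+1)`-fan with center `0` and path `1, …, 2n`. The edges of the path and
those from the center to the two ends of the path are antipodal (together they form the cycle
`0, 1, …, 2n`), the other edges at the center are dominance edges. -/
def fan (n : ℕ) : TwoColoredGraph (Fin (2 * n + 1)) :=
  withHubs (SimpleGraph.cycleGraph (2 * n + 1)) {0}

/-- `F̃_{2n+1}`: the fan `F_{2n+1}` with an additional antipodal edge between the ends `1` and `2n`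
of the path. -/
def chordedFan (n : ℕ) : TwoColoredGraph (Fin (2 * n + 1)) :=
  withHubs (SimpleGraph.cycleGraph (2 * n + 1) ⊔ SimpleGraph.edge 1 (Fin.last (2 * n))) {0}

/-- `DF_{2n+1}`: the `(2n+1)`-double fan; the edges of the cycle `0, 1, …, 2n` are antipodal and all
other edges, from the consecutive vertices `0` and `1`, are dominance edges. -/
def doubleFan (n : ℕ) : TwoColoredGraph (Fin (2 * n + 1)) :=
  withHubs (SimpleGraph.cycleGraph (2 * n + 1)) {0, 1}

/-- The collection `𝓕₀`. -/
def familyZero : Set (Σ U : Type, TwoColoredGraph U) :=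
  {S | (∃ k : ℕ, 1 ≤ k ∧ (S = ⟨_, wheelZero k⟩ ∨ S = ⟨_, wheelOne k⟩)) ∨
    (∃ n : ℕ, 2 ≤ n ∧ S = ⟨_, fan n⟩)}

/-- The collection `𝓕`. -/
def family : Set (Σ U : Type, TwoColoredGraph U) :=
  familyZero ∪ {S | ∃ n : ℕ, 2 ≤ n ∧ (S = ⟨_, chordedFan n⟩ ∨ S = ⟨_, doubleFan n⟩)}

/-! ### The graph `G⁺` -/

/-- `G⁺`: a pendant vertex `v⁺ = inr v` is attached to every vertex `v = inl v` of `G`. -/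
def plus {V : Type u} (G : SimpleGraph V) : SimpleGraph (V ⊕ V) where
  Adj
    | Sum.inl v, Sum.inl w => G.Adj v w
    | Sum.inl v, Sum.inr w => v = w
    | Sum.inr v, Sum.inl w => v = w
    | Sum.inr _, Sum.inr _ => False
  symm := ⟨by
    rintro (v | v) (w | w) h
    · exact SimpleGraph.Adj.symm (G := G) h
    · exact Eq.symm h
    · exact Eq.symm h
    · exact h⟩
  loopless := ⟨by
    rintro (v | v) h
    · exact G.irrefl h
    · exact h⟩

end PathGraphs

universe v

namespace PathGraphs

/-! Every implication passes through good colorings of `Γ_Q`: antipodal members get distinct colors,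
and each vertex of `Q` is seen by members of at most two colors. Path graphs have them. By the Helly
property a maximal clique `Q` consists of all paths through one node `q` of the tree. Each component
of `G - Q` occupies a subtree avoiding `q`, and its color is the branch at `q` containing that
subtree. A path through `q` enters at most two branches, and attached members in one branch are
comparable (`IsPathRepOn.hasGoodColoring`). Conversely, suppose that a good coloring exists at every
clique separator of a chordal graph. By induction the members of `Γ_Q` have path representations,
and these are glued along the coloring: each color is one direction leaving a common root, and
within a color dominating members are placed closer to the root (`IsGlued.insert`). Two colors per
vertex of `Q` mean two arms, hence a path. A chordal graph without clique separators is a union of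
two cliques and needs only a tree with two nodes. The rest is combinatorics of the attachedness
graph. Given a good coloring, the property of having the color of the hub alternates along the rim
of a wheel or the path of a fan, which is impossible for parity reasons; a full antipodal triangle
would need three colors (`IsGoodColoring.not_hasCopy`, `IsGoodColoring.not_triangle`). In the other
direction, members are colored by maximal members above them. The choices below one maximal member
form a bipartition problem whose odd cycles are precisely wheels and fans
(`AttachmentSystem.exists_isGoodColoring`). Excluding induced copies is enough: antipodal chords
yield smaller configurations, and the remaining dominance edges are controlled by transitivity and
`antip_or_lt` (`not_isWheel`, `not_isFan`). In `G⁺` the pendant vertex at `v ∈ Q` is a member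
dominated by all members seeing `v`, so it turns a full antipodal triangle at `v` into a wheel with
three rim vertices. Conversely, a path representation of `G` extends to `G⁺` once every path owns a
private node. -/

/-! ### Cycles as sequences -/

/-- Adjacency in the cycle `0, 1, …, m - 1`. -/
def CycAdj (m i j : ℕ) : Prop :=
  j = i + 1 ∨ i = j + 1 ∨ (i = 0 ∧ j + 1 = m) ∨ (j = 0 ∧ i + 1 = m)

theorem cycleGraph_adj_iff {m : ℕ} (hm : 3 ≤ m) (u v : Fin m) :
    (SimpleGraph.cycleGraph m).Adj u v ↔ CycAdj m u v := by
  rw [SimpleGraph.cycleGraph_adj', CycAdj]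
  have key : ∀ a b : Fin m, (a - b).val = 1 ↔ (a.val = b.val + 1 ∨ (a.val = 0 ∧ b.val + 1 = m)) := by
    intro a b
    have ha := a.isLt
    have hb := b.isLt
    rcases le_or_gt b a with h | h
    · rw [Fin.sub_val_of_le h]
      have : b.val ≤ a.val := h
      omega
    · rw [Fin.coe_sub_iff_lt.2 h]
      have : a.val < b.val := h
      omega
  rw [key, key]
  omega

/-- The index `s + t` modulo `m`, for `s, t < m`. -/
def rotIndex (m s t : ℕ) : ℕ := if s + t < m then s + t else s + t - m

theorem rotIndex_lt {m s t : ℕ} (hs : s < m) (ht : t < m) : rotIndex m s t < m := by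
  unfold rotIndex; split_ifs <;> omega

theorem rotIndex_inj {m s t t' : ℕ} (ht : t < m) (ht' : t' < m)
    (h : rotIndex m s t = rotIndex m s t') : t = t' := by
  unfold rotIndex at h; split_ifs at h <;> omega

theorem rotIndex_zero {m s : ℕ} (hs : s < m) : rotIndex m s 0 = s := by
  unfold rotIndex; split_ifs <;> omega

theorem exists_rotIndex_eq {m s i : ℕ} (hs : s < m) (hi : i < m) :
    ∃ t < m, rotIndex m s t = i := by
  by_cases h : s ≤ i
  · exact ⟨i - s, by omega, by unfold rotIndex; split_ifs <;> omega⟩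
  · exact ⟨i + m - s, by omega, by unfold rotIndex; split_ifs <;> omega⟩

theorem cycAdj_rotIndex {m s i j : ℕ} (hm : 3 ≤ m) (hs : s < m) (hi : i < m) (hj : j < m) :
    CycAdj m (rotIndex m s i) (rotIndex m s j) ↔ CycAdj m i j := by
  unfold CycAdj rotIndex; split_ifs <;> omega

theorem CycAdj.symm {m i j : ℕ} (h : CycAdj m i j) : CycAdj m j i := by
  unfold CycAdj at *; omega

/-! ### Two-edge-colored graphs whose second color comes from an order -/

/-- A strict order whose comparability pairs are the dominance edges and which interacts with the
antipodal edges as in an attachedness graph. -/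
structure DominanceOrder {Γ : Type u} (M : TwoColoredGraph Γ) where
  lt : Γ → Γ → Prop
  irrefl : ∀ i, ¬ lt i i
  trans : ∀ {i j k}, lt i j → lt j k → lt i k
  dom_iff : ∀ i j, M.dom.Adj i j ↔ lt i j ∨ lt j i
  antip_or_lt : ∀ {i j k}, lt i j → M.antip.Adj i k → M.antip.Adj k j ∨ lt k j

/-- The vertices `g 0, …, g (m - 1)` form a cycle of antipodal edges without antipodal chords. -/
structure IsChordlessCycle {Γ : Type u} (M : TwoColoredGraph Γ) (m : ℕ) (g : ℕ → Γ) : Prop where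
  inj : ∀ i < m, ∀ j < m, g i = g j → i = j
  antip_iff : ∀ i < m, ∀ j < m, (M.antip.Adj (g i) (g j) ↔ CycAdj m i j)

theorem IsChordlessCycle.rotate {Γ : Type u} {M : TwoColoredGraph Γ} {m : ℕ} {g : ℕ → Γ}
    (h : IsChordlessCycle M m g) (hm : 3 ≤ m) {s : ℕ} (hs : s < m) :
    IsChordlessCycle M m (fun t => g (rotIndex m s t)) where
  inj i hi j hj hij :=
    rotIndex_inj hi hj (h.inj _ (rotIndex_lt hs hi) _ (rotIndex_lt hs hj) hij)
  antip_iff i hi j hj := by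
    rw [h.antip_iff _ (rotIndex_lt hs hi) _ (rotIndex_lt hs hj), cycAdj_rotIndex hm hs hi hj]

section Cycle

variable {Γ : Type u} {M : TwoColoredGraph Γ} (D : DominanceOrder M) {m : ℕ} {g : ℕ → Γ}

theorem DominanceOrder.not_antip_of_lt {i j : Γ} (h : D.lt i j) : ¬ M.antip.Adj i j :=
  fun h' => M.disj _ _ h' ((D.dom_iff _ _).2 (Or.inl h))

/-- Being below `g 0` spreads along the cycle: by `antip_or_lt`, the next vertex is below `g 0` or
antipodal to it, and chordlessness leaves the second option only to the two neighbors of `g 0`. -/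
theorem IsChordlessCycle.lt_zero (h : IsChordlessCycle M m g) {i : ℕ} (hi : i < m)
    (hlt : D.lt (g i) (g 0)) : ∀ t, 2 ≤ t → t + 2 ≤ m → D.lt (g t) (g 0) := by
  have hi0 : i ≠ 0 := by rintro rfl; exact D.irrefl _ hlt
  have hna : ¬ CycAdj m i 0 := fun hc =>
    D.not_antip_of_lt hlt ((h.antip_iff i hi 0 (by omega)).2 hc)
  have hup : ∀ s, i + s + 2 ≤ m → D.lt (g (i + s)) (g 0) := by
    intro s
    induction s with
    | zero => intro _; exact hlt
    | succ s ih =>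
      intro hs
      rcases D.antip_or_lt (ih (by omega))
        ((h.antip_iff (i + s) (by omega) (i + (s + 1)) (by omega)).2 (by unfold CycAdj; omega))
        with h1 | h1
      · exact absurd ((h.antip_iff (i + (s + 1)) (by omega) 0 (by omega)).1 h1)
          (by unfold CycAdj; omega)
      · exact h1
  have hdown : ∀ s, 2 + s ≤ i → D.lt (g (i - s)) (g 0) := by
    intro s
    induction s with
    | zero => intro _; exact hlt
    | succ s ih =>
      intro hs
      rcases D.antip_or_lt (ih (by omega))
        ((h.antip_iff (i - s) (by omega) (i - (s + 1)) (by omega)).2 (by unfold CycAdj; omega))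
        with h1 | h1
      · exact absurd ((h.antip_iff (i - (s + 1)) (by omega) 0 (by omega)).1 h1)
          (by unfold CycAdj at *; omega)
      · exact h1
  intro t ht1 ht2
  rcases le_or_gt i t with hit | hit
  · have := hup (t - i) (by omega)
    rwa [show i + (t - i) = t by omega] at this
  · have := hdown (i - t) (by omega)
    rwa [show i - (i - t) = t by omega] at this

theorem IsChordlessCycle.lt_of_lt (h : IsChordlessCycle M m g) (hm : 3 ≤ m) {i j : ℕ} (hi : i < m)
    (hj : j < m) (hlt : D.lt (g i) (g j)) :
    ∀ t < m, t ≠ j → ¬ CycAdj m t j → D.lt (g t) (g j) := by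
  intro t ht htj hnc
  obtain ⟨i', hi', rfl⟩ := exists_rotIndex_eq hj hi
  obtain ⟨t', ht', rfl⟩ := exists_rotIndex_eq hj ht
  have h0 := rotIndex_zero hj
  have := (h.rotate hm hj).lt_zero D (i := i') hi' (by simpa [h0] using hlt) t'
  simp only [h0] at this
  have ht0 : t' ≠ 0 := by rintro rfl; exact htj h0
  have hnc' : ¬ CycAdj m t' 0 := by
    intro hc
    apply hnc
    have := (cycAdj_rotIndex hm hj ht' (by omega : 0 < m)).2 hc
    rwa [h0] at this
  unfold CycAdj at hnc'
  exact this (by omega) (by omega)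

/-- Two vertices of a chordless cycle that both dominate something are adjacent. -/
theorem IsChordlessCycle.cycAdj_of_lt_of_lt (h : IsChordlessCycle M m g) (hm : 3 ≤ m)
    {i j i' j' : ℕ} (hi : i < m) (hj : j < m) (hi' : i' < m) (hj' : j' < m) (hne : j ≠ j')
    (hlt : D.lt (g i) (g j)) (hlt' : D.lt (g i') (g j')) : CycAdj m j j' := by
  by_contra hc
  exact D.irrefl _ (D.trans (h.lt_of_lt D hm hi hj hlt j' hj' hne.symm (fun h => hc h.symm))
    (h.lt_of_lt D hm hi' hj' hlt' j hj hne hc))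

/-- A chordless odd antipodal cycle together with its dominance edges. -/
theorem IsChordlessCycle.hasInducedCopy (h : IsChordlessCycle M m g) (hm : 3 ≤ m)
    (hubs : Set (Fin m)) (hlt : ∀ p ∈ hubs, ∃ i < m, D.lt (g i) (g p.val))
    (honly : ∀ p q : Fin m, D.lt (g p.val) (g q.val) → q ∈ hubs) :
    HasInducedCopy (withHubs (SimpleGraph.cycleGraph m) hubs) M := by
  have hub : ∀ p ∈ hubs, ∀ t : Fin m, t ≠ p → ¬ CycAdj m t p → D.lt (g t.val) (g p.val) := by
    intro p hp t htp htc
    obtain ⟨i, hi, hip⟩ := hlt p hp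
    exact h.lt_of_lt D hm hi p.2 hip t t.2 (fun he => htp (Fin.ext he)) htc
  refine ⟨fun x => g x.val, fun x y hxy => Fin.ext (h.inj _ x.2 _ y.2 hxy), ?_, ?_⟩
  · intro x y
    rw [h.antip_iff _ x.2 _ y.2]
    exact cycleGraph_adj_iff hm x y
  · intro x y
    rw [D.dom_iff]
    change (x ≠ y ∧ (x ∈ hubs ∨ y ∈ hubs) ∧ ¬ (SimpleGraph.cycleGraph m).Adj x y) ↔
      D.lt (g x.val) (g y.val) ∨ D.lt (g y.val) (g x.val)
    rw [cycleGraph_adj_iff hm]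
    constructor
    · rintro ⟨hne, h0 | h0, hnc⟩
      · exact Or.inr (hub x h0 y hne.symm (fun h => hnc h.symm))
      · exact Or.inl (hub y h0 x hne hnc)
    · intro hor
      refine ⟨?_, ?_, ?_⟩
      · rintro rfl
        exact hor.elim (D.irrefl _) (D.irrefl _)
      · exact hor.elim (fun h1 => Or.inr (honly _ _ h1)) (fun h1 => Or.inl (honly _ _ h1))
      · exact fun hc => M.disj _ _ ((h.antip_iff _ x.2 _ y.2).2 hc) ((D.dom_iff _ _).2 hor)

/-- A chordless odd antipodal cycle carrying a dominance edge spans an induced fan or an induced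
double fan. -/
theorem IsChordlessCycle.exists_fan {n : ℕ} (hn : 2 ≤ n) (h : IsChordlessCycle M (2 * n + 1) g)
    {i j : ℕ} (hi : i < 2 * n + 1) (hj : j < 2 * n + 1) (hlt : D.lt (g i) (g j)) :
    HasInducedCopy (fan n) M ∨ HasInducedCopy (doubleFan n) M := by
  have hm : 3 ≤ 2 * n + 1 := by omega
  have hzero : (0 : Fin (2 * n + 1)).val = 0 := rfl
  have hone : (1 : Fin (2 * n + 1)).val = 1 :=
    (Fin.val_one' _).trans (Nat.mod_eq_of_lt (by omega))
  -- Dominating vertices of the cycle are pairwise consecutive. On at least five vertices there are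
  -- thus at most two of them, and a rotation brings them to the positions 0 and 1.
  by_cases hcons : ∃ g' : ℕ → Γ, IsChordlessCycle M (2 * n + 1) g' ∧
      (∃ a < 2 * n + 1, D.lt (g' a) (g' 0)) ∧ ∃ b < 2 * n + 1, D.lt (g' b) (g' 1)
  · right
    obtain ⟨g', hg', ⟨a, ha, hla⟩, b, hb, hlb⟩ := hcons
    refine hg'.hasInducedCopy D hm _ ?_ ?_
    · rintro p (rfl | rfl)
      · exact ⟨a, ha, hla⟩
      · exact ⟨b, hb, hone.symm ▸ hlb⟩
    · intro p q hpq
      by_contra hcon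
      have hcon0 : q.val ≠ 0 := fun he => hcon (Or.inl (Fin.ext he))
      have hcon1 : q.val ≠ 1 := fun he => hcon (Or.inr (Fin.ext (he.trans hone.symm)))
      have h0 := hg'.cycAdj_of_lt_of_lt D hm ha (by omega) p.2 q.2 (Ne.symm hcon0) hla hpq
      have h1 := hg'.cycAdj_of_lt_of_lt D hm hb (by omega) p.2 q.2 (Ne.symm hcon1) hlb hpq
      unfold CycAdj at h0 h1
      omega
  · left
    have h' := h.rotate hm hj
    have h0 := rotIndex_zero hj
    obtain ⟨i', hi', rfl⟩ := exists_rotIndex_eq hj hi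
    set g' : ℕ → Γ := fun t => g (rotIndex (2 * n + 1) j t) with hg'
    have hla : D.lt (g' i') (g' 0) := by simpa only [hg', h0] using hlt
    refine h'.hasInducedCopy D hm _ ?_ ?_
    · rintro p rfl
      exact ⟨i', hi', hla⟩
    · intro p q hpq
      by_contra hcon
      have hcon0 : q.val ≠ 0 := fun he => hcon (Fin.ext he)
      have hc := h'.cycAdj_of_lt_of_lt D hm hi' (by omega) p.2 q.2 (Ne.symm hcon0) hla hpq
      apply hcons
      by_cases hq1 : q.val = 1
      · rw [hq1] at hpq
        exact ⟨g', h', ⟨i', hi', hla⟩, p, p.2, hpq⟩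
      -- The second dominating vertex precedes position 0, so the cycle is rotated to start at it;
      -- the old position 0 becomes 1.
      · have hqn : q.val = 2 * n := by unfold CycAdj at hc; omega
        obtain ⟨p', hp', hpp⟩ := exists_rotIndex_eq q.2 p.2
        obtain ⟨a, ha, hai⟩ := exists_rotIndex_eq q.2 hi'
        refine ⟨_, h'.rotate hm q.2, ⟨p', hp', ?_⟩, a, ha, ?_⟩
        · simpa only [rotIndex_zero q.2, hpp] using hpq
        · have h1 : rotIndex (2 * n + 1) q 1 = 0 := by unfold rotIndex; split_ifs <;> omega
          simpa only [hai, h1] using hla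

end Cycle

/-! ### Wheels and fans as sequences -/

/-- A wheel with hub `h` and rim `g 0, …, g (m - 1)` whose rim edges are antipodal and whose spokes
are dominance edges, except possibly the one at `g 0`. -/
structure IsWheel {Γ : Type u} (M : TwoColoredGraph Γ) (h : Γ) (m : ℕ) (g : ℕ → Γ) : Prop where
  inj : ∀ i < m, ∀ j < m, g i = g j → i = j
  antip : ∀ i, i + 1 < m → M.antip.Adj (g i) (g (i + 1))
  antip_last : M.antip.Adj (g (m - 1)) (g 0)
  spoke : ∀ i, 0 < i → i < m → M.dom.Adj h (g i)
  spoke_zero : M.dom.Adj h (g 0) ∨ M.antip.Adj h (g 0)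

/-- A fan with center `h` and path `q 0, …, q (N - 1)`, whose path edges and two extreme edges at
the center are antipodal and whose other edges at the center are dominance edges. -/
structure IsFan {Γ : Type u} (M : TwoColoredGraph Γ) (h : Γ) (N : ℕ) (q : ℕ → Γ) : Prop where
  inj : ∀ i < N, ∀ j < N, q i = q j → i = j
  antip : ∀ i, i + 1 < N → M.antip.Adj (q i) (q (i + 1))
  antip_zero : M.antip.Adj h (q 0)
  antip_last : M.antip.Adj h (q (N - 1))
  spoke : ∀ i, 0 < i → i + 1 < N → M.dom.Adj h (q i)

/-! ### Chords and induced copies of wheels -/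

section

variable {Γ : Type u} {M : TwoColoredGraph Γ} {h : Γ} {m : ℕ} {g : ℕ → Γ}

theorem IsWheel.spoke_all (w : IsWheel M h m g) {i : ℕ} (hi : i < m) :
    M.dom.Adj h (g i) ∨ M.antip.Adj h (g i) := by
  rcases Nat.eq_zero_or_pos i with rfl | hpos
  · exact w.spoke_zero
  · exact Or.inl (w.spoke i hpos hi)

/-- The part of a wheel cut off by a chord, on the side not containing the first rim vertex. -/
theorem IsWheel.inner (w : IsWheel M h m g) {i j : ℕ} (hij : i < j) (hj : j < m)
    (hc : M.antip.Adj (g i) (g j)) : IsWheel M h (j - i + 1) (fun t => g (i + t)) where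
  inj a ha b hb hab := by
    have := w.inj _ (by omega) _ (by omega) hab
    omega
  antip a ha := w.antip (i + a) (by omega)
  antip_last := by
    simp only [Nat.add_sub_cancel, Nat.add_zero]
    rw [show i + (j - i) = j by omega]
    exact hc.symm
  spoke a ha hb := w.spoke _ (by omega) (by omega)
  spoke_zero := w.spoke_all (by omega)

/-- The part of a wheel cut off by a chord, on the side of the first rim vertex. -/
theorem IsWheel.outer (w : IsWheel M h m g) {i j : ℕ} (hij : i < j) (hj : j < m)
    (hc : M.antip.Adj (g i) (g j)) :
    IsWheel M h (m - (j - i - 1)) (fun t => g (if t ≤ i then t else t + (j - i - 1))) where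
  inj a ha b hb hab := by
    have := w.inj _ (by split_ifs <;> omega) _ (by split_ifs <;> omega) hab
    split_ifs at this <;> omega
  antip a ha := by
    rcases lt_trichotomy a i with h1 | h1 | h1
    · rw [if_pos (by omega), if_pos (by omega)]; exact w.antip a (by omega)
    · subst h1
      rw [if_pos (by omega), if_neg (by omega), show a + 1 + (j - a - 1) = j by omega]; exact hc
    · rw [if_neg (by omega), if_neg (by omega),
        show a + 1 + (j - i - 1) = a + (j - i - 1) + 1 by omega]
      exact w.antip _ (by omega)
  antip_last := by
    rw [if_neg (by omega), if_pos (by omega),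
      show m - (j - i - 1) - 1 + (j - i - 1) = m - 1 by omega]
    exact w.antip_last
  spoke a ha hb := w.spoke _ (by split_ifs <;> omega) (by split_ifs <;> omega)
  spoke_zero := by rw [if_pos (by omega)]; exact w.spoke_zero

theorem IsWheel.antip_of_cycAdj (w : IsWheel M h m g) {i j : ℕ} (hi : i < m) (hj : j < m)
    (hc : CycAdj m i j) : M.antip.Adj (g i) (g j) := by
  have hlast := w.antip_last
  rcases hc with rfl | rfl | ⟨rfl, hm⟩ | ⟨rfl, hm⟩
  · exact w.antip _ hj
  · exact (w.antip _ hi).symm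
  · rw [show m - 1 = j by omega] at hlast; exact hlast.symm
  · rw [show m - 1 = i by omega] at hlast; exact hlast

theorem isChordlessCycle_of_forall (hinj : ∀ i < m, ∀ j < m, g i = g j → i = j)
    (h1 : ∀ i < m, ∀ j < m, CycAdj m i j → M.antip.Adj (g i) (g j))
    (h2 : ∀ i j, i < j → j < m → ¬ CycAdj m i j → ¬ M.antip.Adj (g i) (g j)) :
    IsChordlessCycle M m g where
  inj := hinj
  antip_iff i hi j hj := by
    refine ⟨fun ha => ?_, h1 i hi j hj⟩
    by_contra hc
    rcases lt_trichotomy i j with hij | rfl | hij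
    · exact h2 i j hij hj hc ha
    · exact M.antip.irrefl ha
    · exact h2 j i hij hi (fun h => hc h.symm) ha.symm

/-- An induced wheel. -/
theorem hasInducedCopy_withHubs_none (D : DominanceOrder M) (hg : IsChordlessCycle M m g)
    (hnlt : ∀ i < m, ∀ j < m, ¬ D.lt (g i) (g j))
    (hspoke : ∀ i < m, M.dom.Adj h (g i) ∨ M.antip.Adj h (g i))
    (H : SimpleGraph (Option (Fin m)))
    (hrim : ∀ x y : Fin m, H.Adj (some x) (some y) ↔ CycAdj m x y)
    (hhub : ∀ x : Fin m, H.Adj none (some x) ↔ M.antip.Adj h (g x)) :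
    HasInducedCopy (withHubs H {none}) M := by
  have hne : ∀ x : Fin m, h ≠ g x := by
    intro x he
    rcases hspoke x x.2 with h1 | h1
    · exact h1.ne he
    · exact h1.ne he
  have hant : ∀ i j : Option (Fin m), H.Adj i j ↔
      M.antip.Adj (i.elim h fun x => g x.val) (j.elim h fun x => g x.val) := by
    rintro (_ | x) (_ | y)
    · simp
    · exact hhub y
    · rw [H.adj_comm, M.antip.adj_comm]; exact hhub x
    · rw [hrim]; exact (hg.antip_iff _ x.2 _ y.2).symm
  refine ⟨fun o => o.elim h fun x => g x.val, ?_, hant, ?_⟩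
  · rintro (_ | x) (_ | y) hxy
    · rfl
    · exact absurd hxy (hne y)
    · exact absurd hxy.symm (hne x)
    · exact congrArg some (Fin.ext (hg.inj _ x.2 _ y.2 hxy))
  · intro i j
    change (i ≠ j ∧ (i ∈ ({none} : Set (Option (Fin m))) ∨ j ∈ ({none} : Set (Option (Fin m)))) ∧
      ¬ H.Adj i j) ↔ _
    rw [hant]
    rcases i with _ | x <;> rcases j with _ | y
    · simp
    · simp only [Option.elim]
      have := hspoke y y.2
      have h2 := M.disj h (g y)
      simp only [ne_eq, reduceCtorEq, not_false_eq_true, Set.mem_singleton_iff, or_false, true_and]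
      tauto
    · simp only [Option.elim]
      have := hspoke x x.2
      have h2 := M.disj h (g x)
      rw [M.antip.adj_comm, M.dom.adj_comm]
      simp only [ne_eq, reduceCtorEq, not_false_eq_true, Set.mem_singleton_iff, or_true, true_and]
      tauto
    · simp only [Option.elim, D.dom_iff]
      have h1 := hnlt _ x.2 _ y.2
      have h2 := hnlt _ y.2 _ x.2
      simp [h1, h2]

theorem fan_mem_family {n : ℕ} (hn : 2 ≤ n) :
    (⟨_, fan n⟩ : Σ U : Type, TwoColoredGraph U) ∈ family :=
  Or.inl (Or.inr ⟨n, hn, rfl⟩)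

theorem doubleFan_mem_family {n : ℕ} (hn : 2 ≤ n) :
    (⟨_, doubleFan n⟩ : Σ U : Type, TwoColoredGraph U) ∈ family :=
  Or.inr ⟨n, hn, Or.inr rfl⟩

theorem chordedFan_mem_family {n : ℕ} (hn : 2 ≤ n) :
    (⟨_, chordedFan n⟩ : Σ U : Type, TwoColoredGraph U) ∈ family :=
  Or.inr ⟨n, hn, Or.inl rfl⟩

theorem wheelZero_mem_familyZero {k : ℕ} (hk : 1 ≤ k) :
    (⟨_, wheelZero k⟩ : Σ U : Type, TwoColoredGraph U) ∈ familyZero :=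
  Or.inl ⟨k, hk, Or.inl rfl⟩

theorem wheelOne_mem_familyZero {k : ℕ} (hk : 1 ≤ k) :
    (⟨_, wheelOne k⟩ : Σ U : Type, TwoColoredGraph U) ∈ familyZero :=
  Or.inl ⟨k, hk, Or.inr rfl⟩

theorem fan_mem_familyZero {n : ℕ} (hn : 2 ≤ n) :
    (⟨_, fan n⟩ : Σ U : Type, TwoColoredGraph U) ∈ familyZero :=
  Or.inr ⟨n, hn, rfl⟩

theorem rim_adj_some {x y : Fin m} :
    (rim m).Adj (some x) (some y) ↔ (SimpleGraph.cycleGraph m).Adj x y :=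
  SimpleGraph.map_adj_apply

theorem not_rim_adj_none {x : Option (Fin m)} : ¬ (rim m).Adj none x := by
  rintro ⟨-, a, b, -, ha, -⟩
  exact absurd ha (by simp)

/-- On at least five vertices a dominance edge would span a fan or a double fan by `exists_fan`; on
three vertices all pairs are already antipodal. -/
theorem IsChordlessCycle.not_lt {D : DominanceOrder M}
    (hfam : ∀ S ∈ family, ¬ HasInducedCopy S.2 M) {k : ℕ}
    (hg : IsChordlessCycle M (2 * k + 1) g) (hk : 1 ≤ k) :
    ∀ i < 2 * k + 1, ∀ j < 2 * k + 1, ¬ D.lt (g i) (g j) := by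
  intro i hi j hj hlt
  by_cases hk2 : 2 ≤ k
  · rcases hg.exists_fan D hk2 hi hj hlt with h1 | h1
    · exact hfam _ (fan_mem_family hk2) h1
    · exact hfam _ (doubleFan_mem_family hk2) h1
  · have hne : i ≠ j := by rintro rfl; exact D.irrefl _ hlt
    refine D.not_antip_of_lt hlt ((hg.antip_iff i hi j hj).2 ?_)
    unfold CycAdj
    omega

/-- A graph without induced members of the family contains no wheel. -/
theorem not_isWheel (D : DominanceOrder M) (hfam : ∀ S ∈ family, ¬ HasInducedCopy S.2 M) :
    ∀ k, 1 ≤ k → ∀ h g, ¬ IsWheel M h (2 * k + 1) g := by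
  intro k
  induction k using Nat.strong_induction_on with
  | _ k ih =>
  intro hk h g w
  have hm : 3 ≤ 2 * k + 1 := by omega
  -- An antipodal chord cuts the odd rim into two cycles of different parity. The odd one is the rim
  -- of a smaller wheel with the same hub, still with at most one antipodal spoke.
  by_cases hch : ∃ i j, i < j ∧ j < 2 * k + 1 ∧ ¬ CycAdj (2 * k + 1) i j ∧ M.antip.Adj (g i) (g j)
  · obtain ⟨i, j, hij, hj, hnc, ha⟩ := hch
    unfold CycAdj at hnc
    rcases Nat.even_or_odd' (j - i) with ⟨k', hk' | hk'⟩
    · have := w.inner hij hj ha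
      rw [hk'] at this
      exact ih k' (by omega) (by omega) _ _ this
    · have := w.outer hij hj ha
      rw [show 2 * k + 1 - (j - i - 1) = 2 * (k - k') + 1 by omega] at this
      exact ih (k - k') (by omega) (by omega) _ _ this
  · push Not at hch
    have hg : IsChordlessCycle M (2 * k + 1) g :=
      isChordlessCycle_of_forall w.inj
        (fun i hi j hj hc => w.antip_of_cycAdj hi hj hc)
        (fun i j hij hj hc => hch i j hij hj hc)
    have hnlt := hg.not_lt (D := D) hfam hk
    have hpos : ∀ x : Fin (2 * k + 1), x ≠ 0 → 0 < x.val := fun x hx =>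
      Nat.pos_of_ne_zero fun he => hx (Fin.ext he)
    rcases w.spoke_zero with h0 | h0
    · refine hfam _ (Or.inl (wheelZero_mem_familyZero hk))
        (hasInducedCopy_withHubs_none D hg hnlt (fun i hi => w.spoke_all hi) _ ?_ ?_)
      · intro x y
        rw [rim_adj_some, cycleGraph_adj_iff hm]
      · intro x
        refine iff_of_false not_rim_adj_none fun ha => ?_
        by_cases hx : x = 0
        · subst hx; exact M.disj _ _ ha h0
        · exact M.disj _ _ ha (w.spoke _ (hpos x hx) x.2)
    · refine hfam _ (Or.inl (wheelOne_mem_familyZero hk))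
        (hasInducedCopy_withHubs_none D hg hnlt (fun i hi => w.spoke_all hi) _ ?_ ?_)
      · intro x y
        rw [SimpleGraph.sup_adj, rim_adj_some, cycleGraph_adj_iff hm, SimpleGraph.edge_adj]
        simp
      · intro x
        rw [SimpleGraph.sup_adj, SimpleGraph.edge_adj]
        simp only [not_rim_adj_none, false_or]
        by_cases hx : x = 0
        · subst hx; simpa using h0
        · have h2 : ¬ M.antip.Adj h (g x) := fun ha => M.disj _ _ ha (w.spoke _ (hpos x hx) x.2)
          simpa [h2] using hx

end

/-! ### Chords and induced copies of fans -/

section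

variable {Γ : Type u} {M : TwoColoredGraph Γ} {h : Γ} {N : ℕ} {q : ℕ → Γ}

theorem IsFan.reverse (w : IsFan M h N q) : IsFan M h N (fun t => q (N - 1 - t)) where
  inj i hi j hj hij := by
    have := w.inj _ (by omega) _ (by omega) hij
    omega
  antip i hi := by
    have := (w.antip (N - 1 - (i + 1)) (by omega)).symm
    rwa [show N - 1 - (i + 1) + 1 = N - 1 - i by omega] at this
  antip_zero := w.antip_last
  antip_last := by simpa using w.antip_zero
  spoke i hi hi' := w.spoke _ (by omega) (by omega)

/-- The shorter fan obtained from a chord of the path. -/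
theorem IsFan.outer (w : IsFan M h N q) {i j : ℕ} (hij : i < j) (hj : j < N)
    (hne : ¬ (i = 0 ∧ j + 1 = N)) (hc : M.antip.Adj (q i) (q j)) :
    IsFan M h (N - (j - i - 1)) (fun t => q (if t ≤ i then t else t + (j - i - 1))) where
  inj a ha b hb hab := by
    have := w.inj _ (by split_ifs <;> omega) _ (by split_ifs <;> omega) hab
    split_ifs at this <;> omega
  antip a ha := by
    rcases lt_trichotomy a i with h1 | h1 | h1
    · rw [if_pos (by omega), if_pos (by omega)]; exact w.antip a (by omega)
    · subst h1
      rw [if_pos (by omega), if_neg (by omega), show a + 1 + (j - a - 1) = j by omega]; exact hc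
    · rw [if_neg (by omega), if_neg (by omega),
        show a + 1 + (j - i - 1) = a + (j - i - 1) + 1 by omega]
      exact w.antip _ (by omega)
  antip_zero := by rw [if_pos (by omega)]; exact w.antip_zero
  antip_last := by
    rw [if_neg (by omega), show N - (j - i - 1) - 1 + (j - i - 1) = N - 1 by omega]
    exact w.antip_last
  spoke a ha hb := w.spoke _ (by split_ifs <;> omega) (by split_ifs <;> omega)

/-- The wheel obtained from a chord of the path of a fan. -/
theorem IsFan.inner (w : IsFan M h N q) {i j : ℕ} (hij : i < j) (hj : j + 1 < N)
    (hc : M.antip.Adj (q i) (q j)) : IsWheel M h (j - i + 1) (fun t => q (i + t)) where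
  inj a ha b hb hab := by
    have := w.inj _ (by omega) _ (by omega) hab
    omega
  antip a ha := w.antip (i + a) (by omega)
  antip_last := by
    simp only [Nat.add_sub_cancel, Nat.add_zero]
    rw [show i + (j - i) = j by omega]
    exact hc.symm
  spoke a ha hb := w.spoke _ (by omega) (by omega)
  spoke_zero := by
    rcases Nat.eq_zero_or_pos i with rfl | hpos
    · exact Or.inr w.antip_zero
    · exact Or.inl (w.spoke _ (by omega) (by omega))

theorem isWheel_three {a b c : Γ} (hab : M.antip.Adj a b) (hbc : M.antip.Adj b c)
    (hca : M.antip.Adj c a) (hb : M.dom.Adj h b) (hc : M.dom.Adj h c)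
    (ha : M.dom.Adj h a ∨ M.antip.Adj h a) :
    IsWheel M h (2 * 1 + 1) (fun t => if t = 0 then a else if t = 1 then b else c) where
  inj i hi j hj hij := by
    have h1 := hab.ne
    have h2 := hbc.ne
    have h3 := hca.ne
    interval_cases i <;> interval_cases j <;> simp_all
  antip i hi := by
    have : i < 2 := by omega
    interval_cases i <;> simpa
  antip_last := by simpa
  spoke i hi hi' := by interval_cases i <;> simpa
  spoke_zero := by simpa

/-- Dominance along the path of a fan with an antipodal edge between its ends. -/
theorem IsFan.exists_isWheel_of_lt (D : DominanceOrder M) (w : IsFan M h N q) (hN : 4 ≤ N)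
    (hend : M.antip.Adj (q 0) (q (N - 1)))
    (hch : ∀ i j, i < j → j < N → M.antip.Adj (q i) (q j) → j = i + 1 ∨ (i = 0 ∧ j + 1 = N))
    {i j : ℕ} (hi : i < N) (hij : j < i) (hlt : D.lt (q i) (q j)) :
    ∃ h g, IsWheel M h (2 * 1 + 1) g := by
  -- Dominance by `q j` climbs the path, since the path has no other antipodal chords. For `j = 0`
  -- it stops before `q (N - 1)`, which is antipodal to `q 0`.
  have hup : ∀ s, i + s < N → (j = 0 → i + s + 1 < N) → D.lt (q (i + s)) (q j) := by
    intro s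
    induction s with
    | zero => intro _ _; exact hlt
    | succ s ih =>
      intro hs hs'
      rcases D.antip_or_lt (ih (by omega) (by omega)) (w.antip (i + s) (by omega)) with h1 | h1
      · exfalso
        have hlt' := ih (by omega) (by omega)
        rcases hch j (i + s + 1) (by omega) (by omega) h1.symm with h2 | h2
        · rw [show i + s = j by omega] at hlt'
          exact D.irrefl _ hlt'
        · omega
      · exact h1
  by_cases hj0 : j = 0
  · subst hj0
    have hi2 : i + 1 < N := by
      by_contra hcon
      rw [show i = N - 1 by omega] at hlt
      exact D.not_antip_of_lt hlt hend.symm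
    have hlt2 := hup (N - 2 - i) (by omega) (by omega)
    rw [show i + (N - 2 - i) = N - 2 by omega] at hlt2
    have h2 := w.antip (N - 2) (by omega)
    rw [show N - 2 + 1 = N - 1 by omega] at h2
    -- The hub is `q (N - 2)` and the rim is `q (N - 1)`, `h`, `q 0`; only the spoke to `q (N - 1)`
    -- is antipodal.
    exact ⟨q (N - 2), _, isWheel_three w.antip_last.symm w.antip_zero hend
      (w.spoke (N - 2) (by omega) (by omega)).symm ((D.dom_iff _ _).2 (Or.inl hlt2)) (Or.inr h2)⟩
  · have hlt2 := hup (N - 1 - i) (by omega) (by omega)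
    rw [show i + (N - 1 - i) = N - 1 by omega] at hlt2
    have hdom := w.spoke j (by omega) (by omega)
    have hh : D.lt h (q j) := by
      rcases D.antip_or_lt hlt2 w.antip_last.symm with h1 | h1
      · exact absurd hdom (M.disj _ _ h1)
      · exact h1
    -- The hub is `q j` and the rim is `q 0`, `h`, `q (N - 1)`; the spoke to `q 0` may have either
    -- color.
    refine ⟨q j, _, isWheel_three w.antip_zero.symm w.antip_last hend.symm hdom.symm
      ((D.dom_iff _ _).2 (Or.inr hlt2)) ?_⟩
    rcases D.antip_or_lt hh w.antip_zero with h1 | h1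
    · exact Or.inr h1.symm
    · exact Or.inl ((D.dom_iff _ _).2 (Or.inr h1))

/-- With the ends of the path joined, only dominance edges inside the path could prevent an induced
chorded fan. Such an edge yields a wheel with three rim vertices, by `IsFan.exists_isWheel_of_lt`
for the fan or its reversal. -/
theorem not_isFan_of_chord (D : DominanceOrder M) (hfam : ∀ S ∈ family, ¬ HasInducedCopy S.2 M)
    {n : ℕ} (hn : 2 ≤ n) (w : IsFan M h (2 * n) q)
    (hch : ∀ i j, i < j → j < 2 * n → M.antip.Adj (q i) (q j) →
      j = i + 1 ∨ (i = 0 ∧ j + 1 = 2 * n))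
    (hend : M.antip.Adj (q 0) (q (2 * n - 1))) : False := by
  have hnw := not_isWheel D hfam 1 le_rfl
  have hnlt1 : ∀ i < 2 * n, ∀ j < i, ¬ D.lt (q i) (q j) := by
    intro i hi j hij hlt
    obtain ⟨h', g', hw⟩ := w.exists_isWheel_of_lt D (by omega) hend hch hi hij hlt
    exact hnw _ _ hw
  have hnlt2 : ∀ i < 2 * n, ∀ j < i, ¬ D.lt (q j) (q i) := by
    intro i hi j hij hlt
    have hi' : 2 * n - 1 - (2 * n - 1 - i) = i := by omega
    have hj' : 2 * n - 1 - (2 * n - 1 - j) = j := by omega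
    obtain ⟨h', g', hw⟩ := w.reverse.exists_isWheel_of_lt D (by omega)
      (by simpa using hend.symm) (fun a b hab hb hadj => by
        have := hch _ _ (by omega) (by omega) hadj.symm
        omega) (i := 2 * n - 1 - j) (j := 2 * n - 1 - i) (by omega) (by omega)
      (by simpa only [hi', hj'] using hlt)
    exact hnw _ _ hw
  have hnlt : ∀ i < 2 * n, ∀ j < 2 * n, ¬ D.lt (q i) (q j) := by
    intro i hi j hj hlt
    rcases lt_trichotomy i j with h1 | rfl | h1
    · exact hnlt2 j hj i h1 hlt
    · exact D.irrefl _ hlt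
    · exact hnlt1 i hi j h1 hlt
  have hm : 3 ≤ 2 * n + 1 := by omega
  have hone : (1 : Fin (2 * n + 1)).val = 1 :=
    (Fin.val_one' _).trans (Nat.mod_eq_of_lt (by omega))
  have hH : ∀ x y : Fin (2 * n + 1), (SimpleGraph.cycleGraph (2 * n + 1) ⊔
      SimpleGraph.edge 1 (Fin.last (2 * n))).Adj x y ↔ CycAdj (2 * n + 1) x y ∨
      (x.val = 1 ∧ y.val = 2 * n) ∨ (x.val = 2 * n ∧ y.val = 1) := by
    intro x y
    rw [SimpleGraph.sup_adj, cycleGraph_adj_iff hm, SimpleGraph.edge_adj]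
    simp only [Fin.ext_iff, hone, Fin.val_last, ne_eq]
    refine or_congr_right ?_
    omega
  have hhub : ∀ y < 2 * n, (M.antip.Adj h (q y) ↔ y = 0 ∨ y + 1 = 2 * n) := by
    intro y hy
    constructor
    · intro ha
      by_contra hcon
      exact M.disj _ _ ha (w.spoke y (by omega) (by omega))
    · rintro (rfl | h1)
      · exact w.antip_zero
      · rw [show y = 2 * n - 1 by omega]; exact w.antip_last
  have hpath : ∀ x < 2 * n, ∀ y < 2 * n, (M.antip.Adj (q x) (q y) ↔ CycAdj (2 * n) x y) := by
    intro x hx y hy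
    constructor
    · intro ha
      rcases lt_trichotomy x y with h1 | rfl | h1
      · have := hch x y h1 hy ha; unfold CycAdj; omega
      · exact absurd ha M.antip.irrefl
      · have := hch y x h1 hx ha.symm; unfold CycAdj; omega
    · rintro (rfl | rfl | ⟨rfl, h1⟩ | ⟨rfl, h1⟩)
      · exact w.antip _ hy
      · exact (w.antip _ hx).symm
      · rw [show y = 2 * n - 1 by omega]; exact hend
      · rw [show x = 2 * n - 1 by omega]; exact hend.symm
  have hhq : ∀ y < 2 * n, h ≠ q y := by
    rintro y hy rfl
    by_cases hy' : y = 0 ∨ y + 1 = 2 * n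
    · exact M.antip.irrefl ((hhub y hy).2 hy')
    · exact M.dom.irrefl (w.spoke y (by omega) (by omega))
  have hant : ∀ x y : Fin (2 * n + 1), (SimpleGraph.cycleGraph (2 * n + 1) ⊔
      SimpleGraph.edge 1 (Fin.last (2 * n))).Adj x y ↔
      M.antip.Adj (if x.val = 0 then h else q (x.val - 1))
        (if y.val = 0 then h else q (y.val - 1)) := by
    intro x y
    have hx := x.2
    have hy := y.2
    rw [hH]
    split_ifs with h1 h2 h2
    · simp only [SimpleGraph.irrefl, iff_false]; unfold CycAdj; omega
    · rw [hhub _ (by omega)]; unfold CycAdj; omega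
    · rw [M.antip.adj_comm, hhub _ (by omega)]; unfold CycAdj; omega
    · rw [hpath _ (by omega) _ (by omega)]; unfold CycAdj; omega
  refine hfam _ (chordedFan_mem_family hn)
    ⟨fun x => if x.val = 0 then h else q (x.val - 1), ?_, hant, ?_⟩
  · intro x y hxy
    have hx := x.2
    have hy := y.2
    simp only at hxy
    split_ifs at hxy with h1 h2 h2
    · exact Fin.ext (by omega)
    · exact absurd hxy (hhq _ (by omega))
    · exact absurd hxy.symm (hhq _ (by omega))
    · have := w.inj _ (by omega) _ (by omega) hxy
      exact Fin.ext (by omega)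
  · intro x y
    have hx := x.2
    have hy := y.2
    change (x ≠ y ∧ (x = 0 ∨ y = 0) ∧ ¬ (SimpleGraph.cycleGraph (2 * n + 1) ⊔
      SimpleGraph.edge 1 (Fin.last (2 * n))).Adj x y) ↔ _
    rw [hant, Ne, Fin.ext_iff, Fin.ext_iff, Fin.ext_iff]
    simp only [Fin.val_zero]
    split_ifs with h1 h2 h2
    · simp [h1, h2]
    · rw [hhub _ (by omega)]
      have h3 : y.val - 1 = 0 ∨ y.val - 1 + 1 = 2 * n → ¬ M.dom.Adj h (q (y.val - 1)) :=
        fun h4 => M.disj _ _ ((hhub _ (by omega)).2 h4)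
      have h5 := w.spoke (y.val - 1)
      constructor
      · intro h6; exact h5 (by omega) (by omega)
      · intro h6
        exact ⟨by omega, Or.inl h1, fun h7 => h3 h7 h6⟩
    · rw [M.antip.adj_comm, M.dom.adj_comm, hhub _ (by omega)]
      have h3 : x.val - 1 = 0 ∨ x.val - 1 + 1 = 2 * n → ¬ M.dom.Adj h (q (x.val - 1)) :=
        fun h4 => M.disj _ _ ((hhub _ (by omega)).2 h4)
      have h5 := w.spoke (x.val - 1)
      constructor
      · intro h6; exact h5 (by omega) (by omega)
      · intro h6
        exact ⟨by omega, Or.inr h2, fun h7 => h3 h7 h6⟩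
    · rw [D.dom_iff]
      have h3 := hnlt (x.val - 1) (by omega) (y.val - 1) (by omega)
      have h4 := hnlt (y.val - 1) (by omega) (x.val - 1) (by omega)
      simp [h1, h2, h3, h4]

/-- A graph without induced members of the family contains no fan. -/
theorem not_isFan (D : DominanceOrder M) (hfam : ∀ S ∈ family, ¬ HasInducedCopy S.2 M) :
    ∀ n, 2 ≤ n → ∀ h q, ¬ IsFan M h (2 * n) q := by
  intro n
  induction n using Nat.strong_induction_on with
  | _ n ih =>
  intro hn h q w
  have hnw := not_isWheel D hfam
  by_cases hch : ∀ i j, i < j → j < 2 * n → M.antip.Adj (q i) (q j) →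
      j = i + 1 ∨ (i = 0 ∧ j + 1 = 2 * n)
  · by_cases hend : M.antip.Adj (q 0) (q (2 * n - 1))
    · exact not_isFan_of_chord D hfam hn w hch hend
    -- Without any chord of the path, the center followed by the path is a chordless odd antipodal
    -- cycle. Its dominance spokes contradict `IsChordlessCycle.not_lt`.
    · have hg : IsChordlessCycle M (2 * n + 1) (fun t => if t = 0 then h else q (t - 1)) := by
        have hhq : ∀ y < 2 * n, h ≠ q y := by
          rintro y hy rfl
          by_cases hy0 : y = 0
          · subst hy0; exact M.antip.irrefl w.antip_zero
          by_cases hy1 : y = 2 * n - 1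
          · subst hy1; exact M.antip.irrefl w.antip_last
          exact M.dom.irrefl (w.spoke y (by omega) (by omega))
        refine isChordlessCycle_of_forall ?_ ?_ ?_
        · intro x hx y hy hxy
          split_ifs at hxy with h1 h2 h2
          · omega
          · exact absurd hxy (hhq _ (by omega))
          · exact absurd hxy.symm (hhq _ (by omega))
          · have := w.inj _ (by omega) _ (by omega) hxy
            omega
        · have key : ∀ x < 2 * n + 1, ∀ y < 2 * n + 1, (y = x + 1 ∨ (x = 0 ∧ y + 1 = 2 * n + 1)) →
              M.antip.Adj (if x = 0 then h else q (x - 1)) (if y = 0 then h else q (y - 1)) := by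
            rintro x hx y hy (rfl | ⟨rfl, h1⟩)
            · rcases Nat.eq_zero_or_pos x with rfl | hpos
              · simpa using w.antip_zero
              · rw [if_neg (by omega), if_neg (by omega)]
                have := w.antip (x - 1) (by omega)
                rwa [show x - 1 + 1 = x + 1 - 1 by omega] at this
            · rw [if_pos rfl, if_neg (by omega), show y - 1 = 2 * n - 1 by omega]
              exact w.antip_last
          intro x hx y hy hc
          by_cases h1 : y = x + 1 ∨ (x = 0 ∧ y + 1 = 2 * n + 1)
          · exact key x hx y hy h1
          · exact (key y hy x hx (by unfold CycAdj at hc; omega)).symm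
        · intro x y hxy hy hc ha
          unfold CycAdj at hc
          rw [if_neg (show ¬ y = 0 by omega)] at ha
          split_ifs at ha with h1
          · exact M.disj _ _ ha (w.spoke (y - 1) (by omega) (by omega))
          · rcases hch _ _ (by omega) (by omega) ha with h2 | h2
            · omega
            · rw [h2.1, show y - 1 = 2 * n - 1 by omega] at ha
              exact hend ha
      have hnlt := hg.not_lt (D := D) hfam (by omega)
      rcases (D.dom_iff _ _).1 (w.spoke 1 (by omega) (by omega)) with h1 | h1
      · exact hnlt 0 (by omega) 2 (by omega) (by simpa using h1)
      · exact hnlt 2 (by omega) 0 (by omega) (by simpa using h1)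
  · push Not at hch
    obtain ⟨i, j, hij, hj, ha, h1, h2⟩ := hch
    -- At even distance the chord cuts off an odd wheel containing at most one end of the path; the
    -- fan is reversed first if that is the last vertex. At odd distance the bypass leaves a shorter
    -- fan whose path still has even order.
    rcases Nat.even_or_odd' (j - i) with ⟨k, hk | hk⟩
    · by_cases hjl : j + 1 < 2 * n
      · have := w.inner hij hjl ha
        rw [hk] at this
        exact hnw k (by omega) _ _ this
      · have hi' : 2 * n - 1 - (2 * n - 1 - i) = i := by omega
        have hj' : 2 * n - 1 - (2 * n - 1 - j) = j := by omega
        have := w.reverse.inner (i := 2 * n - 1 - j) (j := 2 * n - 1 - i)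
          (by omega) (by omega) (by simpa only [hi', hj'] using ha.symm)
        rw [show 2 * n - 1 - i - (2 * n - 1 - j) = 2 * k by omega] at this
        exact hnw k (by omega) _ _ this
    · have := w.outer hij hj (fun h3 => h2 h3.1 h3.2) ha
      rw [show 2 * n - (j - i - 1) = 2 * (n - k) by omega] at this
      exact ih (n - k) (by omega) (by omega) _ _ this

end

/-! ### Odd cycles -/

/-- A graph that is not bipartite contains an odd cycle. -/
theorem exists_odd_cycle {X : Type u} (H : SimpleGraph X) (hH : ¬ H.Colorable 2) :
    ∃ k, 1 ≤ k ∧ ∃ g : ℕ → X, (∀ i < 2 * k + 1, ∀ j < 2 * k + 1, g i = g j → i = j) ∧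
      ∀ i < 2 * k + 1, ∀ j < 2 * k + 1, CycAdj (2 * k + 1) i j → H.Adj (g i) (g j) := by
  classical
  -- A closed walk of least odd length is a cycle: a repeated vertex would split it into two shorter
  -- closed walks, one of them odd.
  have hex : ∃ m, Odd m ∧ ∃ g : ℕ → X, (∀ i < m, H.Adj (g i) (g (i + 1))) ∧ g m = g 0 := by
    rw [SimpleGraph.two_colorable_iff_forall_loop_even] at hH
    push Not at hH
    obtain ⟨x, p, hp⟩ := hH
    refine ⟨p.length, Nat.not_even_iff_odd.1 hp, p.getVert, fun i hi => p.adj_getVert_succ hi, ?_⟩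
    simp
  obtain ⟨hodd, g, hadj, hclosed⟩ := Nat.find_spec hex
  have hmin := fun {m} => Nat.find_min hex (m := m)
  set m := Nat.find hex
  obtain ⟨k, hk⟩ := hodd
  have hk1 : 1 ≤ k := by
    by_contra hcon
    have h1 := hadj 0 (by omega)
    rw [show m = 0 + 1 by omega] at hclosed
    rw [hclosed] at h1
    exact H.irrefl h1
  have hinj : ∀ i j, i < j → j < m → g i ≠ g j := by
    intro i j hij hj he
    rcases Nat.even_or_odd (j - i) with hev | hod
    · refine hmin (m := m - (j - i)) (by omega) ⟨?_, fun t => g (if t ≤ i then t else t + (j - i)),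
        ?_, ?_⟩
      · rw [Nat.odd_sub (by omega)]
        exact ⟨fun _ => hev, fun _ => ⟨k, hk⟩⟩
      · intro t ht
        beta_reduce
        rcases lt_trichotomy t i with h1 | h1 | h1
        · rw [if_pos (by omega), if_pos (by omega)]; exact hadj t (by omega)
        · subst h1
          rw [if_pos le_rfl, if_neg (by omega), he, show t + 1 + (j - t) = j + 1 by omega]
          exact hadj j hj
        · rw [if_neg (by omega), if_neg (by omega),
            show t + 1 + (j - i) = t + (j - i) + 1 by omega]
          exact hadj _ (by omega)
      · beta_reduce
        rw [if_neg (by omega), if_pos (by omega), show m - (j - i) + (j - i) = m by omega]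
        exact hclosed
    · refine hmin (m := j - i) (by omega) ⟨hod, fun t => g (i + t), ?_, ?_⟩
      · intro t ht
        exact hadj (i + t) (by omega)
      · simp only [Nat.add_zero]
        rw [show i + (j - i) = j by omega, he]
  refine ⟨k, hk1, g, ?_, ?_⟩
  · intro i hi j hj he
    rcases lt_trichotomy i j with h1 | h1 | h1
    · exact absurd he (hinj i j h1 (by omega))
    · exact h1
    · exact absurd he.symm (hinj j i h1 (by omega))
  · have hlast : H.Adj (g (2 * k)) (g 0) := by
      have := hadj (2 * k) (by omega)
      rwa [← hk, hclosed] at this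
    rintro i hi j hj (rfl | rfl | ⟨rfl, h1⟩ | ⟨rfl, h1⟩)
    · exact hadj i (by omega)
    · exact (hadj j (by omega)).symm
    · rw [show j = 2 * k by omega]; exact hlast.symm
    · rw [show i = 2 * k by omega]; exact hlast

/-! ### Colorings -/

/-- An order on the vertices of a two-edge-colored graph together with the sets of vertices of the
separator seen from them. -/
structure AttachmentSystem {Γ : Type u} (M : TwoColoredGraph Γ) (V : Type v) extends
    DominanceOrder M where
  nbr : Γ → Set V
  mono : ∀ {i j}, lt i j → nbr i ⊆ nbr j
  attached_iff : ∀ {i j}, i ≠ j → ((nbr i ∩ nbr j).Nonempty ↔ M.antip.Adj i j ∨ M.dom.Adj i j)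

/-- Antipodal vertices get distinct colors, and every vertex of the separator sees at most two
colors. -/
structure IsGoodColoring {Γ : Type u} (M : TwoColoredGraph Γ) {V : Type v} (nbr : Γ → Set V)
    {C : Type*} (f : Γ → C) : Prop where
  ne_of_antip : ∀ {a b}, M.antip.Adj a b → f a ≠ f b
  two_colors : ∀ {x a b c}, x ∈ nbr a → x ∈ nbr b → x ∈ nbr c →
    f a = f b ∨ f b = f c ∨ f a = f c

section

variable {Γ : Type u} {M : TwoColoredGraph Γ} {V : Type v}

/-- The constraint graph of the elements below `u`: it is bipartite, with the elements that are
antipodal to something antipodal to `u` in the same class. -/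
theorem DominanceOrder.exists_bipartition (D : DominanceOrder M) (u : Γ)
    (hw : ∀ k, 1 ≤ k → ∀ g, ¬ IsWheel M u (2 * k + 1) g)
    (hf : ∀ n, 2 ≤ n → ∀ q, ¬ IsFan M u (2 * n) q) :
    ∃ t : Γ → Prop, (∀ a b, D.lt a u → D.lt b u → M.antip.Adj a b → (t a ↔ ¬ t b)) ∧
      ∀ a d, D.lt a u → M.antip.Adj d u → M.antip.Adj a d → t a := by
  -- The extra vertex `none` is joined to the elements whose class is prescribed, so that any
  -- 2-coloring puts all of them into the class opposite to `none`.
  let H : SimpleGraph (Option Γ) :=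
    { Adj := fun x y => match x, y with
        | none, none => False
        | none, some a => D.lt a u ∧ ∃ d, M.antip.Adj d u ∧ M.antip.Adj a d
        | some a, none => D.lt a u ∧ ∃ d, M.antip.Adj d u ∧ M.antip.Adj a d
        | some a, some b => D.lt a u ∧ D.lt b u ∧ M.antip.Adj a b
      symm := ⟨by
        rintro (_ | a) (_ | b) h
        · exact h
        · exact h
        · exact h
        · exact ⟨h.2.1, h.1, h.2.2.symm⟩⟩
      loopless := ⟨by
        rintro (_ | a) h
        · exact h
        · exact M.antip.irrefl h.2.2⟩ }
  have hdom : ∀ {a}, D.lt a u → M.dom.Adj u a := fun h => (D.dom_iff _ _).2 (Or.inr h)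
  by_cases hcol : H.Colorable 2
  · obtain ⟨c⟩ := hcol
    refine ⟨fun a => c (some a) ≠ c none, ?_, ?_⟩
    · intro a b ha hb hab
      have h1 : c (some a) ≠ c (some b) := c.valid (show H.Adj (some a) (some b) from ⟨ha, hb, hab⟩)
      have h2 : ∀ x y z : Fin 2, x ≠ y → (x ≠ z ↔ ¬ y ≠ z) := by decide
      exact h2 _ _ _ h1
    · intro a d ha hd had
      exact c.valid (show H.Adj (some a) none from ⟨ha, d, hd, had⟩)
  · exfalso
    obtain ⟨k, hk, g, hinj, hadj⟩ := exists_odd_cycle H hcol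
    have hm : 3 ≤ 2 * k + 1 := by omega
    by_cases hnone : ∃ s < 2 * k + 1, g s = none
    · obtain ⟨s, hs, hgs⟩ := hnone
      let g' : ℕ → Option Γ := fun t => g (rotIndex (2 * k + 1) s t)
      have hg'0 : g' 0 = none := by simp only [g', rotIndex_zero hs, hgs]
      have hinj' : ∀ i < 2 * k + 1, ∀ j < 2 * k + 1, g' i = g' j → i = j := fun i hi j hj h =>
        rotIndex_inj hi hj (hinj _ (rotIndex_lt hs hi) _ (rotIndex_lt hs hj) h)
      have hadj' : ∀ i < 2 * k + 1, ∀ j < 2 * k + 1, CycAdj (2 * k + 1) i j → H.Adj (g' i) (g' j) :=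
        fun i hi j hj h => hadj _ (rotIndex_lt hs hi) _ (rotIndex_lt hs hj)
          ((cycAdj_rotIndex hm hs hi hj).2 h)
      let p : ℕ → Γ := fun i => (g' i).getD u
      have hp : ∀ i, 0 < i → i < 2 * k + 1 → g' i = some (p i) := by
        intro i hi hi'
        rcases h1 : g' i with _ | a
        · exact absurd (hinj' i hi' 0 (by omega) (h1.trans hg'0.symm)) (by omega)
        · simp [p, h1]
      have hpadj : ∀ i, 0 < i → i + 1 < 2 * k + 1 →
          D.lt (p i) u ∧ D.lt (p (i + 1)) u ∧ M.antip.Adj (p i) (p (i + 1)) := by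
        intro i hi hi'
        have := hadj' i (by omega) (i + 1) hi' (Or.inl rfl)
        rw [hp i hi (by omega), hp (i + 1) (by omega) hi'] at this
        exact this
      have hplt : ∀ i, 0 < i → i < 2 * k + 1 → D.lt (p i) u := by
        intro i hi hi'
        by_cases h1 : i + 1 < 2 * k + 1
        · exact (hpadj i hi h1).1
        · have := (hpadj (i - 1) (by omega) (by omega)).2.1
          rwa [show i - 1 + 1 = i by omega] at this
      have hpinj : ∀ i, 0 < i → i < 2 * k + 1 → ∀ j, 0 < j → j < 2 * k + 1 → p i = p j → i = j := by
        intro i hi hi' j hj hj' h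
        exact hinj' i hi' j hj' (by rw [hp i hi hi', hp j hj hj', h])
      have h1 := hadj' 0 (by omega) 1 (by omega) (Or.inl rfl)
      rw [hg'0, hp 1 (by omega) (by omega)] at h1
      obtain ⟨-, d, hdu, hd⟩ := h1
      have h2 := hadj' 0 (by omega) (2 * k) (by omega) (Or.inr (Or.inr (Or.inl ⟨rfl, rfl⟩)))
      rw [hg'0, hp (2 * k) (by omega) (by omega)] at h2
      obtain ⟨-, d', hdu', hd'⟩ := h2
      have hne : ∀ {x}, M.antip.Adj x u → ∀ i, 0 < i → i < 2 * k + 1 → x ≠ p i := by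
        rintro x hx i hi hi' rfl
        exact D.not_antip_of_lt (hplt i hi hi') hx
      -- On an odd cycle through `none`, the two neighbors of `none` have witnesses `d` and `d'`
      -- antipodal to `u`. If these agree, `d` replaces `none` and gives a wheel at `u` with one
      -- antipodal spoke. Otherwise `d, p 1, …, p (2k), d'` is the path of a fan at `u`, of order
      -- `2(k + 1)`.
      by_cases hdd : d = d'
      · subst hdd
        refine hw k hk (fun i => if i = 0 then d else p i) ⟨?_, ?_, ?_, ?_, ?_⟩
        · intro i hi j hj hij
          split_ifs at hij with a b b
          · omega
          · exact absurd hij (hne hdu j (by omega) hj)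
          · exact absurd hij.symm (hne hdu i (by omega) hi)
          · exact hpinj i (by omega) hi j (by omega) hj hij
        · intro i hi
          rcases Nat.eq_zero_or_pos i with rfl | hpos
          · simpa using hd.symm
          · rw [if_neg (by omega), if_neg (by omega)]
            exact (hpadj i hpos hi).2.2
        · simp only [Nat.add_sub_cancel, if_true]
          rw [if_neg (by omega)]
          exact hd'
        · intro i hi hi'
          rw [if_neg (by omega)]
          exact hdom (hplt i hi hi')
        · right
          simpa using hdu.symm
      · refine hf (k + 1) (by omega)
          (fun i => if i = 0 then d else if i = 2 * k + 1 then d' else p i) ⟨?_, ?_, ?_, ?_, ?_⟩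
        · intro i hi j hj hij
          split_ifs at hij with a b c e e c e e
          · omega
          · exact absurd hij hdd
          · exact absurd hij (hne hdu j (by omega) (by omega))
          · exact absurd hij.symm hdd
          · omega
          · exact absurd hij (hne hdu' j (by omega) (by omega))
          · exact absurd hij.symm (hne hdu i (by omega) (by omega))
          · exact absurd hij.symm (hne hdu' i (by omega) (by omega))
          · exact hpinj i (by omega) (by omega) j (by omega) (by omega) hij
        · intro i hi
          rcases Nat.eq_zero_or_pos i with rfl | hpos
          · rw [if_pos rfl, if_neg (by omega), if_neg (by omega)]
            exact hd.symm
          · rw [if_neg (by omega), if_neg (by omega), if_neg (by omega)]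
            split_ifs with h3
            · rw [show i = 2 * k by omega]
              exact hd'
            · exact (hpadj i hpos (by omega)).2.2
        · simpa using hdu.symm
        · rw [if_neg (by omega), if_pos (by omega)]
          exact hdu'.symm
        · intro i hi hi'
          rw [if_neg (by omega), if_neg (by omega)]
          exact hdom (hplt i hi (by omega))
    -- An odd cycle avoiding `none` lies strictly below `u` and is the rim of a wheel with dominance
    -- spokes.
    · push Not at hnone
      let p : ℕ → Γ := fun i => (g i).getD u
      have hp : ∀ i, i < 2 * k + 1 → g i = some (p i) := by
        intro i hi
        rcases h1 : g i with _ | a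
        · exact absurd h1 (hnone i hi)
        · simp [p, h1]
      have hpadj : ∀ i < 2 * k + 1, ∀ j < 2 * k + 1, CycAdj (2 * k + 1) i j →
          D.lt (p i) u ∧ D.lt (p j) u ∧ M.antip.Adj (p i) (p j) := by
        intro i hi j hj hc
        have := hadj i hi j hj hc
        rw [hp i hi, hp j hj] at this
        exact this
      have hplt : ∀ i, i < 2 * k + 1 → D.lt (p i) u := by
        intro i hi
        by_cases h1 : i + 1 < 2 * k + 1
        · exact (hpadj i hi (i + 1) h1 (Or.inl rfl)).1
        · exact (hpadj i hi 0 (by omega) (Or.inr (Or.inr (Or.inr ⟨rfl, by omega⟩)))).1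
      refine hw k hk p ⟨?_, ?_, ?_, ?_, ?_⟩
      · intro i hi j hj hij
        exact hinj i hi j hj (by rw [hp i hi, hp j hj, hij])
      · intro i hi
        exact (hpadj i (by omega) (i + 1) hi (Or.inl rfl)).2.2
      · exact (hpadj _ (by omega) 0 (by omega) (Or.inr (Or.inr (Or.inr ⟨rfl, by omega⟩)))).2.2
      · intro i _ hi
        exact hdom (hplt i hi)
      · exact Or.inl (hdom (hplt 0 (by omega)))

/-- An attachment system without wheels, fans and full antipodal triangles has a good coloring. -/
theorem AttachmentSystem.exists_isGoodColoring [Finite Γ] (A : AttachmentSystem M V)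
    (hw : ∀ k, 1 ≤ k → ∀ h g, ¬ IsWheel M h (2 * k + 1) g)
    (hf : ∀ n, 2 ≤ n → ∀ h q, ¬ IsFan M h (2 * n) q)
    (htri : ∀ a b c, M.antip.Adj a b → M.antip.Adj b c → M.antip.Adj a c →
      ∀ x, x ∈ A.nbr a → x ∈ A.nbr b → x ∉ A.nbr c) :
    ∃ f : Γ → Γ × Bool, IsGoodColoring M A.nbr f := by
  classical
  choose t htne htforced using fun u =>
    A.toDominanceOrder.exists_bipartition u (fun k hk g => hw k hk u g) (fun n hn q => hf n hn u q)
  -- Colors with flag `false` are named after maximal elements; flag `true` marks one additional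
  -- color per maximal element. Two distinct maximal elements seeing a common vertex are antipodal,
  -- so without full triangles at most two see it.
  let Top : Γ → Prop := fun u => ∀ d, ¬ A.lt u d
  let Ups : Γ → Set Γ := fun i => {u | Top u ∧ (i = u ∨ A.lt i u)}
  have hUps : ∀ i, (Ups i).Nonempty := by
    have hwf : WellFounded (fun a b => A.lt b a) := by
      have : IsTrans Γ (fun a b => A.lt b a) := ⟨fun _ _ _ h1 h2 => A.trans h2 h1⟩
      have : Std.Irrefl (fun a b => A.lt b a) := ⟨A.irrefl⟩
      exact Finite.wellFounded_of_trans_of_irrefl _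
    intro i
    refine hwf.induction (C := fun i => (Ups i).Nonempty) i ?_
    intro a ih
    by_cases ha : Top a
    · exact ⟨a, ha, Or.inl rfl⟩
    · simp only [Top, not_forall, not_not] at ha
      obtain ⟨d, hd⟩ := ha
      obtain ⟨u, hu, h1⟩ := ih d hd
      refine ⟨u, hu, Or.inr ?_⟩
      rcases h1 with rfl | h1
      · exact hd
      · exact A.trans hd h1
  have hmem : ∀ {i u x}, u ∈ Ups i → x ∈ A.nbr i → x ∈ A.nbr u := by
    rintro i u x ⟨-, rfl | h⟩ hx
    · exact hx
    · exact A.mono h hx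
  have hantip : ∀ {i u x}, Top u → u ∉ Ups i → x ∈ A.nbr i → x ∈ A.nbr u → M.antip.Adj i u := by
    intro i u x hu hnot hi hxu
    have hne : i ≠ u := fun h => hnot ⟨hu, Or.inl h⟩
    rcases (A.attached_iff hne).1 ⟨x, hi, hxu⟩ with h | h
    · exact h
    · rcases (A.dom_iff _ _).1 h with h1 | h1
      · exact absurd ⟨hu, Or.inr h1⟩ hnot
      · exact absurd h1 (hu _)
  have htop : ∀ {a b x}, Top a → Top b → a ≠ b → x ∈ A.nbr a → x ∈ A.nbr b → M.antip.Adj a b := by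
    intro a b x ha hb hab hxa hxb
    refine hantip hb ?_ hxa hxb
    rintro ⟨-, h | h⟩
    · exact hab h
    · exact ha _ h
  have hthree : ∀ {a b c x}, Top a → Top b → Top c → x ∈ A.nbr a → x ∈ A.nbr b → x ∈ A.nbr c →
      a = b ∨ b = c ∨ a = c := by
    intro a b c x ha hb hc hxa hxb hxc
    by_contra hcon
    push Not at hcon
    exact htri a b c (htop ha hb hcon.1 hxa hxb) (htop hb hc hcon.2.1 hxb hxc)
      (htop ha hc hcon.2.2 hxa hxc) x hxa hxb hxc
  -- The selected maximal element must depend on the set `Ups i` alone, so that elements with equal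
  -- `Ups` are compared with the same bipartition. The default `i` is never used, as `Ups i` is
  -- nonempty.
  let σ : Set Γ → Γ → Γ := fun s i => if h : s.Nonempty then h.some else i
  have hσ : ∀ i j, σ (Ups i) i = σ (Ups i) j := fun i j => by simp only [σ, dif_pos (hUps i)]
  have hσmem : ∀ i, σ (Ups i) i ∈ Ups i := fun i => by
    simp only [σ, dif_pos (hUps i)]; exact (hUps i).some_mem
  -- Elements in the class `t` of the selected maximal element take its color. The others take
  -- another maximal element above them if there is one, and the additional color if not.
  let f : Γ → Γ × Bool := fun i =>
    if i = σ (Ups i) i ∨ t (σ (Ups i) i) i then (σ (Ups i) i, false)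
    else if h : ∃ w ∈ Ups i, w ≠ σ (Ups i) i then (h.choose, false) else (σ (Ups i) i, true)
  have hfspec : ∀ i, ((i = σ (Ups i) i ∨ t (σ (Ups i) i) i) ∧ f i = (σ (Ups i) i, false)) ∨
      (A.lt i (σ (Ups i) i) ∧ ¬ t (σ (Ups i) i) i ∧
        ((∃ w ∈ Ups i, w ≠ σ (Ups i) i ∧ f i = (w, false)) ∨
          ((∀ w ∈ Ups i, w = σ (Ups i) i) ∧ f i = (σ (Ups i) i, true)))) := by
    intro i
    by_cases h1 : i = σ (Ups i) i ∨ t (σ (Ups i) i) i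
    · exact Or.inl ⟨h1, by simp only [f]; rw [if_pos h1]⟩
    · right
      have h2 : A.lt i (σ (Ups i) i) := (hσmem i).2.resolve_left fun h => h1 (Or.inl h)
      refine ⟨h2, fun h => h1 (Or.inr h), ?_⟩
      by_cases h3 : ∃ w ∈ Ups i, w ≠ σ (Ups i) i
      · exact Or.inl ⟨h3.choose, h3.choose_spec.1, h3.choose_spec.2,
          by simp only [f]; rw [if_neg h1, dif_pos h3]⟩
      · refine Or.inr ⟨?_, by simp only [f]; rw [if_neg h1, dif_neg h3]⟩
        push Not at h3
        exact h3
  have hfmem : ∀ i, (f i).1 ∈ Ups i := by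
    intro i
    rcases hfspec i with ⟨-, h⟩ | ⟨-, -, ⟨w, hw', -, h⟩ | ⟨-, h⟩⟩
    · rw [h]; exact hσmem i
    · rw [h]; exact hw'
    · rw [h]; exact hσmem i
  -- If a maximal `w'` not above `i` shares a vertex with `i`, then `w` is the only maximal element
  -- above `i`. Both `i` and `w` are antipodal to `w'`, so `i` is `w` itself or is prescribed to lie
  -- in the class `t w`.
  have hforced : ∀ {i w w' x}, w ∈ Ups i → Top w' → w' ∉ Ups i → x ∈ A.nbr i → x ∈ A.nbr w' →
      f i = (w, false) ∧ (i = w ∨ t w i) := by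
    intro i w w' x hwi hw' hnot hxi hxw'
    have hone : ∀ z ∈ Ups i, z = w := by
      intro z hz
      rcases hthree hz.1 hwi.1 hw' (hmem hz hxi) (hmem hwi hxi) hxw' with h | h | h
      · exact h
      · exact absurd (h ▸ hwi) hnot
      · exact absurd (h ▸ hz) hnot
    have hs : σ (Ups i) i = w := hone _ (hσmem i)
    have h1 : i = w ∨ t w i := by
      rcases hwi.2 with h | h
      · exact Or.inl h
      · refine Or.inr (htforced w i w' h ?_ (hantip hw' hnot hxi hxw'))
        exact htop hw' hwi.1 (fun he => hnot (he ▸ hwi)) hxw' (hmem hwi hxi)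
    refine ⟨?_, h1⟩
    simp only [f]
    rw [if_pos (by rw [hs]; exact h1), hs]
  -- Suppose `w'` is above `i` but not above `j`. Then `j` is antipodal to `w'`, which prescribes `t
  -- w' i`; also `j` is in the class `t w` by `hforced`, so `i` is not. Whichever of `w` and `w'` is
  -- selected for `i`, the color of `i` is not `(w, false)`.
  have hasym : ∀ {i j w}, M.antip.Adj i j → f i = (w, false) → f j = (w, false) →
      ∀ w' ∈ Ups i, w' ∈ Ups j := by
    intro i j w hij hi hj w' hw'i
    by_contra hw'j
    have hwi : w ∈ Ups i := by have := hfmem i; rwa [hi] at this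
    have hwj : w ∈ Ups j := by have := hfmem j; rwa [hj] at this
    obtain ⟨x, hxi, hxj⟩ := (A.attached_iff hij.ne).2 (Or.inl hij)
    have hww' : w' ≠ w := fun h => hw'j (h ▸ hwj)
    have hlt : ∀ {z z'}, z ∈ Ups i → z' ∈ Ups i → z' ≠ z → A.lt i z := by
      intro z z' hz hz' hne
      refine hz.2.resolve_left ?_
      rintro rfl
      rcases hz'.2 with h | h
      · exact hne h.symm
      · exact hz.1 _ h
    have hiw : A.lt i w := hlt hwi hw'i hww'
    have hiw' : A.lt i w' := hlt hw'i hwi hww'.symm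
    have hjw' : M.antip.Adj j w' := hantip hw'i.1 hw'j hxj (hmem hw'i hxi)
    have hjw : A.lt j w := by
      refine hwj.2.resolve_left ?_
      rintro rfl
      exact A.not_antip_of_lt hiw hij
    have hσ' : σ (Ups i) i = w ∨ σ (Ups i) i = w' := by
      rcases hthree (hσmem i).1 hwi.1 hw'i.1 (hmem (hσmem i) hxi) (hmem hwi hxi) (hmem hw'i hxi)
        with h | h | h
      · exact Or.inl h
      · exact absurd h.symm hww'
      · exact Or.inr h
    rcases hσ' with hs | hs
    · have htj : t w j := by
        rcases (hforced hwj hw'i.1 hw'j hxj (hmem hw'i hxi)).2 with h | h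
        · exact absurd (h ▸ hjw) (A.irrefl _)
        · exact h
      have hti : ¬ t w i := fun h => (htne w i j hiw hjw hij).1 h htj
      rcases hfspec i with ⟨h1, -⟩ | ⟨-, -, ⟨z, -, hz, h⟩ | ⟨-, h⟩⟩
      · rw [hs] at h1
        rcases h1 with h1 | h1
        · exact A.irrefl _ (h1 ▸ hiw)
        · exact hti h1
      · rw [hi] at h
        exact hz (by rw [hs]; exact (congrArg Prod.fst h).symm)
      · rw [hi] at h
        exact absurd (congrArg Prod.snd h) (by simp)
    · have hti : t w' i := htforced w' i j hiw' hjw' hij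
      rcases hfspec i with ⟨-, h⟩ | ⟨-, h1, -⟩
      · rw [hi, hs] at h
        exact hww' (congrArg Prod.fst h).symm
      · rw [hs] at h1
        exact h1 hti
  refine ⟨f, ?_, ?_⟩
  · intro i j hij hfij
    have hsame : ∀ {s}, σ (Ups i) i = s → σ (Ups j) j = s → A.lt i s → A.lt j s →
        (t s i ↔ t s j) → False := by
      intro s _ _ hi hj ht
      have := htne s i j hi hj hij
      tauto
    have hnot : ∀ {a b : Γ}, M.antip.Adj a b → a ∈ Ups b → False := by
      intro a b hab h
      rcases h.2 with h1 | h1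
      · exact hab.ne h1.symm
      · exact A.not_antip_of_lt h1 hab.symm
    -- For flag `false`, equal colors force equal `Ups`, hence one selected element and one class of
    -- its bipartition for both. For flag `true`, both lie outside the class `t` of that element.
    -- Antipodal elements below it cannot share a class.
    rcases hb : (f i).2 with _ | _
    · have hi : f i = ((f i).1, false) := Prod.ext rfl hb
      have hj : f j = ((f i).1, false) := by rw [← hfij]; exact hi
      have hU : Ups i = Ups j := Set.Subset.antisymm (hasym hij hi hj) (hasym hij.symm hj hi)
      have hss : σ (Ups j) j = σ (Ups i) i := by rw [hU, hσ j i]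
      have hlti : A.lt i (σ (Ups i) i) := (hσmem i).2.resolve_left fun h =>
        hnot hij (by have := hσmem i; rwa [← h, hU] at this)
      have hltj : A.lt j (σ (Ups i) i) := (hss ▸ hσmem j).2.resolve_left fun h =>
        hnot hij.symm (by rw [hU]; have := hσmem j; rwa [hss, ← h] at this)
      refine hsame rfl hss hlti hltj ?_
      have key : ∀ {a}, A.lt a (σ (Ups i) i) → σ (Ups a) a = σ (Ups i) i →
          f a = ((f i).1, false) → (t (σ (Ups i) i) a ↔ (f i).1 = σ (Ups i) i) := by
        intro a hlt hs ha
        rcases hfspec a with ⟨h1, h⟩ | ⟨-, h1, ⟨w, -, hw2, h⟩ | ⟨-, h⟩⟩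
        · rw [hs] at h1
          rw [ha, hs] at h
          refine iff_of_true (h1.resolve_left ?_) (congrArg Prod.fst h)
          intro he
          exact A.irrefl _ (he ▸ hlt)
        · rw [hs] at h1 hw2
          rw [ha] at h
          refine iff_of_false h1 ?_
          rw [show (f i).1 = w from congrArg Prod.fst h]
          exact hw2
        · rw [ha] at h
          exact absurd (congrArg Prod.snd h) (by simp)
      rw [key hlti rfl hi, key hltj hss hj]
    · have key : ∀ {a}, (f a).2 = true → A.lt a (f a).1 ∧ ¬ t (f a).1 a := by
        intro a ha
        rcases hfspec a with ⟨h1, h⟩ | ⟨h2, h1, ⟨w, -, hw2, h⟩ | ⟨-, h⟩⟩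
        · rw [h] at ha; simp at ha
        · rw [h] at ha; simp at ha
        · rw [h]; exact ⟨h2, h1⟩
      have h1 := key hb
      have h2 := key (hfij ▸ hb)
      rw [← hfij] at h2
      have := htne _ i j h1.1 h2.1 hij
      tauto
  · intro x a b c ha hb hc
    -- If some `z` seeing `x` has flag `true`, `hforced` makes every element seeing `x` inherit the
    -- same maximal element, leaving only the two flags. Otherwise the colors are maximal elements
    -- seeing `x`, at most two.
    by_cases hall : ∃ z, (f z).2 = true ∧ x ∈ A.nbr z
    · obtain ⟨z, hz, hxz⟩ := hall
      have hone : ∀ y, x ∈ A.nbr y → (f y).1 = (f z).1 := by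
        intro y hxy
        by_contra hne
        have hnot : (f y).1 ∉ Ups z := by
          rcases hfspec z with ⟨-, h⟩ | ⟨-, -, ⟨w, -, -, h⟩ | ⟨h1, h⟩⟩
          · rw [h] at hz; simp at hz
          · rw [h] at hz; simp at hz
          · intro h2
            apply hne
            rw [h1 _ h2, h]
        have := (hforced (hfmem z) (hfmem y).1 hnot hxz (hmem (hfmem y) hxy)).1
        rw [this] at hz
        simp at hz
      have h1 := hone a ha
      have h2 := hone b hb
      have h3 := hone c hc
      rcases ea : (f a).2 with _ | _ <;> rcases eb : (f b).2 with _ | _ <;>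
        rcases ec : (f c).2 with _ | _ <;> simp [Prod.ext_iff, h1, h2, h3, ea, eb, ec]
    · push Not at hall
      have hF : ∀ y, x ∈ A.nbr y → (f y).2 = false := by
        intro y hy
        by_contra h
        exact hall y (by simpa using h) hy
      have h1 := hF a ha
      have h2 := hF b hb
      have h3 := hF c hc
      rcases hthree (hfmem a).1 (hfmem b).1 (hfmem c).1 (hmem (hfmem a) ha) (hmem (hfmem b) hb)
        (hmem (hfmem c) hc) with h | h | h
      · exact Or.inl (Prod.ext h (h1.trans h2.symm))
      · exact Or.inr (Or.inl (Prod.ext h (h2.trans h3.symm)))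
      · exact Or.inr (Or.inr (Prod.ext h (h1.trans h3.symm)))

end

/-! ### Good colorings exclude wheels, fans and full antipodal triangles -/

section

variable {Γ : Type u} {M : TwoColoredGraph Γ} {V : Type v} {C : Type*} {f : Γ → C}

/-- The three elements see a common vertex: whichever end of the dominance spoke is lower, its
neighborhood is contained in that of the other end and meets that of `b`. At most two colors occur
there and `a`, `b` differ, so exactly one of them has the color of the hub. -/
theorem IsGoodColoring.eq_hub_iff {A : AttachmentSystem M V} (hf : IsGoodColoring M A.nbr f)
    {a b h : Γ} (hab : M.antip.Adj a b) (ha : M.dom.Adj h a)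
    (hb : M.dom.Adj h b ∨ M.antip.Adj h b) : f b = f h ↔ ¬ f a = f h := by
  have hne := hf.ne_of_antip hab
  have hx : ∃ x, x ∈ A.nbr a ∧ x ∈ A.nbr b ∧ x ∈ A.nbr h := by
    rcases (A.dom_iff _ _).1 ha with h1 | h1
    · have hhb : h ≠ b := hb.elim (fun h => h.ne) (fun h => h.ne)
      obtain ⟨x, hxh, hxb⟩ := (A.attached_iff hhb).2 hb.symm
      exact ⟨x, A.mono h1 hxh, hxb, hxh⟩
    · obtain ⟨x, hxa, hxb⟩ := (A.attached_iff hab.ne).2 (Or.inl hab)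
      exact ⟨x, hxa, hxb, A.mono h1 hxa⟩
  obtain ⟨x, hxa, hxb, hxh⟩ := hx
  constructor
  · intro h1 h2
    exact hne (h2.trans h1.symm)
  · intro h1
    rcases hf.two_colors hxa hxb hxh with h2 | h2 | h2
    · exact absurd h2 hne
    · exact h2
    · exact absurd h2 h1

/-- Agreement with the hub alternates along the rim, so it cannot close up around an odd cycle. -/
theorem IsGoodColoring.not_isWheel {A : AttachmentSystem M V} (hf : IsGoodColoring M A.nbr f)
    {k : ℕ} (hk : 1 ≤ k) {h : Γ} {g : ℕ → Γ} : ¬ IsWheel M h (2 * k + 1) g := by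
  intro w
  have key : ∀ i, i < 2 * k + 1 → (f (g i) = f h ↔ (Even i ↔ f (g 0) = f h)) := by
    intro i
    induction i with
    | zero => intro _; simp
    | succ i ih =>
      intro hi
      have h1 := (hf.eq_hub_iff (w.antip i hi).symm (w.spoke (i + 1) (by omega) hi)
        (w.spoke_all (by omega)))
      rw [ih (by omega)] at h1
      rw [Nat.even_add_one]
      tauto
  have h1 := hf.eq_hub_iff w.antip_last (w.spoke _ (by omega) (by omega)) w.spoke_zero
  rw [key (2 * k + 1 - 1) (by omega)] at h1
  have h2 : Even (2 * k + 1 - 1) := by simp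
  tauto

/-- The path starts at a vertex differing from the center and then alternates. Its last index `2n -
1` is odd, so the last vertex would agree with the center although it is antipodal to it. -/
theorem IsGoodColoring.not_isFan {A : AttachmentSystem M V} (hf : IsGoodColoring M A.nbr f)
    {n : ℕ} (hn : 2 ≤ n) {h : Γ} {q : ℕ → Γ} : ¬ IsFan M h (2 * n) q := by
  intro w
  have key : ∀ i, i + 1 < 2 * n → (f (q i) = f h ↔ ¬ Even i) := by
    intro i
    induction i with
    | zero =>
      intro _
      simpa using (hf.ne_of_antip w.antip_zero).symm
    | succ i ih =>
      intro hi
      have h1 := hf.eq_hub_iff (w.antip i (by omega)).symm (w.spoke (i + 1) (by omega) hi) (by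
        rcases Nat.eq_zero_or_pos i with rfl | hpos
        · exact Or.inr w.antip_zero
        · exact Or.inl (w.spoke i hpos (by omega)))
      rw [ih (by omega)] at h1
      rw [Nat.even_add_one]
      tauto
  have h1 := w.antip (2 * n - 2) (by omega)
  rw [show 2 * n - 2 + 1 = 2 * n - 1 by omega] at h1
  have h2 := hf.eq_hub_iff h1 (w.spoke _ (by omega) (by omega)) (Or.inr w.antip_last)
  rw [key (2 * n - 2) (by omega)] at h2
  have h3 : Even (2 * n - 2) := ⟨n - 1, by omega⟩
  exact hf.ne_of_antip w.antip_last (h2.2 (by tauto)).symm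

/-- A good coloring excludes full antipodal triangles. -/
theorem IsGoodColoring.not_triangle {nbr : Γ → Set V} (hf : IsGoodColoring M nbr f)
    {a b c : Γ} (hab : M.antip.Adj a b) (hbc : M.antip.Adj b c) (hac : M.antip.Adj a c)
    {x : V} (ha : x ∈ nbr a) (hb : x ∈ nbr b) : x ∉ nbr c := by
  intro hc
  rcases hf.two_colors ha hb hc with h | h | h
  · exact hf.ne_of_antip hab h
  · exact hf.ne_of_antip hbc h
  · exact hf.ne_of_antip hac h

theorem isWheel_of_hasCopy {k : ℕ} (hk : 1 ≤ k) {H : SimpleGraph (Option (Fin (2 * k + 1)))}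
    (hrim : rim (2 * k + 1) ≤ H) (hspoke : ∀ x : Fin (2 * k + 1), x ≠ 0 → ¬ H.Adj none (some x))
    (hc : HasCopy (withHubs H {none}) M) : ∃ h g, IsWheel M h (2 * k + 1) g := by
  obtain ⟨e, hinj, hant, hdom⟩ := hc
  have hm : 3 ≤ 2 * k + 1 := by omega
  refine ⟨e none, fun i => e (some (Fin.ofNat _ i)), ?_, ?_, ?_, ?_, ?_⟩
  · intro i hi j hj hij
    have := congrArg Fin.val (Option.some_injective _ (hinj hij))
    simpa [Nat.mod_eq_of_lt hi, Nat.mod_eq_of_lt hj] using this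
  · intro i hi
    apply hant
    apply hrim
    rw [rim_adj_some, cycleGraph_adj_iff hm]
    left
    simp [Nat.mod_eq_of_lt hi, Nat.mod_eq_of_lt (show i < 2 * k + 1 by omega)]
  · apply hant
    apply hrim
    rw [rim_adj_some, cycleGraph_adj_iff hm]
    right; right; right
    simp
  · intro i hi hi'
    apply hdom
    refine ⟨by simp, Or.inl rfl, hspoke _ ?_⟩
    intro he
    have := congrArg Fin.val he
    simp [Nat.mod_eq_of_lt hi'] at this
    omega
  · by_cases h : H.Adj none (some (Fin.ofNat _ 0))
    · exact Or.inr (hant _ _ h)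
    · exact Or.inl (hdom _ _ ⟨by simp, Or.inl rfl, h⟩)

theorem isFan_of_hasCopy {n : ℕ} (hn : 2 ≤ n) (hc : HasCopy (fan n) M) :
    ∃ h q, IsFan M h (2 * n) q := by
  obtain ⟨e, hinj, hant, hdom⟩ := hc
  have hm : 3 ≤ 2 * n + 1 := by omega
  have hval : ∀ i, i < 2 * n + 1 → (Fin.ofNat (2 * n + 1) i).val = i := fun i hi => by
    simp [Nat.mod_eq_of_lt hi]
  have hanti : ∀ x y : Fin (2 * n + 1), CycAdj (2 * n + 1) x y → M.antip.Adj (e x) (e y) :=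
    fun x y h => hant x y ((cycleGraph_adj_iff hm x y).2 h)
  refine ⟨e 0, fun i => e (Fin.ofNat _ (i + 1)), ?_, ?_, ?_, ?_, ?_⟩
  · intro i hi j hj hij
    have := congrArg Fin.val (hinj hij)
    rw [hval _ (by omega), hval _ (by omega)] at this
    omega
  · intro i hi
    apply hanti
    rw [hval _ (by omega), hval _ (by omega)]
    exact Or.inl rfl
  · apply hanti
    rw [hval _ (by omega)]
    exact Or.inl rfl
  · apply hanti
    rw [hval _ (by omega)]
    refine Or.inr (Or.inr (Or.inl ⟨rfl, by omega⟩))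
  · intro i hi hi'
    apply hdom
    refine ⟨?_, Or.inl rfl, ?_⟩
    · intro he
      have := congrArg Fin.val he
      rw [hval _ (by omega)] at this
      simp at this
    · intro he
      have := (cycleGraph_adj_iff hm _ _).1 he
      rw [hval _ (by omega)] at this
      simp [CycAdj] at this
      omega

/-- A good coloring excludes the graphs of the small family as subgraphs. -/
theorem IsGoodColoring.not_hasCopy {A : AttachmentSystem M V} (hf : IsGoodColoring M A.nbr f) :
    ∀ S ∈ familyZero, ¬ HasCopy S.2 M := by
  rintro S (⟨k, hk, rfl | rfl⟩ | ⟨n, hn, rfl⟩) hc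
  · obtain ⟨h, g, w⟩ := isWheel_of_hasCopy hk le_rfl (fun x _ => not_rim_adj_none) hc
    exact hf.not_isWheel hk w
  · obtain ⟨h, g, w⟩ := isWheel_of_hasCopy hk le_sup_left (fun x hx => by
      rw [SimpleGraph.sup_adj, SimpleGraph.edge_adj]
      simpa [not_rim_adj_none] using hx) hc
    exact hf.not_isWheel hk w
  · obtain ⟨h, q, w⟩ := isFan_of_hasCopy hn hc
    exact hf.not_isFan hn w

theorem HasInducedCopy.hasCopy {U : Type*} {S : TwoColoredGraph U} (h : HasInducedCopy S M) :
    HasCopy S M := by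
  obtain ⟨e, hinj, h1, h2⟩ := h
  exact ⟨e, hinj, fun i j => (h1 i j).1, fun i j => (h2 i j).1⟩

/-- Hypothesis `hd` keeps the dominance edges at the smaller hub set: passing to `H'` must not
recolor them antipodal. -/
theorem HasCopy.of_withHubs {U : Type*} {H H' : SimpleGraph U} {s s' : Set U} (hH : H ≤ H')
    (hs : s ⊆ s') (hd : ∀ i ∈ s, ∀ j, H'.Adj i j → H.Adj i j) (h : HasCopy (withHubs H' s') M) :
    HasCopy (withHubs H s) M := by
  obtain ⟨e, hinj, h1, h2⟩ := h
  refine ⟨e, hinj, fun i j hij => h1 i j (hH hij), ?_⟩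
  rintro i j ⟨hne, hor, hnot⟩
  refine h2 i j ⟨hne, hor.imp (fun h => hs h) (fun h => hs h), fun h' => hnot ?_⟩
  rcases hor with h3 | h3
  · exact hd i h3 j h'
  · exact (hd j h3 i h'.symm).symm

/-- Excluding the small family as subgraphs excludes the large family as induced subgraphs. -/
theorem not_hasInducedCopy_of_not_hasCopy (h : ∀ S ∈ familyZero, ¬ HasCopy S.2 M) :
    ∀ S ∈ family, ¬ HasInducedCopy S.2 M := by
  rintro S (hS | ⟨n, hn, rfl | rfl⟩) hc
  · exact h S hS hc.hasCopy
  · refine h _ (fan_mem_familyZero hn) (HasCopy.of_withHubs le_sup_left le_rfl ?_ hc.hasCopy)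
    rintro i rfl j hj
    rw [SimpleGraph.sup_adj, SimpleGraph.edge_adj] at hj
    refine hj.resolve_right ?_
    have hone : (1 : Fin (2 * n + 1)).val = 1 :=
      (Fin.val_one' _).trans (Nat.mod_eq_of_lt (by omega))
    simp only [Fin.ext_iff, hone, Fin.val_last, Fin.val_zero]
    omega
  · exact h _ (fan_mem_familyZero hn)
      (HasCopy.of_withHubs le_rfl (Set.singleton_subset_iff.2 (Or.inl rfl)) (fun _ _ _ h => h)
        hc.hasCopy)

end

/-! ### The attachedness graph as an attachment system -/

section

variable {V : Type u} {G : SimpleGraph V} {Q : Set V}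

/-- The vertices of `Q` that have `γ_c` as a neighboring subgraph. -/
def nbr (G : SimpleGraph V) (Q : Set V) (c : Comp G Q) : Set V :=
  {x | x ∈ Q ∧ IsNeighboring G Q c x}

theorem attached_iff_nbr {c d : Comp G Q} :
    Attached G Q c d ↔ (nbr G Q c ∩ nbr G Q d).Nonempty := by
  constructor
  · rintro ⟨K, L, hK, hL, x, ⟨hxK, hxL⟩, hxQ⟩
    exact ⟨x, ⟨hxQ, K, hK, hxK⟩, hxQ, L, hL, hxL⟩
  · rintro ⟨x, ⟨hxQ, K, hK, hxK⟩, -, L, hL, hxL⟩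
    exact ⟨K, L, hK, hL, x, ⟨hxK, hxL⟩, hxQ⟩

/-- The relevant cliques of the lower member enter dominance only through the union of their traces
on `Q`, which is `nbr`. -/
theorem dominated_iff_nbr {c d : Comp G Q} :
    Dominated G Q c d ↔ (nbr G Q c ∩ nbr G Q d).Nonempty ∧
      ∀ L, IsRelevant G Q d L → nbr G Q c ⊆ L ∨ nbr G Q c ∩ L = ∅ := by
  rw [Dominated, attached_iff_nbr]
  refine and_congr_right fun _ => forall₂_congr fun L _ => or_congr ?_ ?_
  · constructor
    · rintro h x ⟨hxQ, K, hK, hxK⟩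
      exact (h K hK ⟨hxK, hxQ⟩).1
    · rintro h K hK x ⟨hxK, hxQ⟩
      exact ⟨h ⟨hxQ, K, hK, hxK⟩, hxQ⟩
  · simp only [Set.eq_empty_iff_forall_notMem]
    constructor
    · rintro h x ⟨⟨hxQ, K, hK, hxK⟩, hxL⟩
      exact h K hK x ⟨⟨hxK, hxL⟩, hxQ⟩
    · rintro h K hK x ⟨⟨hxK, hxL⟩, hxQ⟩
      exact h x ⟨⟨hxQ, K, hK, hxK⟩, hxL⟩

theorem Dominated.nbr_subset {c d : Comp G Q} (h : Dominated G Q c d) :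
    nbr G Q c ⊆ nbr G Q d := by
  rw [dominated_iff_nbr] at h
  obtain ⟨⟨x, hxc, hxQ, L, hL, hxL⟩, h⟩ := h
  rcases h L hL with h1 | h1
  · exact fun y hy => ⟨hy.1, L, hL, h1 hy⟩
  · exact absurd (show x ∈ nbr G Q c ∩ L from ⟨hxc, hxL⟩) (by simp [h1])

theorem Dominated.trans {c d e : Comp G Q} (h : Dominated G Q c d) (h' : Dominated G Q d e) :
    Dominated G Q c e := by
  have hcd := h.nbr_subset
  have hde := h'.nbr_subset
  rw [dominated_iff_nbr] at *
  obtain ⟨⟨x, hxc, hxd⟩, -⟩ := h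
  refine ⟨⟨x, hxc, hde hxd⟩, fun L hL => ?_⟩
  rcases h'.2 L hL with h1 | h1
  · exact Or.inl (hcd.trans h1)
  · exact Or.inr (Set.subset_empty_iff.1 (h1 ▸ Set.inter_subset_inter_left _ hcd))

/-- The attachedness graph, with ties in the dominance relation broken by a well-order. -/
noncomputable def attachmentSystem (G : SimpleGraph V) (Q : Set V) :
    AttachmentSystem (attachednessGraph G Q) V where
  lt c d := Dominated G Q c d ∧ (¬ Dominated G Q d c ∨ WellOrderingRel c d)
  irrefl c h := h.2.elim (fun h' => h' h.1) (irrefl c)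
  trans {c d e} h h' := by
    refine ⟨h.1.trans h'.1, ?_⟩
    by_cases hec : Dominated G Q e c
    · right
      exact _root_.trans (h.2.resolve_left fun h1 => h1 (h'.1.trans hec))
        (h'.2.resolve_left fun h1 => h1 (hec.trans h.1))
    · exact Or.inl hec
  dom_iff c d := by
    constructor
    · rintro ⟨hne, h⟩
      by_cases h1 : Dominated G Q c d <;> by_cases h2 : Dominated G Q d c
      · rcases trichotomous_of WellOrderingRel c d with h3 | h3 | h3
        · exact Or.inl ⟨h1, Or.inr h3⟩
        · exact absurd h3 hne
        · exact Or.inr ⟨h2, Or.inr h3⟩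
      · exact Or.inl ⟨h1, Or.inl h2⟩
      · exact Or.inr ⟨h2, Or.inl h1⟩
      · exact absurd h (by tauto)
    · have key : ∀ c d : Comp G Q, (Dominated G Q c d ∧
          (¬ Dominated G Q d c ∨ WellOrderingRel c d)) → c ≠ d := by
        rintro c d h rfl
        exact h.2.elim (fun h' => h' h.1) (irrefl c)
      rintro (h | h)
      · exact ⟨key _ _ h, Or.inl h.1⟩
      · exact ⟨(key _ _ h).symm, Or.inr h.1⟩
  -- A vertex shared by `c` and `e` is also seen by `d`, so `e` and `d` are attached. Dominance of
  -- `d` by `e` would give dominance of `c` by `e`, against antipodality.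
  antip_or_lt {c d e} h h' := by
    have hed : e ≠ d := by
      rintro rfl
      exact h'.2.2.1 h.1
    have hatt : Attached G Q e d := by
      have := h'.2.1
      rw [attached_iff_nbr] at this ⊢
      obtain ⟨x, hxc, hxe⟩ := this
      exact ⟨x, hxe, h.1.nbr_subset hxc⟩
    have hde : ¬ Dominated G Q d e := fun h1 => h'.2.2.1 (h.1.trans h1)
    by_cases h1 : Dominated G Q e d
    · exact Or.inr ⟨h1, Or.inl hde⟩
    · exact Or.inl ⟨hed, hatt, h1, hde⟩
  nbr := nbr G Q
  mono h := h.1.nbr_subset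
  attached_iff {c d} hne := by
    rw [← attached_iff_nbr]
    constructor
    · intro h
      by_cases h1 : Dominated G Q c d ∨ Dominated G Q d c
      · exact Or.inr ⟨hne, h1⟩
      · push Not at h1
        exact Or.inl ⟨hne, h, h1⟩
    · rintro (h | ⟨-, h | h⟩)
      · exact h.2.1
      · exact h.1
      · exact h.1.symm

/-- The attachedness graph has a good coloring. -/
def HasGoodColoring (G : SimpleGraph V) (Q : Set V) : Prop :=
  ∃ (C : Type u) (f : Comp G Q → C), IsGoodColoring (attachednessGraph G Q) (nbr G Q) f

theorem HasGoodColoring.not_hasCopy (h : HasGoodColoring G Q) :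
    ∀ S ∈ familyZero, ¬ HasCopy S.2 (attachednessGraph G Q) := by
  obtain ⟨C, f, hf⟩ := h
  exact IsGoodColoring.not_hasCopy (A := attachmentSystem G Q) hf

theorem HasGoodColoring.not_hasFullAntipodalTriangle (h : HasGoodColoring G Q) :
    ¬ HasFullAntipodalTriangle G Q := by
  obtain ⟨C, f, hf⟩ := h
  rintro ⟨a, b, c, hab, hbc, hac, x, hxQ, ha, hb, hc⟩
  exact hf.not_triangle hab hbc hac ⟨hxQ, ha⟩ ⟨hxQ, hb⟩ ⟨hxQ, hc⟩

theorem hasGoodColoring_of_not_hasInducedCopy [Finite V] (htri : ¬ HasFullAntipodalTriangle G Q)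
    (h : ∀ S ∈ family, ¬ HasInducedCopy S.2 (attachednessGraph G Q)) : HasGoodColoring G Q := by
  have D := (attachmentSystem G Q).toDominanceOrder
  obtain ⟨f, hf⟩ := (attachmentSystem G Q).exists_isGoodColoring
    (not_isWheel D h) (not_isFan D h)
    (fun a b c hab hbc hac x ha hb hc => htri ⟨a, b, c, hab, hbc, hac, x, ha.1, ha.2, hb.2, hc.2⟩)
  exact ⟨_, f, hf⟩

/-! ### Relevant cliques -/

/-- The vertex set of a component of `G - Q`. -/
def compSet (G : SimpleGraph V) (Q : Set V) (c : Comp G Q) : Set V := Subtype.val '' c.supp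

/-- `K` is a maximal clique of `G`. -/
abbrev IsMaxClique (G : SimpleGraph V) (K : Set V) : Prop := IsMaxCliqueIn G Set.univ K

theorem mem_compSet {c : Comp G Q} {x : V} :
    x ∈ compSet G Q c ↔ ∃ h : x ∉ Q, (G.induce Qᶜ).connectedComponentMk ⟨x, h⟩ = c := by
  constructor
  · rintro ⟨⟨y, hy⟩, hyc, rfl⟩
    exact ⟨hy, hyc⟩
  · rintro ⟨h, hc⟩
    exact ⟨⟨x, h⟩, hc, rfl⟩

theorem notMem_of_mem_compSet {c : Comp G Q} {x : V} (h : x ∈ compSet G Q c) : x ∉ Q :=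
  (mem_compSet.1 h).1

theorem mem_compSet_of_adj {c : Comp G Q} {x y : V} (h : x ∈ compSet G Q c) (hxy : G.Adj x y)
    (hy : y ∉ Q) : y ∈ compSet G Q c := by
  obtain ⟨hx, rfl⟩ := mem_compSet.1 h
  refine mem_compSet.2 ⟨hy, ?_⟩
  apply SimpleGraph.ConnectedComponent.sound
  exact SimpleGraph.Adj.reachable (show (G.induce Qᶜ).Adj ⟨y, hy⟩ ⟨x, hx⟩ from hxy.symm)

theorem exists_mem_compSet {x : V} (h : x ∉ Q) : ∃ c : Comp G Q, x ∈ compSet G Q c :=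
  ⟨_, mem_compSet.2 ⟨h, rfl⟩⟩

theorem compSet_eq_of_mem {c d : Comp G Q} {x : V} (hc : x ∈ compSet G Q c)
    (hd : x ∈ compSet G Q d) : c = d := by
  obtain ⟨h, rfl⟩ := mem_compSet.1 hc
  obtain ⟨h', rfl⟩ := mem_compSet.1 hd
  rfl

theorem compSet_nonempty (c : Comp G Q) : (compSet G Q c).Nonempty := by
  obtain ⟨x, hx⟩ := c.nonempty_supp
  exact ⟨x, x, hx, rfl⟩

theorem IsMaxClique.mem_of_forall {K : Set V} (h : IsMaxClique G K) {x : V}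
    (hx : ∀ y ∈ K, y ≠ x → G.Adj x y) : x ∈ K := by
  have h1 : G.IsClique (insert x K) := by
    rw [SimpleGraph.isClique_insert]
    exact ⟨h.prop.1, fun y hy hne => hx y hy hne.symm⟩
  exact h.le_of_ge ⟨h1, Set.subset_univ _⟩ (Set.subset_insert _ _) (Set.mem_insert _ _)

theorem IsMaxClique.eq_of_subset {K L : Set V} (h : IsMaxClique G K) (hL : G.IsClique L)
    (hKL : K ⊆ L) : K = L :=
  Set.Subset.antisymm hKL (h.le_of_ge ⟨hL, Set.subset_univ _⟩ hKL)

theorem exists_isMaxClique [Finite V] {K : Set V} (h : G.IsClique K) :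
    ∃ L, K ⊆ L ∧ IsMaxClique G L := by
  obtain ⟨L, hKL, hL⟩ := Set.Finite.exists_le_maximal (Set.toFinite {L : Set V | G.IsClique L ∧
    L ⊆ Set.univ}) (a := K) ⟨h, Set.subset_univ _⟩
  exact ⟨L, hKL, hL⟩

/-- A clique meeting the component lies inside the piece, so maximality in `γ_c` and in `G` agree
for it; conversely a maximal clique of `γ_c` missing the component is contained in `Q`, hence equal
to it. -/
theorem isRelevant_iff (hQ : G.IsClique Q) {c : Comp G Q} {K : Set V} :
    IsRelevant G Q c K ↔
      IsMaxClique G K ∧ (K ∩ Q).Nonempty ∧ (K ∩ compSet G Q c).Nonempty := by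
  have hpiece : ∀ {K : Set V}, G.IsClique K → (K ∩ compSet G Q c).Nonempty → K ⊆ piece G Q c := by
    rintro K hK ⟨x, hxK, hxc⟩ y hy
    by_cases hyQ : y ∈ Q
    · exact Or.inr hyQ
    · by_cases hxy : x = y
      · exact Or.inl (hxy ▸ hxc)
      · exact Or.inl (mem_compSet_of_adj hxc (hK hxK hy hxy) hyQ)
  constructor
  · rintro ⟨hK, hKQ, hne⟩
    have hKc : (K ∩ compSet G Q c).Nonempty := by
      by_contra hcon
      apply hne
      have hsub : K ⊆ Q := by
        intro x hx
        rcases hK.prop.2 hx with h | h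
        · exact absurd ⟨x, hx, h⟩ hcon
        · exact h
      exact Set.Subset.antisymm hsub (hK.le_of_ge ⟨hQ, Set.subset_union_right⟩ hsub)
    refine ⟨⟨⟨hK.prop.1, Set.subset_univ _⟩, ?_⟩, hKQ, hKc⟩
    rintro L ⟨hL, -⟩ hKL
    exact hK.le_of_ge ⟨hL, hpiece hL (hKc.mono (Set.inter_subset_inter_left _ hKL))⟩ hKL
  · rintro ⟨hK, hKQ, hKc⟩
    refine ⟨⟨⟨hK.prop.1, hpiece hK.prop.1 hKc⟩, ?_⟩, hKQ, ?_⟩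
    · rintro L ⟨hL, -⟩ hKL
      exact hK.le_of_ge ⟨hL, Set.subset_univ _⟩ hKL
    · rintro rfl
      obtain ⟨x, hxK, hxc⟩ := hKc
      exact notMem_of_mem_compSet hxc hxK

theorem mem_nbr_iff [Finite V] (hQ : G.IsClique Q) {c : Comp G Q} {x : V} :
    x ∈ nbr G Q c ↔ x ∈ Q ∧ ∃ y ∈ compSet G Q c, G.Adj x y := by
  constructor
  · rintro ⟨hxQ, K, hK, hxK⟩
    obtain ⟨hK, -, y, hyK, hyc⟩ := (isRelevant_iff hQ).1 hK
    refine ⟨hxQ, y, hyc, hK.prop.1 hxK hyK ?_⟩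
    rintro rfl
    exact notMem_of_mem_compSet hyc hxQ
  · rintro ⟨hxQ, y, hyc, hxy⟩
    obtain ⟨K, hKs, hK⟩ := exists_isMaxClique (G := G) (K := {x, y}) (by
      rw [SimpleGraph.isClique_pair]; exact fun _ => hxy)
    exact ⟨hxQ, K, (isRelevant_iff hQ).2 ⟨hK, ⟨x, hKs (by simp), hxQ⟩, y, hKs (by simp), hyc⟩,
      hKs (by simp)⟩

end

/-! ### Segments of a tree -/

section

variable {W : Type u} {T : SimpleGraph W}

/-- The vertices that lie on every walk from `a` to `b`. -/
def seg (T : SimpleGraph W) (a b : W) : Set W := {x | ∀ p : T.Walk a b, x ∈ p.support}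

theorem left_mem_seg (a b : W) : a ∈ seg T a b := fun p => p.start_mem_support

theorem right_mem_seg (a b : W) : b ∈ seg T a b := fun p => p.end_mem_support

theorem seg_comm (a b : W) : seg T a b = seg T b a := by
  ext x
  constructor <;> intro h p <;> simpa using h p.reverse

/-- Walks from `a` to `z` and from `z` to `b` that both avoid `x` concatenate to one avoiding `x`.
-/
theorem seg_subset_union (a b z : W) : seg T a b ⊆ seg T a z ∪ seg T z b := by
  intro x hx
  by_contra hcon
  simp only [Set.mem_union, seg, Set.mem_ofPred_eq, not_or, not_forall] at hcon
  obtain ⟨⟨p, hp⟩, q, hq⟩ := hcon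
  have := hx (p.append q)
  rw [SimpleGraph.Walk.mem_support_append_iff] at this
  exact this.elim hp hq

theorem seg_subset_of_mem {a b m : W} (h : m ∈ seg T a b) : seg T m b ⊆ seg T a b := by
  classical
  intro x hx p
  exact SimpleGraph.Walk.support_dropUntil_subset_support p (h p) (hx (p.dropUntil m (h p)))

theorem seg_subset_of_mem' {a b m : W} (h : m ∈ seg T a b) : seg T a m ⊆ seg T a b := by
  rw [seg_comm a m, seg_comm a b] at *
  exact seg_subset_of_mem h

theorem seg_convex {a b x y : W} (hx : x ∈ seg T a b) (hy : y ∈ seg T a b) :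
    seg T x y ⊆ seg T a b := by
  refine (seg_subset_union x y b).trans (Set.union_subset (seg_subset_of_mem hx) ?_)
  rw [seg_comm b y]
  exact seg_subset_of_mem hy

theorem seg_self (a : W) : seg T a a = {a} := by
  refine Set.Subset.antisymm (fun x hx => ?_) (by simpa using left_mem_seg a a)
  simpa using hx SimpleGraph.Walk.nil

theorem seg_eq_support (hT : T.IsTree) {a b : W} {p : T.Walk a b} (hp : p.IsPath) :
    seg T a b = {x | x ∈ p.support} := by
  classical
  refine Set.Subset.antisymm (fun x hx => hx p) (fun x hx q => ?_)
  have : q.bypass = p := (hT.existsUnique_path a b).unique q.bypass_isPath hp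
  exact q.support_bypass_subset_support (this ▸ hx)

theorem exists_isPath (hT : T.IsTree) (a b : W) : ∃ p : T.Walk a b, p.IsPath :=
  (hT.existsUnique_path a b).exists

theorem isPathSet_iff (hT : T.IsTree) {S : Set W} : IsPathSet T S ↔ ∃ a b, S = seg T a b := by
  constructor
  · rintro ⟨a, b, p, hp, rfl⟩
    exact ⟨a, b, (seg_eq_support hT hp).symm⟩
  · rintro ⟨a, b, rfl⟩
    obtain ⟨p, hp⟩ := exists_isPath hT a b
    exact ⟨a, b, p, hp, seg_eq_support hT hp⟩

theorem seg_antisymm (hT : T.IsTree) {a x y : W} (hx : x ∈ seg T a y) (hy : y ∈ seg T a x) :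
    x = y := by
  classical
  by_contra hne
  obtain ⟨p, hp⟩ := exists_isPath hT a y
  exact SimpleGraph.Walk.endpoint_notMem_support_takeUntil hp (hx p) (Ne.symm hne)
    (hy (p.takeUntil x (hx p)))

/-- With `seg_antisymm`, the vertices of a segment are linearly ordered by their position as seen
from `a`. -/
theorem seg_chain (hT : T.IsTree) {a b x y : W} (hx : x ∈ seg T a b) (hy : y ∈ seg T a b) :
    x ∈ seg T a y ∨ y ∈ seg T a x := by
  classical
  obtain ⟨p, hp⟩ := exists_isPath hT a b
  obtain ⟨p₁, p₂, rfl⟩ := SimpleGraph.Walk.mem_support_iff_exists_append.1 (hx p)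
  by_cases h : y ∈ p₁.support
  · right
    rw [seg_eq_support hT hp.of_append_left]
    exact h
  · left
    have h2 := ((SimpleGraph.Walk.mem_support_append_iff p₁ p₂).1 (hy _)).resolve_left h
    obtain ⟨r₁, r₂, rfl⟩ := SimpleGraph.Walk.mem_support_iff_exists_append.1 h2
    rw [SimpleGraph.Walk.append_assoc] at hp
    rw [seg_eq_support hT hp.of_append_left]
    exact (SimpleGraph.Walk.mem_support_append_iff _ _).2 (Or.inl p₁.end_mem_support)

theorem mem_seg_of_mem_of_mem (hT : T.IsTree) {a b x y : W} (hy : y ∈ seg T a b)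
    (hx : x ∈ seg T a y) : y ∈ seg T x b := by
  rcases seg_subset_union a b x hy with h | h
  · rw [seg_antisymm hT hx h]
    exact left_mem_seg _ _
  · exact h

/-- Two vertices of a segment on the same side of `q` are not separated by `q`. -/
theorem notMem_seg_of_mem (hT : T.IsTree) {a q x y : W} (hx : x ∈ seg T a q) (hy : y ∈ seg T a q)
    (hxq : x ≠ q) (hyq : y ≠ q) : q ∉ seg T x y := by
  intro h
  rcases seg_chain hT hx hy with h1 | h1
  · exact hyq (seg_antisymm hT hy (seg_convex h1 (right_mem_seg a y) h))
  · exact hxq (seg_antisymm hT hx (seg_convex (right_mem_seg a x) h1 h))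

/-- A set of vertices of a tree containing the segments between its members. -/
def SegConvex (T : SimpleGraph W) (U : Set W) : Prop := ∀ a ∈ U, ∀ b ∈ U, seg T a b ⊆ U

theorem segConvex_seg (a b : W) : SegConvex T (seg T a b) := fun _ hx _ hy => seg_convex hx hy

theorem mem_seg_of_adj (hT : T.IsTree) {r s u : W} (hrs : T.Adj r s) (hr : r ∉ seg T s u) :
    s ∈ seg T r u := by
  obtain ⟨p, hp⟩ := exists_isPath hT s u
  rw [seg_eq_support hT hp] at hr
  rw [seg_eq_support hT (hp.cons hr (h := hrs))]
  simp

/-- Every nonempty convex set of vertices has a gate for every vertex. -/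
theorem exists_gate (hT : T.IsTree) {U : Set W} (hU : SegConvex T U) (hne : U.Nonempty) (r : W) :
    ∃ m ∈ U, ∀ u ∈ U, m ∈ seg T r u := by
  obtain ⟨u₀, hu₀⟩ := hne
  obtain ⟨p, -⟩ := exists_isPath hT r u₀
  induction p with
  | nil => exact ⟨_, hu₀, fun u _ => left_mem_seg _ _⟩
  | @cons r s u₀ hrs p ih =>
    obtain ⟨m, hm, hgate⟩ := ih hu₀
    by_cases hr : r ∈ U
    · exact ⟨r, hr, fun u _ => left_mem_seg _ _⟩
    · refine ⟨m, hm, fun u hu => ?_⟩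
      rcases seg_subset_union s u r (hgate u hu) with h | h
      · have h1 := h hrs.symm.toWalk
        have h2 : m = s ∨ m = r := by simpa using h1
        rcases h2 with rfl | rfl
        · exact mem_seg_of_adj hT hrs fun h3 => hr (hU _ hm _ hu h3)
        · exact absurd hm hr
      · exact h

/-- The Helly property of convex sets of vertices of a tree. -/
theorem exists_mem_of_pairwise [Finite W] (hT : T.IsTree) {V : Type*} {K : Set V} (hK : K.Finite)
    {φ : V → Set W} (hconv : ∀ v ∈ K, SegConvex T (φ v)) (hne : ∀ v ∈ K, (φ v).Nonempty)
    (hpair : ∀ v ∈ K, ∀ w ∈ K, v ≠ w → (φ v ∩ φ w).Nonempty) : ∃ q, ∀ v ∈ K, q ∈ φ v := by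
  classical
  obtain ⟨r⟩ := hT.connected.nonempty
  rcases K.eq_empty_or_nonempty with rfl | hKne
  · exact ⟨r, by simp⟩
  have hg : ∀ v, ∃ m, v ∈ K → m ∈ φ v ∧ ∀ u ∈ φ v, m ∈ seg T r u := by
    intro v
    by_cases hv : v ∈ K
    · obtain ⟨m, hm, h⟩ := exists_gate hT (hconv v hv) (hne v hv) r
      exact ⟨m, fun _ => ⟨hm, h⟩⟩
    · exact ⟨r, fun h => absurd h hv⟩
  choose m hm using hg
  -- The gate farthest from the root lies in every set. If `z` is common to the sets of `v` and `w`,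
  -- both gates are on the segment from `r` to `z`, with `m w` first; so `m v` lies between `m w`
  -- and `z`, inside the set of `w`.
  obtain ⟨v, hv, hmax⟩ := Set.exists_max_image K (fun v => (seg T r (m v)).ncard) hK hKne
  refine ⟨m v, fun w hw => ?_⟩
  by_cases hvw : v = w
  · exact hvw ▸ (hm v hv).1
  obtain ⟨z, hzv, hzw⟩ := hpair v hv w hw hvw
  have h1 := (hm v hv).2 z hzv
  have h2 := (hm w hw).2 z hzw
  have h3 : m w ∈ seg T r (m v) := by
    rcases seg_chain hT h2 h1 with h | h
    · exact h
    · have := Set.eq_of_subset_of_ncard_le (seg_subset_of_mem' h) (hmax w hw) (Set.toFinite _)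
      rw [this]
      exact right_mem_seg _ _
  exact hconv w hw _ (hm w hw).1 _ hzw (mem_seg_of_mem_of_mem hT h1 h3)

/-- The gate of `r` on the segment from `a` to `b` lies on both arms, so it is `r`. -/
theorem seg_union_eq (hT : T.IsTree) {r a b : W} (h : seg T r a ∩ seg T r b ⊆ {r}) :
    seg T r a ∪ seg T r b = seg T a b := by
  obtain ⟨m, hm, hgate⟩ := exists_gate hT (segConvex_seg (T := T) a b) ⟨a, left_mem_seg _ _⟩ r
  have hmr : m = r := h ⟨hgate a (left_mem_seg _ _), hgate b (right_mem_seg _ _)⟩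
  subst hmr
  refine Set.Subset.antisymm (Set.union_subset (seg_convex hm (left_mem_seg _ _))
    (seg_convex hm (right_mem_seg _ _))) ?_
  rw [seg_comm m a]
  exact seg_subset_union a b m

/-- A vertex of a segment splits it into at most two branches. -/
theorem exists_notMem_seg (hT : T.IsTree) {a b q x y z : W} (hx : x ∈ seg T a b) (hy : y ∈ seg T a b) (hz : z ∈ seg T a b) (hxq : x ≠ q) (hyq : y ≠ q)
    (hzq : z ≠ q) : q ∉ seg T x y ∨ q ∉ seg T y z ∨ q ∉ seg T x z := by
  have key : ∀ {w}, w ∈ seg T a b → w ∈ seg T a q ∨ w ∈ seg T b q := by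
    intro w hw
    rw [seg_comm b q]
    exact seg_subset_union a b q hw
  rcases key hx with h1 | h1 <;> rcases key hy with h2 | h2 <;> rcases key hz with h3 | h3
  · exact Or.inl (notMem_seg_of_mem hT h1 h2 hxq hyq)
  · exact Or.inl (notMem_seg_of_mem hT h1 h2 hxq hyq)
  · exact Or.inr (Or.inr (notMem_seg_of_mem hT h1 h3 hxq hzq))
  · exact Or.inr (Or.inl (notMem_seg_of_mem hT h2 h3 hyq hzq))
  · exact Or.inr (Or.inl (notMem_seg_of_mem hT h2 h3 hyq hzq))
  · exact Or.inr (Or.inr (notMem_seg_of_mem hT h1 h3 hxq hzq))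
  · exact Or.inl (notMem_seg_of_mem hT h1 h2 hxq hyq)
  · exact Or.inl (notMem_seg_of_mem hT h1 h2 hxq hyq)

end

/-! ### Joining two trees by an edge -/

section

variable {W₁ W₂ : Type u} {T₁ : SimpleGraph W₁} {T₂ : SimpleGraph W₂} {a : W₁} {b : W₂}

/-- Two graphs joined by an edge. -/
def join (T₁ : SimpleGraph W₁) (T₂ : SimpleGraph W₂) (a : W₁) (b : W₂) : SimpleGraph (W₁ ⊕ W₂) :=
  (T₁.sum T₂) ⊔ SimpleGraph.edge (Sum.inl a) (Sum.inr b)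

/-- The join is connected, and the new edge restores the count of one edge fewer than vertices. -/
theorem isTree_join [Finite W₁] [Finite W₂] (h₁ : T₁.IsTree) (h₂ : T₂.IsTree) :
    (join T₁ T₂ a b).IsTree := by
  classical
  rw [SimpleGraph.isTree_iff_connected_and_card] at *
  refine ⟨h₁.1.sum_sup_edge h₂.1, ?_⟩
  have h : (join T₁ T₂ a b).edgeSet = insert s(Sum.inl a, Sum.inr b) (T₁.sum T₂).edgeSet := by
    rw [join, SimpleGraph.edgeSet_sup, SimpleGraph.edgeSet_edge_of_ne Sum.inl_ne_inr,
      Set.union_comm]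
    rfl
  have hnot : s(Sum.inl a, Sum.inr b) ∉ (T₁.sum T₂).edgeSet := by
    rw [SimpleGraph.mem_edgeSet]
    exact SimpleGraph.not_adj_sum_inl_inr _ _
  have hc : Nat.card (T₁.sum T₂).edgeSet = Nat.card T₁.edgeSet + Nat.card T₂.edgeSet := by
    rw [Nat.card_congr SimpleGraph.edgeSetSumEquiv, Nat.card_sum]
  have h3 := Set.ncard_insert_of_notMem hnot (Set.toFinite _)
  rw [← h, ← Nat.card_coe_set_eq, ← Nat.card_coe_set_eq, hc] at h3
  rw [h3, Nat.card_sum]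
  omega

/-- The left inclusion into a join. -/
def joinInl (T₁ : SimpleGraph W₁) (T₂ : SimpleGraph W₂) (a : W₁) (b : W₂) :
    T₁ →g join T₁ T₂ a b where
  toFun := Sum.inl
  map_rel' h := Or.inl (SimpleGraph.sum_adj_inl.2 h)

/-- The right inclusion into a join. -/
def joinInr (T₁ : SimpleGraph W₁) (T₂ : SimpleGraph W₂) (a : W₁) (b : W₂) :
    T₂ →g join T₁ T₂ a b where
  toFun := Sum.inr
  map_rel' h := Or.inl (SimpleGraph.sum_adj_inr.2 h)

theorem seg_join_inl [Finite W₁] [Finite W₂] (h₁ : T₁.IsTree) (h₂ : T₂.IsTree) (x y : W₁) :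
    seg (join T₁ T₂ a b) (Sum.inl x) (Sum.inl y) = Sum.inl '' seg T₁ x y := by
  obtain ⟨p, hp⟩ := exists_isPath h₁ x y
  have hp' : (p.map (joinInl T₁ T₂ a b)).IsPath :=
    (SimpleGraph.Walk.isPath_map_iff_of_injective Sum.inl_injective).2 hp
  rw [seg_eq_support h₁ hp]
  refine (seg_eq_support (isTree_join h₁ h₂) hp').trans ?_
  ext z
  rw [Set.mem_ofPred_eq, SimpleGraph.Walk.support_map, List.mem_map]
  rfl

theorem seg_join_inr [Finite W₁] [Finite W₂] (h₁ : T₁.IsTree) (h₂ : T₂.IsTree) (x y : W₂) :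
    seg (join T₁ T₂ a b) (Sum.inr x) (Sum.inr y) = Sum.inr '' seg T₂ x y := by
  obtain ⟨p, hp⟩ := exists_isPath h₂ x y
  have hp' : (p.map (joinInr T₁ T₂ a b)).IsPath :=
    (SimpleGraph.Walk.isPath_map_iff_of_injective Sum.inr_injective).2 hp
  rw [seg_eq_support h₂ hp]
  refine (seg_eq_support (isTree_join h₁ h₂) hp').trans ?_
  ext z
  rw [Set.mem_ofPred_eq, SimpleGraph.Walk.support_map, List.mem_map]
  rfl

theorem seg_join_inl_inr [Finite W₁] [Finite W₂] (h₁ : T₁.IsTree) (h₂ : T₂.IsTree) (x : W₁)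
    (y : W₂) : seg (join T₁ T₂ a b) (Sum.inl x) (Sum.inr y) =
      Sum.inl '' seg T₁ x a ∪ Sum.inr '' seg T₂ b y := by
  obtain ⟨p, hp⟩ := exists_isPath h₁ x a
  obtain ⟨q, hq⟩ := exists_isPath h₂ b y
  have hab : (join T₁ T₂ a b).Adj (joinInl T₁ T₂ a b a) (joinInr T₁ T₂ a b b) :=
    Or.inr ((SimpleGraph.edge_adj ..).2 ⟨Or.inl ⟨rfl, rfl⟩, Sum.inl_ne_inr⟩)
  let w := (p.map (joinInl T₁ T₂ a b)).append
    (SimpleGraph.Walk.cons hab (q.map (joinInr T₁ T₂ a b)))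
  have hw : w.support = p.support.map Sum.inl ++ q.support.map Sum.inr := by
    simp only [w, SimpleGraph.Walk.support_append, SimpleGraph.Walk.support_map,
      SimpleGraph.Walk.support_cons, List.tail_cons]
    rfl
  have hwp : w.IsPath := by
    rw [SimpleGraph.Walk.isPath_def, hw, List.nodup_append]
    refine ⟨(List.nodup_map_iff Sum.inl_injective).2 hp.support_nodup,
      (List.nodup_map_iff Sum.inr_injective).2 hq.support_nodup, ?_⟩
    intro z hz z' hz'
    obtain ⟨t, -, rfl⟩ := List.mem_map.1 hz
    obtain ⟨t', -, rfl⟩ := List.mem_map.1 hz'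
    simp
  rw [seg_eq_support h₁ hp, seg_eq_support h₂ hq]
  refine (seg_eq_support (isTree_join h₁ h₂) hwp).trans ?_
  ext z
  rw [Set.mem_ofPred_eq, hw, List.mem_append, List.mem_map, List.mem_map]
  rfl

end

/-! ### Representations by paths of a tree -/

section

variable {V W : Type u} {G : SimpleGraph V} {Q : Set V} {T : SimpleGraph W} {φ : V → Set W}

/-- A representation of the subgraph of `G` induced by `S` by (not necessarily distinct) paths of a
tree. -/
structure IsPathRepOn (G : SimpleGraph V) (S : Set V) (T : SimpleGraph W) (φ : V → Set W) :
    Prop where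
  isTree : T.IsTree
  exists_seg : ∀ v ∈ S, ∃ a b, φ v = seg T a b
  adj_iff : ∀ v ∈ S, ∀ w ∈ S, v ≠ w → (G.Adj v w ↔ (φ v ∩ φ w).Nonempty)

/-- A representation of `G` by (not necessarily distinct) paths of a tree. -/
abbrev IsPathRep (G : SimpleGraph V) (T : SimpleGraph W) (φ : V → Set W) : Prop :=
  IsPathRepOn G Set.univ T φ

/-- The vertex `q` cuts the segment into two halves: `x` and `y` are comparable as seen from `q`
when in the same half, and separated by `q` otherwise. -/
theorem seg_cases (hT : T.IsTree) {a b q x y : W} (hq : q ∈ seg T a b) (hx : x ∈ seg T a b)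
    (hy : y ∈ seg T a b) : x ∈ seg T q y ∨ y ∈ seg T q x ∨ q ∈ seg T x y := by
  have key : ∀ {a b x y : W}, q ∈ seg T a b → x ∈ seg T a q → y ∈ seg T q b → q ∈ seg T x y := by
    intro a b x y hq hx hy
    have h1 := mem_seg_of_mem_of_mem hT hq hx
    rw [seg_comm] at h1 hy
    have h2 := mem_seg_of_mem_of_mem hT h1 hy
    rwa [seg_comm] at h2
  rcases seg_subset_union a b q hx with h1 | h1 <;> rcases seg_subset_union a b q hy with h2 | h2
  · rw [seg_comm] at h1 h2
    exact (seg_chain hT h1 h2).imp_right Or.inl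
  · exact Or.inr (Or.inr (key hq h1 h2))
  · have := key hq h2 h1
    rw [seg_comm] at this
    exact Or.inr (Or.inr this)
  · exact (seg_chain hT h1 h2).imp_right Or.inl

theorem IsPathRepOn.convex {S : Set V} (h : IsPathRepOn G S T φ) {v : V} (hv : v ∈ S) :
    SegConvex T (φ v) := by
  obtain ⟨a, b, hab⟩ := h.exists_seg v hv
  rw [hab]
  exact segConvex_seg a b

theorem IsPathRepOn.nonempty {S : Set V} (h : IsPathRepOn G S T φ) {v : V} (hv : v ∈ S) :
    (φ v).Nonempty := by
  obtain ⟨a, b, hab⟩ := h.exists_seg v hv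
  rw [hab]
  exact ⟨a, left_mem_seg a b⟩

theorem IsPathRepOn.adj_of_mem {S : Set V} (h : IsPathRepOn G S T φ) {v w : V} (hvS : v ∈ S)
    (hwS : w ∈ S) (hne : v ≠ w) {x : W} (hv : x ∈ φ v) (hw : x ∈ φ w) : G.Adj v w :=
  (h.adj_iff v hvS w hwS hne).2 ⟨x, hv, hw⟩

/-- A maximal clique is the set of all vertices whose paths contain a certain node. -/
theorem IsPathRepOn.exists_node [Finite V] [Finite W] {S : Set V} (h : IsPathRepOn G S T φ)
    {K : Set V} (hK : IsMaxClique G K) (hKS : K ⊆ S) : ∃ q, ∀ v ∈ S, (q ∈ φ v ↔ v ∈ K) := by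
  obtain ⟨q, hq⟩ := exists_mem_of_pairwise h.isTree (Set.toFinite K)
    (fun v hv => h.convex (hKS hv)) (fun v hv => h.nonempty (hKS hv))
    (fun v hv w hw hne => (h.adj_iff v (hKS hv) w (hKS hw) hne).1 (hK.prop.1 hv hw hne))
  refine ⟨q, fun v hvS => ⟨fun hv => ?_, hq v⟩⟩
  exact IsMaxClique.mem_of_forall hK fun w hw hne =>
    h.adj_of_mem hvS (hKS hw) hne.symm hv (hq w hw)

/-- The nodes used by the vertices of a component of `G - Q`. -/
def compNodes (G : SimpleGraph V) (Q : Set V) (φ : V → Set W) (c : Comp G Q) : Set W :=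
  {x | ∃ v ∈ compSet G Q c, x ∈ φ v}

/-- Along a walk inside the component consecutive paths intersect, so their union is connected. -/
theorem IsPathRepOn.convex_compNodes {S : Set V} (h : IsPathRepOn G S T φ) {c : Comp G Q}
    (hc : compSet G Q c ⊆ S) : SegConvex T (compNodes G Q φ c) := by
  rintro a ⟨v, hv, hav⟩ b ⟨w, hw, hbw⟩
  obtain ⟨hvQ, hvc⟩ := mem_compSet.1 hv
  obtain ⟨hwQ, hwc⟩ := mem_compSet.1 hw
  have hr : (G.induce Qᶜ).Reachable ⟨v, hvQ⟩ ⟨w, hwQ⟩ :=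
    SimpleGraph.ConnectedComponent.exact (hvc.trans hwc.symm)
  obtain ⟨p⟩ := hr
  have key : ∀ (v w : ↥(Qᶜ : Set V)) (p : (G.induce Qᶜ).Walk v w), v.1 ∈ compSet G Q c →
      ∀ a ∈ φ v, ∀ b ∈ φ w, seg T a b ⊆ compNodes G Q φ c := by
    intro v w p
    induction p with
    | nil => exact fun hv a ha b hb x hx => ⟨_, hv, h.convex (hc hv) a ha b hb hx⟩
    | @cons v v' w hadj p ih =>
      intro hv a ha b hb
      have hadj' : G.Adj v v' := hadj
      have hv' := mem_compSet_of_adj hv hadj' v'.2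
      obtain ⟨z, hzv, hzv'⟩ := (h.adj_iff v (hc hv) v' (hc hv') hadj'.ne).1 hadj'
      exact (seg_subset_union a b z).trans (Set.union_subset
        (fun x hx => ⟨v, hv, h.convex (hc hv) a ha z hzv hx⟩) (ih hv' z hzv' b hb))
  exact key _ _ p hv a hav b hbw

theorem notMem_compNodes {q : W} {c : Comp G Q} (hq : ∀ v ∈ compSet G Q c, q ∈ φ v → v ∈ Q) :
    q ∉ compNodes G Q φ c := by
  rintro ⟨v, hv, hqv⟩
  exact notMem_of_mem_compSet hv (hq v hv hqv)

/-- A common node makes two vertices outside `Q` equal or adjacent, so distinct components use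
disjoint sets of nodes. -/
theorem IsPathRepOn.compNodes_eq {S : Set V} (h : IsPathRepOn G S T φ) {c d : Comp G Q}
    (hcS : compSet G Q c ⊆ S) (hdS : compSet G Q d ⊆ S) {x : W}
    (hc : x ∈ compNodes G Q φ c) (hd : x ∈ compNodes G Q φ d) : c = d := by
  obtain ⟨v, hv, hxv⟩ := hc
  obtain ⟨w, hw, hxw⟩ := hd
  by_cases hvw : v = w
  · subst hvw
    exact compSet_eq_of_mem hv hw
  · exact compSet_eq_of_mem (mem_compSet_of_adj hv
      (h.adj_of_mem (hcS hv) (hdS hw) hvw hxv hxw) (notMem_of_mem_compSet hw)) hw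

/-- A path graph has good colorings at all its maximal cliques. -/
theorem IsPathRepOn.hasGoodColoring [Finite V] [Finite W] (h : IsPathRep G T φ)
    (hQ : IsMaxClique G Q) : HasGoodColoring G Q := by
  have hT := h.isTree
  have hQc : G.IsClique Q := hQ.prop.1
  obtain ⟨q, hq'⟩ := h.exists_node hQ (Set.subset_univ _)
  have hq : ∀ v, q ∈ φ v ↔ v ∈ Q := fun v => hq' v trivial
  have hsub : ∀ c, compSet G Q c ⊆ Set.univ := fun c => Set.subset_univ _
  have hqc : ∀ c, q ∉ compNodes G Q φ c := fun c => notMem_compNodes fun v _ => (hq v).1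
  have hg : ∀ c : Comp G Q, ∃ m ∈ compNodes G Q φ c, ∀ u ∈ compNodes G Q φ c, m ∈ seg T q u := by
    intro c
    obtain ⟨v, hv⟩ := compSet_nonempty c
    obtain ⟨x, hx⟩ := h.nonempty (v := v) trivial
    exact exists_gate hT (h.convex_compNodes (hsub c)) ⟨x, v, hv, hx⟩ q
  choose m hm hgate using hg
  have hmq : ∀ c, m c ≠ q := fun c he => hqc c (he ▸ hm c)
  have hmem : ∀ {c x}, x ∈ nbr G Q c → q ∈ φ x ∧ m c ∈ φ x := by
    intro c x hx
    obtain ⟨hxQ, y, hy, hxy⟩ := (mem_nbr_iff hQc).1 hx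
    obtain ⟨z, hzx, hzy⟩ := (h.adj_iff x trivial y trivial hxy.ne).1 hxy
    exact ⟨(hq x).2 hxQ, h.convex (v := x) trivial q ((hq x).2 hxQ) z hzx (hgate c z ⟨y, hy, hzy⟩)⟩
  -- The color is the branch at `q` that contains the gate `m c`.
  let f : Comp G Q → Set W := fun c => {x | q ∉ seg T x (m c)}
  have hfeq : ∀ c d, f c = f d ↔ q ∉ seg T (m c) (m d) := by
    intro c d
    constructor
    · intro he
      have : m c ∈ f c := by
        change q ∉ seg T (m c) (m c)
        rw [seg_self]
        exact fun h1 => hmq c h1.symm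
      rw [he] at this
      exact this
    · intro hcd
      ext x
      change q ∉ seg T x (m c) ↔ q ∉ seg T x (m d)
      constructor
      · intro h1 h2
        exact (seg_subset_union x (m d) (m c) h2).elim h1 hcd
      · intro h1 h2
        rw [seg_comm] at hcd
        exact (seg_subset_union x (m c) (m d) h2).elim h1 hcd
  -- In one branch, the member whose gate is closer to `q` dominates: paths from `q` to the farther
  -- gate meet the closer component in the same way.
  have hdom : ∀ {c d x}, c ≠ d → x ∈ nbr G Q c → x ∈ nbr G Q d → q ∉ seg T (m c) (m d) →
      m c ∈ seg T q (m d) → Dominated G Q d c := by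
    intro c d x hcd hxc hxd hsame hle
    rw [dominated_iff_nbr]
    refine ⟨⟨x, hxd, hxc⟩, fun L hL => ?_⟩
    by_contra hcon
    push Not at hcon
    obtain ⟨hnsub, y₀, hy₀, hy₀L⟩ := hcon
    obtain ⟨hLmax, -, v, hvL, hvc⟩ := (isRelevant_iff hQc).1 hL
    obtain ⟨l, hl⟩ := h.exists_node hLmax (Set.subset_univ _)
    have hlc : l ∈ compNodes G Q φ c := ⟨v, hvc, (hl v trivial).2 hvL⟩
    obtain ⟨hqy, hmy⟩ := hmem hy₀
    have hly := (hl y₀ trivial).2 hy₀L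
    obtain ⟨a, b, hab⟩ := h.exists_seg y₀ trivial
    rw [hab] at hqy hmy hly
    -- If the node `l` of `L` lies between `q` and `m d`, all paths of `nbr d` contain it, so `nbr d
    -- ⊆ L`. If `m d` lies between `q` and `l`, it lies between two nodes of `c`, a contradiction.
    -- Finally, `q` cannot separate `l` from `m d`, as both are in the branch of `m c`.
    rcases seg_cases hT hqy hly hmy with h1 | h1 | h1
    · apply hnsub
      intro y hy
      obtain ⟨hqy', hmy'⟩ := hmem hy
      exact (hl y trivial).1 (h.convex (v := y) trivial q hqy' _ hmy' h1)
    · have h2 := h.convex_compNodes (hsub c) _ (hm c) _ hlc (mem_seg_of_mem_of_mem hT h1 hle)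
      exact hcd (h.compNodes_eq (hsub c) (hsub d) h2 (hm d))
    · rcases seg_subset_union l (m d) (m c) h1 with h2 | h2
      · exact hqc c (h.convex_compNodes (hsub c) _ hlc _ (hm c) h2)
      · exact hsame h2
  refine ⟨Set W, f, ?_, ?_⟩
  · intro c d hcd he
    obtain ⟨hne, hatt, h1, h2⟩ := hcd
    rw [attached_iff_nbr] at hatt
    obtain ⟨x, hxc, hxd⟩ := hatt
    have hs := (hfeq c d).1 he
    have hs' := hs
    rw [seg_comm] at hs'
    obtain ⟨hqx, hmc⟩ := hmem hxc
    obtain ⟨-, hmd⟩ := hmem hxd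
    obtain ⟨a, b, hab⟩ := h.exists_seg x trivial
    rw [hab] at hqx hmc hmd
    rcases seg_cases hT hqx hmc hmd with h3 | h3 | h3
    · exact h2 (hdom hne hxc hxd hs h3)
    · exact h1 (hdom hne.symm hxd hxc hs' h3)
    · exact hs h3
  · intro x a b c ha hb hc
    obtain ⟨s, t, hst⟩ := h.exists_seg x trivial
    have h1 := (hmem ha).2
    have h2 := (hmem hb).2
    have h3 := (hmem hc).2
    rw [hst] at h1 h2 h3
    rw [hfeq, hfeq, hfeq]
    exact exists_notMem_seg hT h1 h2 h3 (hmq a) (hmq b) (hmq c)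

end

/-! ### Chordal graphs -/

section

variable {V : Type u} {G : SimpleGraph V} {Q : Set V}

/-- A shortest path from a vertex to a set of vertices. -/
theorem exists_shortest {X : Type u} (H : SimpleGraph X) {v z : X} (Z : Set X) (hz : z ∈ Z)
    (hr : H.Reachable v z) :
    ∃ (m : ℕ) (s : ℕ → X), s 0 = v ∧ s m ∈ Z ∧ (∀ i < m, s i ∉ Z) ∧
      (∀ i < m, H.Adj (s i) (s (i + 1))) ∧
      ∀ i j, i < j → j ≤ m → s i ≠ s j ∧ (H.Adj (s i) (s j) → j = i + 1) := by
  classical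
  have hex : ∃ m, ∃ s : ℕ → X, s 0 = v ∧ s m ∈ Z ∧ ∀ i < m, H.Adj (s i) (s (i + 1)) := by
    obtain ⟨p⟩ := hr
    exact ⟨p.length, p.getVert, p.getVert_zero, by simpa using hz, fun i hi => p.adj_getVert_succ hi⟩
  obtain ⟨s, h0, hm, hadj⟩ := Nat.find_spec hex
  have hmin := fun {m} => Nat.find_min hex (m := m)
  set m := Nat.find hex
  have hfirst : ∀ i < m, s i ∉ Z := fun i hi hiZ =>
    hmin hi ⟨s, h0, hiZ, fun j hj => hadj j (by omega)⟩
  refine ⟨m, s, h0, hm, hfirst, hadj, ?_⟩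
  · intro i j hij hj
    constructor
    · intro he
      have hjm : j ≠ m := by
        rintro rfl
        exact hfirst i hij (he ▸ hm)
      refine hmin (m := m - (j - i)) (by omega)
        ⟨fun t => s (if t ≤ i then t else t + (j - i)), ?_, ?_, ?_⟩
      · simpa using h0
      · beta_reduce
        rw [if_neg (by omega), show m - (j - i) + (j - i) = m by omega]
        exact hm
      · intro t ht
        beta_reduce
        rcases lt_trichotomy t i with h1 | h1 | h1
        · rw [if_pos (by omega), if_pos (by omega)]; exact hadj t (by omega)
        · subst h1
          rw [if_pos le_rfl, if_neg (by omega), show t + 1 + (j - t) = j + 1 by omega, he]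
          exact hadj j (by omega)
        · rw [if_neg (by omega), if_neg (by omega),
            show t + 1 + (j - i) = t + (j - i) + 1 by omega]
          exact hadj _ (by omega)
    · intro ha
      by_contra hne
      refine hmin (m := m - (j - i - 1)) (by omega)
        ⟨fun t => s (if t ≤ i then t else t + (j - i - 1)), ?_, ?_, ?_⟩
      · simpa using h0
      · beta_reduce
        rw [if_neg (by omega), show m - (j - i - 1) + (j - i - 1) = m by omega]
        exact hm
      · intro t ht
        beta_reduce
        rcases lt_trichotomy t i with h1 | h1 | h1
        · rw [if_pos (by omega), if_pos (by omega)]; exact hadj t (by omega)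
        · subst h1
          rw [if_pos le_rfl, if_neg (by omega), show t + 1 + (j - t - 1) = j by omega]
          exact ha
        · rw [if_neg (by omega), if_neg (by omega),
            show t + 1 + (j - i - 1) = t + (j - i - 1) + 1 by omega]
          exact hadj _ (by omega)

/-- In a chordal graph, some vertex of a component of `G - Q` sees everything in the clique `Q` that
the component sees. -/
theorem IsChordal.exists_principal [Finite V] (hG : IsChordal G) (hQ : G.IsClique Q)
    (c : Comp G Q) :
    ∃ v ∈ compSet G Q c, ∀ x ∈ Q, ∀ y ∈ compSet G Q c, G.Adj x y → G.Adj x v := by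
  classical
  -- A vertex with most neighbors in `Q` works. If it missed `b`, the end of a shortest path from it
  -- to a neighbor of `b` would see `b` and all its neighbors in `Q`.
  obtain ⟨v, hv, hmax⟩ := Set.exists_max_image (compSet G Q c)
    (fun v => {x | x ∈ Q ∧ G.Adj x v}.ncard) (Set.toFinite _) (compSet_nonempty c)
  refine ⟨v, hv, fun b hb y hy hby => ?_⟩
  by_contra hbv
  obtain ⟨hvQ, hvc⟩ := mem_compSet.1 hv
  obtain ⟨hyQ, hyc⟩ := mem_compSet.1 hy
  obtain ⟨m, s, hs0, hsm, hsZ, hadj, hch⟩ := exists_shortest (G.induce Qᶜ) (v := ⟨v, hvQ⟩)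
    (z := ⟨y, hyQ⟩) {z | G.Adj b z} hby
    (SimpleGraph.ConnectedComponent.exact (hvc.trans hyc.symm))
  have hsc : ∀ i ≤ m, (s i).1 ∈ compSet G Q c := by
    intro i
    induction i with
    | zero => intro _; rw [hs0]; exact hv
    | succ i ih =>
      intro hi
      exact mem_compSet_of_adj (ih (by omega)) (hadj i (by omega)) (s (i + 1)).2
  have hall : ∀ a ∈ Q, G.Adj a v → G.Adj a (s m) := by
    intro a ha hav
    have hab : a ≠ b := by rintro rfl; exact hbv hav
    by_contra ham
    -- From the last neighbor `s t` of `a` on the path, the vertices `s t, …, s m, b, a` form an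
    -- induced cycle; it has length `m - t + 3 ≥ 4` because `t < m`.
    obtain ⟨t, ⟨htm, hat⟩, htmax⟩ := Set.exists_max_image {i | i ≤ m ∧ G.Adj a (s i)} id
      ((Set.finite_Iic m).subset fun i hi => hi.1) ⟨0, Nat.zero_le _, by rw [hs0]; exact hav⟩
    have htm' : t < m := lt_of_le_of_ne htm (by rintro rfl; exact ham hat)
    have hat' : ∀ i, t < i → i ≤ m → ¬ G.Adj a (s i) := fun i hi hi' h =>
      absurd (htmax i ⟨hi', h⟩) (by simpa using hi)
    have hsQ : ∀ i, ∀ x ∈ Q, (s i).1 ≠ x := fun i x hx he => (s i).2 (he ▸ hx)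
    have hsadj : ∀ i j, i ≤ m → j ≤ m → (G.Adj (s i) (s j) ↔ j = i + 1 ∨ i = j + 1) := by
      intro i j hi hj
      constructor
      · intro h
        rcases lt_trichotomy i j with h1 | rfl | h1
        · exact Or.inl ((hch i j h1 hj).2 h)
        · exact absurd h G.irrefl
        · exact Or.inr ((hch j i h1 hi).2 h.symm)
      · rintro (rfl | rfl)
        · exact hadj i (by omega)
        · exact SimpleGraph.Adj.symm (hadj j (by omega))
    let n := m - t
    let e : Fin (n + 3) → V := fun i =>
      if i.val ≤ n then (s (t + i)).1 else if i.val = n + 1 then b else a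
    have he : ∀ i j : Fin (n + 3), G.Adj (e i) (e j) ↔ CycAdj (n + 3) i j := by
      have hb' : ∀ i ≤ m, (G.Adj b (s i) ↔ i = m) := by
        intro i hi
        refine ⟨fun h => ?_, fun h => h ▸ hsm⟩
        by_contra hne
        exact hsZ i (by omega) h
      have ha' : ∀ i, t ≤ i → i ≤ m → (G.Adj a (s i) ↔ i = t) := by
        intro i hi hi'
        refine ⟨fun h => ?_, fun h => h ▸ hat⟩
        by_contra hne
        exact hat' i (by omega) hi' h
      intro i j
      have hi := i.2
      have hj := j.2
      have hnm : t + n = m := by omega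
      simp only [e]
      split_ifs with h1 h2 h3 h4 h5 h6 h7 h8
      · rw [hsadj _ _ (by omega) (by omega)]; unfold CycAdj; omega
      · rw [G.adj_comm, hb' _ (by omega)]; unfold CycAdj; omega
      · rw [G.adj_comm, ha' _ (by omega) (by omega)]; unfold CycAdj; omega
      · rw [hb' _ (by omega)]; unfold CycAdj; omega
      · simp only [SimpleGraph.irrefl, false_iff]; unfold CycAdj; omega
      · refine iff_of_true (hQ hb ha hab.symm) ?_; unfold CycAdj; omega
      · rw [ha' _ (by omega) (by omega)]; unfold CycAdj; omega
      · refine iff_of_true (hQ ha hb hab) ?_; unfold CycAdj; omega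
      · simp only [SimpleGraph.irrefl, false_iff]; unfold CycAdj; omega
    have hinj : Function.Injective e := by
      intro i j hij
      have hi := i.2
      have hj := j.2
      have hnm : t + n = m := by omega
      simp only [e] at hij
      apply Fin.ext
      split_ifs at hij with h1 h2 h3 h4 h5 h6 h7 h8
      · by_contra hne
        rcases lt_or_gt_of_ne hne with h | h
        · exact (hch (t + i) (t + j) (by omega) (by omega)).1 (Subtype.ext hij)
        · exact (hch (t + j) (t + i) (by omega) (by omega)).1 (Subtype.ext hij.symm)
      · exact absurd hij (hsQ _ b hb)
      · exact absurd hij (hsQ _ a ha)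
      · exact absurd hij.symm (hsQ _ b hb)
      · omega
      · exact absurd hij.symm hab
      · exact absurd hij.symm (hsQ _ a ha)
      · exact absurd hij hab
      · omega
    refine (hG (n + 3) (by omega)).false ⟨⟨e, hinj⟩, ?_⟩
    intro i j
    rw [cycleGraph_adj_iff (by omega)]
    exact he i j
  have hlt : {x | x ∈ Q ∧ G.Adj x v}.ncard < {x | x ∈ Q ∧ G.Adj x (s m)}.ncard := by
    refine Set.ncard_lt_ncard ⟨fun x hx => ⟨hx.1, hall x hx.1 hx.2⟩, fun hsub => ?_⟩ (Set.toFinite _)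
    exact hbv (hsub (show b ∈ {x | x ∈ Q ∧ G.Adj x (s m)} from ⟨hb, hsm⟩)).2
  exact absurd (hmax _ (hsc m le_rfl)) (not_le.2 hlt)

/-- A chordal graph without clique separators is the union of two cliques. -/
theorem IsChordal.exists_two_cliques [Finite V] (hG : IsChordal G)
    (hno : ∀ Q, ¬ IsCliqueSeparator G Q) :
    ∃ K L : Set V, G.IsClique K ∧ G.IsClique L ∧ K ∪ L = Set.univ ∧
      ∀ x ∈ K, x ∉ L → ∀ y ∈ L, y ∉ K → ¬ G.Adj x y := by
  obtain ⟨K, -, hK⟩ := exists_isMaxClique (G := G) (K := ∅) (by simp)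
  have hsub : ∀ {K : Set V}, IsMaxClique G K → ∀ c d : Comp G K, c = d := by
    intro K hK c d
    by_contra hne
    exact hno K ⟨hK, ⟨c, d, hne⟩⟩
  have hKc : G.IsClique K := hK.prop.1
  by_cases hU : K = Set.univ
  · exact ⟨K, K, hKc, hKc, by rw [Set.union_self, hU], fun x hx hx' => absurd hx hx'⟩
  obtain ⟨z, hz⟩ := (Set.ne_univ_iff_exists_notMem K).1 hU
  obtain ⟨c, hzc⟩ := exists_mem_compSet (G := G) hz
  have hc : ∀ y ∉ K, y ∈ compSet G K c := by
    intro y hy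
    obtain ⟨d, hd⟩ := exists_mem_compSet (G := G) hy
    rwa [hsub hK c d]
  obtain ⟨v, hv, hprin⟩ := hG.exists_principal hKc c
  have hvK := notMem_of_mem_compSet hv
  obtain ⟨L, hL, hLmax⟩ := exists_isMaxClique (G := G) (K := insert v {x | x ∈ K ∧ G.Adj x v}) (by
    rw [SimpleGraph.isClique_insert]
    exact ⟨hKc.subset fun x hx => hx.1, fun x hx _ => hx.2.symm⟩)
  have hvL : v ∈ L := hL (Set.mem_insert _ _)
  -- All vertices outside `K` form one component, so a vertex of `K` with a neighbor there is
  -- adjacent to the principal vertex `v` and was put into `L`.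
  have hout : ∀ x ∈ K, x ∉ L → ∀ y ∉ K, ¬ G.Adj x y := by
    intro x hx hxL y hy hxy
    exact hxL (hL (Set.mem_insert_of_mem _ ⟨hx, hprin x hx y (hc y hy) hxy⟩))
  refine ⟨K, L, hKc, hLmax.prop.1, ?_, fun x hx hxL y _ hyK => hout x hx hxL y hyK⟩
  rw [Set.eq_univ_iff_forall]
  intro y
  by_contra hy
  simp only [Set.mem_union, not_or] at hy
  have hs : ∃ s ∈ K, s ∉ L := by
    by_contra hcon
    push Not at hcon
    exact hvK ((IsMaxClique.eq_of_subset hK hLmax.prop.1 hcon) ▸ hvL)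
  obtain ⟨s, hsK, hsL⟩ := hs
  -- By `hout`, walks in `G - L` starting in `K` stay in `K`. Since `G - L` is connected and
  -- contains a vertex of `K`, nothing remains outside `K ∪ L`.
  have key : ∀ (a b : ↥(Lᶜ : Set V)) (p : (G.induce Lᶜ).Walk a b), a.1 ∈ K → b.1 ∈ K := by
    intro a b p
    induction p with
    | nil => exact id
    | @cons a a' b hadj p ih =>
      intro ha
      apply ih
      by_contra ha'
      exact hout a ha a.2 a' ha' hadj
  have hr : (G.induce Lᶜ).Reachable ⟨s, hsL⟩ ⟨y, hy.2⟩ :=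
    SimpleGraph.ConnectedComponent.exact (hsub hLmax _ _)
  obtain ⟨p⟩ := hr
  exact hy.1 (key _ _ p hsK)

/-- The graph has a representation by paths of a finite tree. -/
def HasPathRep (G : SimpleGraph V) : Prop :=
  ∃ (W : Type u) (_ : Finite W) (T : SimpleGraph W) (φ : V → Set W), IsPathRep G T φ

theorem hasPathRep_of_two_cliques {K L : Set V} (hK : G.IsClique K) (hL : G.IsClique L)
    (hKL : K ∪ L = Set.univ) (hno : ∀ x ∈ K, x ∉ L → ∀ y ∈ L, y ∉ K → ¬ G.Adj x y) :
    HasPathRep G := by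
  classical
  have hpt : (⊥ : SimpleGraph PUnit.{u + 1}).IsTree := SimpleGraph.IsTree.of_subsingleton
  let T := join (⊥ : SimpleGraph PUnit.{u + 1}) (⊥ : SimpleGraph PUnit.{u + 1}) PUnit.unit PUnit.unit
  let l : PUnit.{u + 1} ⊕ PUnit.{u + 1} := Sum.inl PUnit.unit
  let r : PUnit.{u + 1} ⊕ PUnit.{u + 1} := Sum.inr PUnit.unit
  have hll : seg T l l = {l} := seg_self l
  have hrr : seg T r r = {r} := seg_self r
  have hlr : l ≠ r := Sum.inl_ne_inr
  let φ : V → Set (PUnit.{u + 1} ⊕ PUnit.{u + 1}) := fun x =>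
    seg T (if x ∈ K then l else r) (if x ∈ L then r else l)
  have hmem : ∀ x, x ∈ K ∨ x ∈ L := fun x => by
    have : x ∈ K ∪ L := hKL ▸ Set.mem_univ x
    exact this
  have hl : ∀ x, l ∈ φ x ↔ x ∈ K := by
    intro x
    have := hmem x
    by_cases h1 : x ∈ K
    · simp only [φ, h1, if_true, iff_true]
      exact left_mem_seg _ _
    · have h2 : x ∈ L := this.resolve_left h1
      simp only [φ, h1, h2, if_true, if_false, hrr, iff_false]
      exact hlr
  have hr : ∀ x, r ∈ φ x ↔ x ∈ L := by
    intro x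
    have := hmem x
    by_cases h2 : x ∈ L
    · simp only [φ, h2, if_true, iff_true]
      exact right_mem_seg _ _
    · have h1 : x ∈ K := this.resolve_right h2
      simp only [φ, h1, h2, if_true, if_false, hll, iff_false]
      exact hlr.symm
  refine ⟨_, inferInstance, T, φ, isTree_join hpt hpt, fun x _ => ⟨_, _, rfl⟩, ?_⟩
  intro x _ y _ hxy
  constructor
  · intro hadj
    by_cases h1 : x ∈ K ∧ y ∈ K
    · exact ⟨l, (hl x).2 h1.1, (hl y).2 h1.2⟩
    by_cases h2 : x ∈ L ∧ y ∈ L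
    · exact ⟨r, (hr x).2 h2.1, (hr y).2 h2.2⟩
    exfalso
    have hx := hmem x
    have hy := hmem y
    by_cases hxK : x ∈ K
    · exact hno x hxK (by tauto) y (by tauto) (by tauto) hadj
    · exact hno y (by tauto) (by tauto) x (by tauto) hxK hadj.symm
  · rintro ⟨w | w, h1, h2⟩
    · exact hK ((hl x).1 h1) ((hl y).1 h2) hxy
    · exact hL ((hr x).1 h1) ((hr y).1 h2) hxy

end

/-! ### Attachedness graphs along graph embeddings -/

section

variable {V V' : Type u} {G : SimpleGraph V} {G' : SimpleGraph V'} {Q : Set V}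

/-- The map on components of complements of `Q` induced by a graph embedding. -/
def compMap (e : G ↪g G') (Q : Set V) : Comp G Q → Comp G' (e '' Q) :=
  SimpleGraph.ConnectedComponent.map
    { toFun := fun x => ⟨e x.1, fun ⟨_, hy, hyx⟩ => x.2 (e.injective hyx ▸ hy)⟩
      map_rel' := fun {_ _} h => e.map_adj_iff.2 h }

theorem mem_compSet_compMap (e : G ↪g G') {c : Comp G Q} {x : V} (hx : x ∈ compSet G Q c) :
    e x ∈ compSet G' (e '' Q) (compMap e Q c) := by
  obtain ⟨h, rfl⟩ := mem_compSet.1 hx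
  exact mem_compSet.2 ⟨fun ⟨_, hy, hyx⟩ => h (e.injective hyx ▸ hy), rfl⟩

theorem eq_of_mem_compSet {α : Type*} {R : V → α}
    (hR : ∀ x y, x ∉ Q → y ∉ Q → G.Adj x y → R x = R y) {c : Comp G Q} {x y : V}
    (hx : x ∈ compSet G Q c) (hy : y ∈ compSet G Q c) : R x = R y := by
  have hwalk : ∀ {x y : ↥Qᶜ}, (G.induce Qᶜ).Walk x y → R x = R y := by
    intro x y p
    induction p with
    | nil => rfl
    | @cons a b _ h _ ih => exact (hR a.1 b.1 a.2 b.2 h).trans ih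
  obtain ⟨h1, h1'⟩ := mem_compSet.1 hx
  obtain ⟨h2, h2'⟩ := mem_compSet.1 hy
  obtain ⟨p⟩ := SimpleGraph.ConnectedComponent.exact (h1'.trans h2'.symm)
  exact hwalk p

/-- The labeling `R` is constant on components of the larger graph and recovers the original
component, hence acts as a left inverse. -/
theorem compMap_injective (e : G ↪g G') (R : V' → Option (Comp G Q))
    (hR : ∀ x y, x ∉ e '' Q → y ∉ e '' Q → G'.Adj x y → R x = R y)
    (hRe : ∀ (c : Comp G Q) (x : V), x ∈ compSet G Q c → R (e x) = some c) :
    Function.Injective (compMap e Q) := by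
  intro c d hcd
  obtain ⟨x, hx⟩ := compSet_nonempty c
  obtain ⟨y, hy⟩ := compSet_nonempty d
  have := eq_of_mem_compSet hR (mem_compSet_compMap e hx) (hcd ▸ mem_compSet_compMap e hy)
  rw [hRe c x hx, hRe d y hy] at this
  exact Option.some.inj this

end

/-! ### Pulling good colorings back along embeddings -/

section

variable {V V' : Type u} {G : SimpleGraph V} {G' : SimpleGraph V'} {Q : Set V} (e : G ↪g G')
  (F : Comp G Q → Comp G' (e '' Q))

theorem mem_nbr_of_isRelevant_image
    (hF : ∀ c K, IsRelevant G Q c K → IsRelevant G' (e '' Q) (F c) (e '' K))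
    {c : Comp G Q} {x : V} (hx : x ∈ nbr G Q c) : e x ∈ nbr G' (e '' Q) (F c) := by
  obtain ⟨hxQ, K, hK, hxK⟩ := hx
  exact ⟨⟨x, hxQ, rfl⟩, _, hF c K hK, x, hxK, rfl⟩

/-- Dominance quantifies universally over relevant cliques, so it survives having fewer of them.
Attachedness does not and is assumed separately. -/
theorem Dominated.of_isRelevant_image
    (hF : ∀ c K, IsRelevant G Q c K → IsRelevant G' (e '' Q) (F c) (e '' K))
    {c d : Comp G Q} (hatt : Attached G Q c d) (h : Dominated G' (e '' Q) (F c) (F d)) :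
    Dominated G Q c d := by
  rw [attached_iff_nbr] at hatt
  rw [dominated_iff_nbr] at h ⊢
  refine ⟨hatt, fun L hL => ?_⟩
  rcases h.2 _ (hF d L hL) with h1 | h1
  · left
    intro x hx
    obtain ⟨y, hy, hyx⟩ := h1 (mem_nbr_of_isRelevant_image e F hF hx)
    exact e.injective hyx ▸ hy
  · right
    rw [Set.eq_empty_iff_forall_notMem] at h1 ⊢
    rintro x ⟨hx, hxL⟩
    exact h1 _ ⟨mem_nbr_of_isRelevant_image e F hF hx, x, hxL, rfl⟩

theorem antip_adj_of_isRelevant_image (hinj : Function.Injective F)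
    (hF : ∀ c K, IsRelevant G Q c K → IsRelevant G' (e '' Q) (F c) (e '' K))
    {c d : Comp G Q} (h : (attachednessGraph G Q).antip.Adj c d) :
    (attachednessGraph G' (e '' Q)).antip.Adj (F c) (F d) := by
  obtain ⟨hne, hatt, h1, h2⟩ := h
  refine ⟨hinj.ne hne, ?_, fun h => h1 (h.of_isRelevant_image e F hF hatt),
    fun h => h2 (h.of_isRelevant_image e F hF hatt.symm)⟩
  rw [attached_iff_nbr] at hatt ⊢
  obtain ⟨x, hxc, hxd⟩ := hatt
  exact ⟨e x, mem_nbr_of_isRelevant_image e F hF hxc, mem_nbr_of_isRelevant_image e F hF hxd⟩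

theorem HasGoodColoring.of_isRelevant_image (hinj : Function.Injective F)
    (hF : ∀ c K, IsRelevant G Q c K → IsRelevant G' (e '' Q) (F c) (e '' K))
    (h : HasGoodColoring G' (e '' Q)) : HasGoodColoring G Q := by
  obtain ⟨C, f, hf⟩ := h
  exact ⟨C, f ∘ F, fun hcd => hf.ne_of_antip (antip_adj_of_isRelevant_image e F hinj hF hcd),
    fun hc hd hd' => hf.two_colors (mem_nbr_of_isRelevant_image e F hF hc)
      (mem_nbr_of_isRelevant_image e F hF hd) (mem_nbr_of_isRelevant_image e F hF hd')⟩

end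

/-! ### Heredity -/

section

variable {V : Type u} {G : SimpleGraph V} {Q : Set V}

theorem IsChordal.induce (h : IsChordal G) (S : Set V) : IsChordal (G.induce S) := by
  intro n hn
  exact ⟨fun e => (h n hn).false (e.trans (SimpleGraph.Embedding.induce S))⟩

/-- A maximal clique of a member of `Γ_Q` is a maximal clique of the whole graph. -/
theorem isMaxClique_image_of_induce (hQ : IsMaxClique G Q) (c : Comp G Q)
    {K : Set (piece G Q c)} (hK : IsMaxClique (G.induce (piece G Q c)) K) :
    IsMaxClique G (Subtype.val '' K) := by
  have hKc : G.IsClique (Subtype.val '' K) := by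
    rintro _ ⟨x, hx, rfl⟩ _ ⟨y, hy, rfl⟩ hne
    exact hK.prop.1 hx hy (fun h => hne (congrArg _ h))
  refine ⟨⟨hKc, Set.subset_univ _⟩, ?_⟩
  rintro L ⟨hL, -⟩ hKL z hz
  have hin : ∀ z ∈ L, z ∈ piece G Q c → z ∈ Subtype.val '' K := by
    intro z hz hzS
    refine ⟨⟨z, hzS⟩, hK.mem_of_forall ?_, rfl⟩
    intro y hy hne
    exact hL hz (hKL ⟨y, hy, rfl⟩) (fun h => hne (Subtype.ext h.symm))
  by_cases hzS : z ∈ piece G Q c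
  · exact hin z hz hzS
  exfalso
  -- A clique leaving the piece cannot meet the component, so `K` lies in `Q`; being maximal in the
  -- piece it contains `Q`, and the maximality of `Q` excludes `z`.
  have hKQ : Subtype.val '' K ⊆ Q := by
    rintro _ ⟨y, hy, rfl⟩
    by_contra hyQ
    have hyc : y.1 ∈ compSet G Q c := y.2.resolve_right hyQ
    have hyz : y.1 ≠ z := fun h => hzS (h ▸ y.2)
    refine hzS (Or.inl (mem_compSet_of_adj hyc (hL (hKL ⟨y, hy, rfl⟩) hz hyz) ?_))
    exact fun h => hzS (Or.inr h)
  have hQK : Q ⊆ Subtype.val '' K := by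
    intro q hq
    refine ⟨⟨q, Or.inr hq⟩, hK.mem_of_forall ?_, rfl⟩
    intro y hy hne
    exact hQ.prop.1 hq (hKQ ⟨y, hy, rfl⟩) (fun h => hne (Subtype.ext h.symm))
  exact hzS (Or.inr (hQ.le_of_ge ⟨hL, Set.subset_univ _⟩ (hQK.trans hKL) hz))

/-- Vertices outside the piece attach to it only through the clique `Q`, and `Q` minus `Q'` lies in
one component of the piece. Labeling all outside vertices with this component `z` gives the
retraction. -/
theorem compMap_induce_injective (hQ : G.IsClique Q) (c : Comp G Q) (Q' : Set (piece G Q c)) :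
    Function.Injective
      (compMap (SimpleGraph.Embedding.induce (piece G Q c) : G.induce (piece G Q c) ↪g G) Q') := by
  classical
  let H := G.induce (piece G Q c)
  obtain ⟨z, hz⟩ : ∃ z : Option (Comp H Q'), ∀ (d : Comp H Q') (y : piece G Q c),
      y ∈ compSet H Q' d → y.1 ∈ Q → z = some d := by
    by_cases h : ∃ y : piece G Q c, y.1 ∈ Q ∧ y ∉ Q'
    · obtain ⟨y, hyQ, hyQ'⟩ := h
      obtain ⟨d, hd⟩ := exists_mem_compSet (G := H) hyQ'
      refine ⟨some d, fun d' y' hy' hyQ => ?_⟩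
      by_cases hyy : y' = y
      · subst hyy
        rw [compSet_eq_of_mem hd hy']
      · have hadj : H.Adj y' y := hQ hyQ ‹_› (fun h => hyy (Subtype.ext h))
        rw [compSet_eq_of_mem hd (mem_compSet_of_adj hy' hadj hyQ')]
    · exact ⟨none, fun d y hy hyQ => absurd ⟨y, hyQ, notMem_of_mem_compSet hy⟩ h⟩
  let R : V → Option (Comp H Q') := fun x =>
    if h : ∃ (d : Comp H Q') (y : piece G Q c), y ∈ compSet H Q' d ∧ y.1 = x then some h.choose
    else z
  have hRe : ∀ (d : Comp H Q') (y : piece G Q c), y ∈ compSet H Q' d → R y.1 = some d := by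
    intro d y hy
    have h : ∃ (d : Comp H Q') (y' : piece G Q c), y' ∈ compSet H Q' d ∧ y'.1 = y.1 := ⟨d, y, hy, rfl⟩
    obtain ⟨y', hy', hyy⟩ := h.choose_spec
    obtain rfl := Subtype.ext hyy
    simp only [R, dif_pos h, compSet_eq_of_mem hy' hy]
  have hRz : ∀ x, x ∉ piece G Q c → R x = z := by
    intro x hx
    exact dif_neg (fun ⟨_, y, _, hyx⟩ => hx (hyx ▸ y.2))
  have hcross : ∀ x y, x ∉ Subtype.val '' Q' → y ∉ Subtype.val '' Q' → G.Adj x y →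
      x ∈ piece G Q c → R x = R y := by
    intro x y hx hy hxy hxS
    obtain ⟨d, hd⟩ := exists_mem_compSet (G := H) (x := ⟨x, hxS⟩) (Q := Q')
      (fun h => hx ⟨_, h, rfl⟩)
    rw [hRe d ⟨x, hxS⟩ hd]
    by_cases hyS : y ∈ piece G Q c
    · rw [hRe d ⟨y, hyS⟩ (mem_compSet_of_adj hd (show H.Adj ⟨x, hxS⟩ ⟨y, hyS⟩ from hxy)
        (fun h => hy ⟨_, h, rfl⟩))]
    · rw [hRz y hyS, hz d ⟨x, hxS⟩ hd]
      rcases hxS with h | h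
      · exact absurd (Or.inl (mem_compSet_of_adj h hxy (fun h => hyS (Or.inr h)))) hyS
      · exact h
  refine compMap_injective _ R ?_ hRe
  intro x y hx hy hxy
  by_cases hxS : x ∈ piece G Q c
  · exact hcross x y hx hy hxy hxS
  by_cases hyS : y ∈ piece G Q c
  · exact (hcross y x hy hx hxy.symm hyS).symm
  · rw [hRz x hxS, hRz y hyS]

/-- The members of `Γ_Q` inherit good colorings. -/
theorem HasGoodColoring.induce_piece (hQ : IsMaxClique G Q) (c : Comp G Q)
    {Q' : Set (piece G Q c)} (hQ' : IsMaxClique (G.induce (piece G Q c)) Q')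
    (h : HasGoodColoring G (Subtype.val '' Q')) :
    HasGoodColoring (G.induce (piece G Q c)) Q' := by
  let e : G.induce (piece G Q c) ↪g G := SimpleGraph.Embedding.induce (piece G Q c)
  refine HasGoodColoring.of_isRelevant_image e (compMap e Q')
    (compMap_induce_injective hQ.prop.1 c Q') ?_ h
  intro d K hK
  obtain ⟨hK, ⟨x, hxK, hxQ⟩, y, hyK, hyd⟩ := (isRelevant_iff hQ'.prop.1).1 hK
  exact (isRelevant_iff (isMaxClique_image_of_induce hQ c hQ').prop.1).2
    ⟨isMaxClique_image_of_induce hQ c hK, ⟨x, ⟨x, hxK, rfl⟩, x, hxQ, rfl⟩,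
      y, ⟨y, hyK, rfl⟩, mem_compSet_compMap e hyd⟩

theorem HasPathRep.exists_isPathRepOn {S : Set V} (h : HasPathRep (G.induce S)) :
    ∃ (W : Type u) (_ : Finite W) (T : SimpleGraph W) (φ : V → Set W), IsPathRepOn G S T φ := by
  obtain ⟨W, hW, T, φ, hφ⟩ := h
  have key : ∀ (v : V) (hv : v ∈ S), {w | ∃ h : v ∈ S, w ∈ φ ⟨v, h⟩} = φ ⟨v, hv⟩ := by
    intro v hv
    ext w
    exact ⟨fun ⟨_, h⟩ => h, fun h => ⟨hv, h⟩⟩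
  refine ⟨W, hW, T, fun v => {w | ∃ h : v ∈ S, w ∈ φ ⟨v, h⟩}, hφ.isTree, ?_, ?_⟩
  · intro v hv
    rw [key v hv]
    exact hφ.exists_seg _ trivial
  · intro v hv w hw hne
    rw [key v hv, key w hw]
    exact hφ.adj_iff ⟨v, hv⟩ trivial ⟨w, hw⟩ trivial (fun h => hne (congrArg Subtype.val h))

end

/-! ### Rooted representations of the members of `Γ_Q` -/

section

variable {V W : Type u} {G : SimpleGraph V} {Q : Set V} {T : SimpleGraph W} {φ : V → Set W}

/-- A representation of `γ_c` with root `r`: the vertices of the component are represented by the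
paths `ψ v`, a vertex `x` of `Q` is represented by the path from `r` to `e x`, and `e x` depends only
on the relevant cliques containing `x`. -/
structure IsRootedRep (G : SimpleGraph V) (Q : Set V) (c : Comp G Q) (T : SimpleGraph W) (r : W)
    (ψ : V → Set W) (e : V → W) : Prop where
  isTree : T.IsTree
  exists_seg : ∀ v ∈ compSet G Q c, ∃ a b, ψ v = seg T a b
  adj_iff : ∀ v ∈ compSet G Q c, ∀ w ∈ compSet G Q c, v ≠ w →
    (G.Adj v w ↔ (ψ v ∩ ψ w).Nonempty)
  arm : ∀ x ∈ nbr G Q c, ∀ v ∈ compSet G Q c, (G.Adj x v ↔ (seg T r (e x) ∩ ψ v).Nonempty)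
  end_eq : ∀ x ∈ nbr G Q c, ∀ y ∈ nbr G Q c, (∀ L, IsRelevant G Q c L → (x ∈ L ↔ y ∈ L)) →
    e x = e y

/-- The root is the node of `Q`, and each path of a vertex of `Q` is trimmed to end at its farthest
node representing a relevant clique. -/
theorem IsPathRepOn.exists_isRootedRep [Finite V] [Finite W] {c : Comp G Q}
    (h : IsPathRepOn G (piece G Q c) T φ) (hQ : IsMaxClique G Q) :
    ∃ r e, IsRootedRep G Q c T r φ e := by
  have hT := h.isTree
  have hQc : G.IsClique Q := hQ.prop.1
  have hQS : Q ⊆ piece G Q c := Set.subset_union_right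
  have hcS : compSet G Q c ⊆ piece G Q c := Set.subset_union_left
  obtain ⟨q, hq⟩ := h.exists_node hQ hQS
  have hqc : q ∉ compNodes G Q φ c := notMem_compNodes fun v hv => (hq v (hcS hv)).1
  let N : V → Set W := fun x =>
    {w | w ∈ φ x ∧ ∃ L, IsRelevant G Q c L ∧ ∀ v ∈ piece G Q c, (w ∈ φ v ↔ v ∈ L)}
  have hNc : ∀ {x w}, w ∈ N x → w ∈ compNodes G Q φ c := by
    rintro x w ⟨-, L, hL, hw⟩
    obtain ⟨-, -, v, hvL, hvc⟩ := (isRelevant_iff hQc).1 hL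
    exact ⟨v, hvc, (hw v (hcS hvc)).2 hvL⟩
  have hNmem : ∀ {x L}, x ∈ Q → IsRelevant G Q c L → x ∈ L →
      ∃ w ∈ N x, ∀ v ∈ piece G Q c, (w ∈ φ v ↔ v ∈ L) := by
    intro x L hxQ hL hxL
    obtain ⟨w, hw⟩ := h.exists_node ((isRelevant_iff hQc).1 hL).1 hL.1.prop.2
    exact ⟨w, ⟨(hw x (hQS hxQ)).2 hxL, L, hL, hw⟩, hw⟩
  -- The farthest node is chosen as a function of the set `A`, so equal sets `N x` yield equal ends;
  -- this gives `end_eq`.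
  have hmax : ∀ A : Set W, ∃ m, A.Nonempty →
      m ∈ A ∧ ∀ w ∈ A, (seg T q w).ncard ≤ (seg T q m).ncard := by
    intro A
    by_cases hA : A.Nonempty
    · obtain ⟨m, hm, hm'⟩ := Set.exists_max_image A (fun w => (seg T q w).ncard) (Set.toFinite A) hA
      exact ⟨m, fun _ => ⟨hm, hm'⟩⟩
    · exact ⟨q, fun h => absurd h hA⟩
  choose g hg using hmax
  have hsub : ∀ {x}, x ∈ Q → ∀ w ∈ N x, w ∈ seg T q (g (N x)) := by
    intro x hxQ w hw
    obtain ⟨hgN, hgmax⟩ := hg (N x) ⟨w, hw⟩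
    obtain ⟨a, b, hab⟩ := h.exists_seg x (hQS hxQ)
    have hq1 := (hq x (hQS hxQ)).2 hxQ
    have hw1 := hw.1
    have hg1 := hgN.1
    rw [hab] at hq1 hw1 hg1
    rcases seg_cases hT hq1 hw1 hg1 with h1 | h1 | h1
    · exact h1
    · have h2 : seg T q (g (N x)) ⊆ seg T q w := seg_convex (left_mem_seg _ _) h1
      rw [Set.eq_of_subset_of_ncard_le h2 (hgmax w hw)]
      exact right_mem_seg _ _
    -- The root cannot lie between two nodes of `N x`: these belong to the component, whose nodes
    -- are convex and avoid `q`.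
    · exact absurd (h.convex_compNodes hcS _ (hNc hw) _ (hNc hgN) h1) hqc
  refine ⟨q, fun x => g (N x), hT, fun v hv => h.exists_seg v (hcS hv),
    fun v hv w hw => h.adj_iff v (hcS hv) w (hcS hw), ?_, ?_⟩
  · intro x hx v hv
    have hxv : x ≠ v := by
      rintro rfl
      exact notMem_of_mem_compSet hv hx.1
    constructor
    · intro hadj
      obtain ⟨L, hLs, hL⟩ := exists_isMaxClique (G := G) (K := {x, v}) (by
        rw [SimpleGraph.isClique_pair]; exact fun _ => hadj)
      have hLr : IsRelevant G Q c L := (isRelevant_iff hQc).2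
        ⟨hL, ⟨x, hLs (by simp), hx.1⟩, v, hLs (by simp), hv⟩
      obtain ⟨w, hwN, hw⟩ := hNmem hx.1 hLr (hLs (by simp))
      exact ⟨w, hsub hx.1 w hwN, (hw v (hcS hv)).2 (hLs (by simp))⟩
    · rintro ⟨w, hw, hwv⟩
      obtain ⟨hxQ, L, hL, hxL⟩ := hx
      obtain ⟨w', hw', -⟩ := hNmem hxQ hL hxL
      have hgx := (hg (N x) ⟨w', hw'⟩).1.1
      exact h.adj_of_mem (hQS hxQ) (hcS hv) hxv
        (h.convex (hQS hxQ) q ((hq x (hQS hxQ)).2 hxQ) _ hgx hw) hwv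
  · intro x hx y hy hxy
    have : ∀ {x y}, x ∈ Q → y ∈ Q → (∀ L, IsRelevant G Q c L → (x ∈ L ↔ y ∈ L)) → N x ⊆ N y := by
      rintro x y hx hy hxy w ⟨hwx, L, hL, hw⟩
      exact ⟨(hw y (hQS hy)).2 ((hxy L hL).1 ((hw x (hQS hx)).1 hwx)), L, hL, hw⟩
    exact congrArg g (Set.Subset.antisymm (this hx.1 hy.1 hxy)
      (this hy.1 hx.1 fun L hL => (hxy L hL).symm))

end

/-! ### Gluing rooted representations -/

section

variable {V W W' C : Type u} {G : SimpleGraph V} {Q : Set V} {f : Comp G Q → C}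
  {T : SimpleGraph W} {T' : SimpleGraph W'}

/-- A representation of the subgraph of `G` induced by `Q` and the components in `S`. A vertex `x` of
`Q` is represented by the union of the paths from the root `r` to `e x k`, one for every color `k`;
paths of distinct colors meet only in `r`, and `e x k` depends only on the relevant cliques of
color `k` containing `x`. -/
structure IsGlued (G : SimpleGraph V) (Q : Set V) (f : Comp G Q → C) (S : Set (Comp G Q))
    (T : SimpleGraph W) (r : W) (ψ : V → Set W) (e : V → C → W) : Prop where
  isTree : T.IsTree
  exists_seg : ∀ c ∈ S, ∀ v ∈ compSet G Q c, ∃ a b, ψ v = seg T a b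
  adj_iff : ∀ c ∈ S, ∀ d ∈ S, ∀ v ∈ compSet G Q c, ∀ w ∈ compSet G Q d, v ≠ w →
    (G.Adj v w ↔ (ψ v ∩ ψ w).Nonempty)
  arm : ∀ x ∈ Q, ∀ c ∈ S, ∀ v ∈ compSet G Q c,
    (G.Adj x v ↔ ∃ k, (seg T r (e x k) ∩ ψ v).Nonempty)
  root : ∀ x ∈ Q, ∀ k, (∀ c ∈ S, f c = k → x ∉ nbr G Q c) → e x k = r
  end_eq : ∀ x ∈ Q, ∀ y ∈ Q, ∀ k,
    (∀ c ∈ S, f c = k → ∀ L, IsRelevant G Q c L → (x ∈ L ↔ y ∈ L)) → e x k = e y k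
  inter_subset : ∀ x ∈ Q, ∀ y ∈ Q, ∀ k l, k ≠ l → seg T r (e x k) ∩ seg T r (e y l) ⊆ {r}

theorem isGlued_empty : IsGlued G Q f ∅ (⊥ : SimpleGraph PUnit.{u + 1}) PUnit.unit (fun _ => ∅)
    (fun _ _ => PUnit.unit) where
  isTree := SimpleGraph.IsTree.of_subsingleton
  exists_seg _ h := h.elim
  adj_iff _ h := h.elim
  arm _ _ _ h := h.elim
  root _ _ _ _ := rfl
  end_eq _ _ _ _ _ _ := rfl
  inter_subset _ _ _ _ _ _ _ _ _ := rfl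

/-- The members already placed dominate the new one whenever they have its color and are attached to
it, so its tree can be hung at one node, prolonging only the arms of color `f c`. -/
theorem IsGlued.insert [Finite V] [Finite W] [Finite W'] (hQ : G.IsClique Q)
    {S : Set (Comp G Q)} {r : W} {ψ : V → Set W} {e : V → C → W} (h : IsGlued G Q f S T r ψ e)
    {c : Comp G Q} (hcS : c ∉ S) {r' : W'} {ψ' : V → Set W'} {e' : V → W'}
    (h' : IsRootedRep G Q c T' r' ψ' e')
    (hdom : ∀ d ∈ S, f d = f c → Attached G Q c d → Dominated G Q c d) :
    ∃ (a : W) (ψ₁ : V → Set (W ⊕ W')) (e₁ : V → C → W ⊕ W'),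
      IsGlued G Q f (insert c S) (join T T' a r') (Sum.inl r) ψ₁ e₁ := by
  classical
  have hT := h.isTree
  have hT' := h'.isTree
  -- Every relevant clique of an earlier member of this color contains all of `nbr c` or none of it,
  -- so by `end_eq` all these arms end at the same node.
  obtain ⟨a, ha⟩ : ∃ a, ∀ x ∈ nbr G Q c, e x (f c) = a := by
    by_cases hB : (nbr G Q c).Nonempty
    · obtain ⟨x₀, hx₀⟩ := hB
      refine ⟨e x₀ (f c), fun x hx => h.end_eq x hx.1 x₀ hx₀.1 _ fun d hd hfd L hL => ?_⟩
      by_cases hatt : Attached G Q c d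
      · rcases (dominated_iff_nbr.1 (hdom d hd hfd hatt)).2 L hL with h1 | h1
        · exact ⟨fun _ => h1 hx₀, fun _ => h1 hx⟩
        · rw [Set.eq_empty_iff_forall_notMem] at h1
          exact ⟨fun h2 => absurd ⟨hx, h2⟩ (h1 x), fun h2 => absurd ⟨hx₀, h2⟩ (h1 x₀)⟩
      · rw [attached_iff_nbr] at hatt
        exact ⟨fun h2 => absurd ⟨x, hx, hx.1, L, hL, h2⟩ hatt,
          fun h2 => absurd ⟨x₀, hx₀, hx₀.1, L, hL, h2⟩ hatt⟩
    · exact ⟨r, fun x hx => absurd ⟨x, hx⟩ hB⟩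
  let ψ₁ : V → Set (W ⊕ W') := fun v =>
    if v ∈ compSet G Q c then Sum.inr '' ψ' v else Sum.inl '' ψ v
  let e₁ : V → C → W ⊕ W' := fun x k =>
    if x ∈ nbr G Q c ∧ k = f c then Sum.inr (e' x) else Sum.inl (e x k)
  have hψc : ∀ {v}, v ∈ compSet G Q c → ψ₁ v = Sum.inr '' ψ' v := fun hv => if_pos hv
  have hψS : ∀ {d v}, d ∈ S → v ∈ compSet G Q d → ψ₁ v = Sum.inl '' ψ v := by
    intro d v hd hv
    refine if_neg fun hvc => hcS ?_
    rwa [compSet_eq_of_mem hvc hv]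
  have he1 : ∀ {x}, x ∈ nbr G Q c → e₁ x (f c) = Sum.inr (e' x) := fun hx => if_pos ⟨hx, rfl⟩
  have he2 : ∀ {x k}, ¬ (x ∈ nbr G Q c ∧ k = f c) → e₁ x k = Sum.inl (e x k) := fun hx => if_neg hx
  have hinl : ∀ (x k) (z : W), Sum.inl z ∈ seg (join T T' a r') (Sum.inl r) (e₁ x k) ↔
      z ∈ seg T r (e x k) := by
    intro x k z
    by_cases hx : x ∈ nbr G Q c ∧ k = f c
    · obtain ⟨hx, rfl⟩ := hx
      rw [he1 hx, seg_join_inl_inr hT hT', ha x hx]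
      simp
    · rw [he2 hx, seg_join_inl hT hT']
      simp
  have hinr : ∀ (x k) (z : W'), Sum.inr z ∈ seg (join T T' a r') (Sum.inl r) (e₁ x k) ↔
      (x ∈ nbr G Q c ∧ k = f c) ∧ z ∈ seg T' r' (e' x) := by
    intro x k z
    by_cases hx : x ∈ nbr G Q c ∧ k = f c
    · obtain ⟨hx, rfl⟩ := hx
      rw [he1 hx, seg_join_inl_inr hT hT']
      simp [hx]
    · rw [he2 hx, seg_join_inl hT hT']
      simp [hx]
  have hcross : ∀ d ∈ S, ∀ v ∈ compSet G Q c, ∀ w ∈ compSet G Q d,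
      ¬ G.Adj v w ∧ ¬ (ψ₁ v ∩ ψ₁ w).Nonempty := by
    intro d hd v hv w hw
    constructor
    · intro hvw
      have := compSet_eq_of_mem (mem_compSet_of_adj hv hvw (notMem_of_mem_compSet hw)) hw
      exact hcS (this ▸ hd)
    · rw [hψc hv, hψS hd hw]
      rintro ⟨_, ⟨z, -, rfl⟩, y, -, hy⟩
      exact Sum.inl_ne_inr hy
  refine ⟨a, ψ₁, e₁, isTree_join hT hT', ?_, ?_, ?_, ?_, ?_, ?_⟩
  · rintro d (rfl | hd) v hv
    · obtain ⟨s, t, hst⟩ := h'.exists_seg v hv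
      exact ⟨_, _, by rw [hψc hv, hst, seg_join_inr hT hT' s t]⟩
    · obtain ⟨s, t, hst⟩ := h.exists_seg d hd v hv
      exact ⟨_, _, by rw [hψS hd hv, hst, seg_join_inl hT hT' s t]⟩
  · rintro d (rfl | hd) d' (rfl | hd') v hv w hw hne
    · rw [h'.adj_iff v hv w hw hne, hψc hv, hψc hw, ← Set.image_inter Sum.inr_injective,
        Set.image_nonempty]
    · exact iff_of_false (hcross d' hd' v hv w hw).1 (hcross d' hd' v hv w hw).2
    · have := hcross d hd w hw v hv
      rw [SimpleGraph.adj_comm, Set.inter_comm]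
      exact iff_of_false this.1 this.2
    · rw [h.adj_iff d hd d' hd' v hv w hw hne, hψS hd hv, hψS hd' hw,
        ← Set.image_inter Sum.inl_injective, Set.image_nonempty]
  · rintro x hx d (rfl | hd) v hv
    · rw [hψc hv]
      constructor
      · intro hadj
        have hxB : x ∈ nbr G Q d := (mem_nbr_iff hQ).2 ⟨hx, v, hv, hadj⟩
        obtain ⟨z, hz, hzv⟩ := (h'.arm x hxB v hv).1 hadj
        exact ⟨f d, Sum.inr z, (hinr x _ z).2 ⟨⟨hxB, rfl⟩, hz⟩, z, hzv, rfl⟩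
      · rintro ⟨k, _, hz, z, hzv, rfl⟩
        obtain ⟨⟨hxB, -⟩, hz⟩ := (hinr x k z).1 hz
        exact (h'.arm x hxB v hv).2 ⟨z, hz, hzv⟩
    · rw [hψS hd hv, h.arm x hx d hd v hv]
      refine exists_congr fun k => ?_
      constructor
      · rintro ⟨z, hz, hzv⟩
        exact ⟨Sum.inl z, (hinl x k z).2 hz, z, hzv, rfl⟩
      · rintro ⟨_, hz, z, hzv, rfl⟩
        exact ⟨z, (hinl x k z).1 hz, hzv⟩
  · intro x hx k hk
    rw [he2, h.root x hx k fun d hd => hk d (Or.inr hd)]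
    rintro ⟨hxB, rfl⟩
    exact hk c (Or.inl rfl) rfl hxB
  · intro x hx y hy k hk
    have hxy := h.end_eq x hx y hy k fun d hd => hk d (Or.inr hd)
    by_cases hkc : k = f c
    · have hL := hk c (Or.inl rfl) hkc.symm
      subst hkc
      by_cases hxB : x ∈ nbr G Q c
      · have hyB : y ∈ nbr G Q c := by
          obtain ⟨-, L, hL', hxL⟩ := hxB
          exact ⟨hy, L, hL', (hL L hL').1 hxL⟩
        rw [he1 hxB, he1 hyB, h'.end_eq x hxB y hyB hL]
      · have hyB : y ∉ nbr G Q c := by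
          rintro ⟨-, L, hL', hyL⟩
          exact hxB ⟨hx, L, hL', (hL L hL').2 hyL⟩
        rw [he2 (fun h => hxB h.1), he2 (fun h => hyB h.1), hxy]
    · rw [he2 (fun h => hkc h.2), he2 (fun h => hkc h.2), hxy]
  · rintro x hx y hy k l hkl (z | z) ⟨hz, hz'⟩
    · exact congrArg Sum.inl (h.inter_subset x hx y hy k l hkl
        ⟨(hinl x k z).1 hz, (hinl y l z).1 hz'⟩)
    · exact absurd (((hinr x k z).1 hz).1.2.trans ((hinr y l z).1 hz').1.2.symm) hkl

/-- A minimal member is glued last, so that dominating members lie nearer to the root. -/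
theorem IsGoodColoring.exists_isGlued [Finite V] (hQ : G.IsClique Q)
    (hf : IsGoodColoring (attachednessGraph G Q) (nbr G Q) f)
    (hrep : ∀ c : Comp G Q, ∃ (W : Type u) (_ : Finite W) (T : SimpleGraph W) (r : W)
      (ψ : V → Set W) (e : V → W), IsRootedRep G Q c T r ψ e) (S : Finset (Comp G Q)) :
    ∃ (W : Type u) (_ : Finite W) (T : SimpleGraph W) (r : W) (ψ : V → Set W) (e : V → C → W),
      IsGlued G Q f S T r ψ e := by
  classical
  induction S using Finset.strongInduction with
  | H S ih =>
    rcases S.eq_empty_or_nonempty with rfl | hS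
    · rw [Finset.coe_empty]
      exact ⟨_, inferInstance, _, _, _, _, isGlued_empty⟩
    obtain ⟨c, hc, hmin⟩ : ∃ c ∈ S, ∀ d ∈ S, Dominated G Q d c → Dominated G Q c d := by
      let A := attachmentSystem G Q
      have : IsTrans (Comp G Q) A.lt := ⟨fun _ _ _ => A.trans⟩
      have : Std.Irrefl A.lt := ⟨A.irrefl⟩
      obtain ⟨c, hc, hmin⟩ := (Finite.wellFounded_of_trans_of_irrefl A.lt).has_min (S : Set (Comp G Q))
        (Finset.coe_nonempty.2 hS)
      refine ⟨c, hc, fun d hd hdc => ?_⟩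
      by_contra hcd
      exact hmin d hd ⟨hdc, Or.inl hcd⟩
    obtain ⟨W, hW, T, r, ψ, e, h⟩ := ih (S.erase c) (Finset.erase_ssubset hc)
    obtain ⟨W', hW', T', r', ψ', e', h'⟩ := hrep c
    obtain ⟨a, ψ₁, e₁, h₁⟩ := h.insert hQ (by simp) h' (by
      intro d hd hfd hatt
      have hd' := Finset.mem_of_mem_erase hd
      by_contra hcd
      -- Attached members of the same color are not antipodal, hence comparable; minimality of `c`
      -- gives the required direction.
      exact hf.ne_of_antip (a := d) (b := c) ⟨Finset.ne_of_mem_erase hd, hatt.symm,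
        fun h => hcd (hmin d hd' h), hcd⟩ hfd)
    rw [← Finset.coe_insert, Finset.insert_erase hc] at h₁
    exact ⟨_, inferInstance, _, _, _, _, h₁⟩

/-- Only colors seen by `x` have an arm beyond the root. There are at most two, and arms of distinct
colors meet only in `r`, so together they form one segment. -/
theorem IsGlued.exists_seg_eq (hf : IsGoodColoring (attachednessGraph G Q) (nbr G Q) f)
    {r : W} {ψ : V → Set W} {e : V → C → W} (h : IsGlued G Q f Set.univ T r ψ e) {x : V}
    (hx : x ∈ Q) : ∃ a b, {z | z = r ∨ ∃ k, z ∈ seg T r (e x k)} = seg T a b := by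
  have hk : ∃ a b, (a = r ∨ ∃ k, a = e x k) ∧ (b = r ∨ ∃ k, b = e x k) ∧
      (∀ k, e x k = r ∨ e x k = a ∨ e x k = b) ∧ seg T r a ∩ seg T r b ⊆ {r} := by
    by_cases h1 : ∃ c, x ∈ nbr G Q c
    · obtain ⟨c, hc⟩ := h1
      by_cases h2 : ∃ d, x ∈ nbr G Q d ∧ f c ≠ f d
      · obtain ⟨d, hd, hcd⟩ := h2
        refine ⟨e x (f c), e x (f d), Or.inr ⟨_, rfl⟩, Or.inr ⟨_, rfl⟩, fun k => ?_,
          h.inter_subset x hx x hx _ _ hcd⟩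
        by_cases h3 : ∃ d', x ∈ nbr G Q d' ∧ f d' = k
        · obtain ⟨d', hd', rfl⟩ := h3
          rcases hf.two_colors hc hd hd' with h4 | h4 | h4
          · exact absurd h4 hcd
          · exact Or.inr (Or.inr (by rw [h4]))
          · exact Or.inr (Or.inl (by rw [h4]))
        · exact Or.inl (h.root x hx k fun d' _ hd' hxd' => h3 ⟨d', hxd', hd'⟩)
      · refine ⟨e x (f c), r, Or.inr ⟨_, rfl⟩, Or.inl rfl, fun k => ?_, ?_⟩
        · by_cases hkc : f c = k
          · exact Or.inr (Or.inl (by rw [hkc]))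
          · exact Or.inl (h.root x hx k fun d _ hd hxd => h2 ⟨d, hxd, hd ▸ hkc⟩)
        · rw [seg_self]
          exact Set.inter_subset_right
    · refine ⟨r, r, Or.inl rfl, Or.inl rfl, fun k => Or.inl ?_, ?_⟩
      · exact h.root x hx k fun c _ _ hxc => h1 ⟨c, hxc⟩
      · rw [seg_self]
        exact Set.inter_subset_right
  obtain ⟨a, b, ha, hb, hab, hdisj⟩ := hk
  refine ⟨a, b, ?_⟩
  rw [← seg_union_eq h.isTree hdisj]
  have hsub : ∀ {a}, (a = r ∨ ∃ k, a = e x k) →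
      seg T r a ⊆ {z | z = r ∨ ∃ k, z ∈ seg T r (e x k)} := by
    rintro a (rfl | ⟨k, rfl⟩) z hz
    · rw [seg_self] at hz
      exact Or.inl hz
    · exact Or.inr ⟨k, hz⟩
  refine Set.Subset.antisymm ?_ (Set.union_subset (hsub ha) (hsub hb))
  rintro z (rfl | ⟨k, hz⟩)
  · exact Or.inl (left_mem_seg _ _)
  · rcases hab k with h1 | h1 | h1 <;> rw [h1] at hz
    · rw [seg_self] at hz
      exact Or.inl (hz ▸ left_mem_seg _ _)
    · exact Or.inl hz
    · exact Or.inr hz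

theorem IsGlued.hasPathRep [Finite W] (hQ : G.IsClique Q)
    (hf : IsGoodColoring (attachednessGraph G Q) (nbr G Q) f)
    {r : W} {ψ : V → Set W} {e : V → C → W} (h : IsGlued G Q f Set.univ T r ψ e) :
    HasPathRep G := by
  classical
  let φ : V → Set W := fun x => if x ∈ Q then {z | z = r ∨ ∃ k, z ∈ seg T r (e x k)} else ψ x
  have hφQ : ∀ {x}, x ∈ Q → φ x = {z | z = r ∨ ∃ k, z ∈ seg T r (e x k)} := fun hx => if_pos hx
  have hφ : ∀ {x}, x ∉ Q → φ x = ψ x := fun hx => if_neg hx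
  have harm : ∀ {x v}, x ∈ Q → v ∉ Q → (G.Adj x v ↔ (φ x ∩ φ v).Nonempty) := by
    intro x v hx hv
    obtain ⟨c, hc⟩ := exists_mem_compSet (G := G) hv
    rw [h.arm x hx c trivial v hc, hφQ hx, hφ hv]
    constructor
    · rintro ⟨k, z, hz, hzv⟩
      exact ⟨z, Or.inr ⟨k, hz⟩, hzv⟩
    · rintro ⟨z, rfl | ⟨k, hz⟩, hzv⟩
      · exact ⟨f c, z, left_mem_seg _ _, hzv⟩
      · exact ⟨k, z, hz, hzv⟩
  refine ⟨W, inferInstance, T, φ, h.isTree, fun v _ => ?_, fun v _ w _ hne => ?_⟩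
  · by_cases hv : v ∈ Q
    · rw [hφQ hv]
      exact h.exists_seg_eq hf hv
    · rw [hφ hv]
      obtain ⟨c, hc⟩ := exists_mem_compSet (G := G) hv
      exact h.exists_seg c trivial v hc
  · by_cases hv : v ∈ Q <;> by_cases hw : w ∈ Q
    · refine iff_of_true (hQ hv hw hne) ⟨r, ?_, ?_⟩
      · rw [hφQ hv]
        exact Or.inl rfl
      · rw [hφQ hw]
        exact Or.inl rfl
    · exact harm hv hw
    · rw [SimpleGraph.adj_comm, Set.inter_comm]
      exact harm hw hv
    · obtain ⟨c, hc⟩ := exists_mem_compSet (G := G) hv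
      obtain ⟨d, hd⟩ := exists_mem_compSet (G := G) hw
      rw [hφ hv, hφ hw]
      exact h.adj_iff c trivial d trivial v hc w hd hne

/-- A graph with a good coloring at a maximal clique has a path representation if the members of
`Γ_Q` have one. -/
theorem HasGoodColoring.hasPathRep [Finite V] (hQ : IsMaxClique G Q) (h : HasGoodColoring G Q)
    (hrep : ∀ c : Comp G Q, HasPathRep (G.induce (piece G Q c))) : HasPathRep G := by
  classical
  obtain ⟨C, f, hf⟩ := h
  have := Fintype.ofFinite (Comp G Q)
  obtain ⟨W, hW, T, r, ψ, e, h⟩ := hf.exists_isGlued hQ.prop.1 (fun c => by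
    obtain ⟨W, hW, T, φ, hφ⟩ := (hrep c).exists_isPathRepOn
    obtain ⟨r, e, he⟩ := hφ.exists_isRootedRep hQ
    exact ⟨W, hW, T, r, φ, e, he⟩) Finset.univ
  rw [Finset.coe_univ] at h
  exact h.hasPathRep hQ.prop.1 hf

end

/-! ### Path representations from good colorings -/

section

variable {V : Type u} {G : SimpleGraph V} {Q : Set V}

theorem hasGoodColoring_of_not_isCliqueSeparator (hQ : IsMaxClique G Q)
    (h : ¬ IsCliqueSeparator G Q) : HasGoodColoring G Q := by
  have hs : Subsingleton (Comp G Q) := not_nontrivial_iff_subsingleton.1 fun h' => h ⟨hQ, h'⟩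
  exact ⟨PUnit, fun _ => PUnit.unit, fun hab => absurd (Subsingleton.elim _ _) hab.1,
    fun _ _ _ => Or.inl rfl⟩

/-- A chordal graph with good colorings at all its clique separators has a path representation. -/
theorem IsChordal.hasPathRep [Finite V] (hG : IsChordal G)
    (h : ∀ Q, IsCliqueSeparator G Q → HasGoodColoring G Q) : HasPathRep G := by
  induction hn : Nat.card V using Nat.strong_induction_on generalizing V with
  | _ n ih =>
    by_cases hsep : ∃ Q, IsCliqueSeparator G Q
    · obtain ⟨Q, hQ⟩ := hsep
      refine HasGoodColoring.hasPathRep hQ.1 (h Q hQ) fun c => ?_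
      have hcard : Nat.card (piece G Q c) < n := by
        have := hQ.2
        obtain ⟨d, hd⟩ := exists_ne c
        obtain ⟨y, hy⟩ := compSet_nonempty d
        rw [← hn]
        refine Finite.card_subtype_lt (x := y) fun hyc => ?_
        rcases hyc with hyc | hyc
        · exact hd (compSet_eq_of_mem hy hyc)
        · exact notMem_of_mem_compSet hy hyc
      refine ih _ hcard (hG.induce _) (fun Q' hQ' => ?_) rfl
      have hmax := isMaxClique_image_of_induce hQ.1 c hQ'.1
      refine HasGoodColoring.induce_piece hQ.1 c hQ'.1 ?_
      -- The image is a maximal clique of `G`; if it does not separate, a single color suffices.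
      by_cases hs : IsCliqueSeparator G (Subtype.val '' Q')
      · exact h _ hs
      · exact hasGoodColoring_of_not_isCliqueSeparator hmax hs
    · push Not at hsep
      obtain ⟨K, L, hK, hL, hKL, hno⟩ := hG.exists_two_cliques hsep
      exact hasPathRep_of_two_cliques hK hL hKL hno

/-! ### Representations with private nodes -/

/-- A new leaf at an end of the path of `v` prolongs this path only and creates no new
intersections. Private nodes make paths distinct and leave room for pendant vertices. -/
theorem HasPathRep.exists_private (h : HasPathRep G) (S : Finset V) :
    ∃ (W : Type u) (_ : Finite W) (T : SimpleGraph W) (φ : V → Set W) (p : V → W),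
      IsPathRep G T φ ∧ ∀ v ∈ S, p v ∈ φ v ∧ ∀ u, u ≠ v → p v ∉ φ u := by
  classical
  induction S using Finset.induction_on with
  | empty =>
    obtain ⟨W, hW, T, φ, hφ⟩ := h
    have := hφ.isTree.connected.nonempty
    exact ⟨W, hW, T, φ, fun _ => Classical.arbitrary W, hφ, by simp⟩
  | insert v S hv ih =>
    obtain ⟨W, hW, T, φ, p, hφ, hp⟩ := ih
    obtain ⟨a, b, hab⟩ := hφ.exists_seg v trivial
    have hT := hφ.isTree
    have hpt : (⊥ : SimpleGraph PUnit.{u + 1}).IsTree := SimpleGraph.IsTree.of_subsingleton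
    let φ₁ : V → Set (W ⊕ PUnit.{u + 1}) := fun u => {z | (∃ y ∈ φ u, z = Sum.inl y) ∨
      (u = v ∧ z = Sum.inr PUnit.unit)}
    have hinl : ∀ u y, Sum.inl y ∈ φ₁ u ↔ y ∈ φ u := by simp [φ₁]
    have hinr : ∀ u y, Sum.inr y ∈ φ₁ u ↔ u = v := by simp [φ₁]
    refine ⟨W ⊕ PUnit.{u + 1}, inferInstance, join T ⊥ b PUnit.unit, φ₁,
      fun u => if u = v then Sum.inr PUnit.unit else Sum.inl (p u), ⟨isTree_join hT hpt, ?_, ?_⟩, ?_⟩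
    · intro u _
      by_cases huv : u = v
      · subst huv
        refine ⟨Sum.inl a, Sum.inr PUnit.unit, ?_⟩
        rw [seg_join_inl_inr hT hpt, seg_self, ← hab]
        ext (z | z) <;> simp [hinl, hinr]
      · obtain ⟨s, t, hst⟩ := hφ.exists_seg u trivial
        refine ⟨Sum.inl s, Sum.inl t, ?_⟩
        rw [seg_join_inl hT hpt, ← hst]
        ext (z | z) <;> simp [hinl, hinr, huv]
    · intro u _ w _ hne
      rw [hφ.adj_iff u trivial w trivial hne]
      constructor
      · rintro ⟨z, hz, hz'⟩
        exact ⟨Sum.inl z, (hinl u z).2 hz, (hinl w z).2 hz'⟩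
      · rintro ⟨z | z, hz, hz'⟩
        · exact ⟨z, (hinl u z).1 hz, (hinl w z).1 hz'⟩
        · exact absurd (((hinr u z).1 hz).trans ((hinr w z).1 hz').symm) hne
    · intro u hu
      by_cases huv : u = v
      · subst huv
        simp only [if_true, hinr, true_and]
        exact fun _ h => h
      · obtain ⟨h1, h2⟩ := hp u ((Finset.mem_insert.1 hu).resolve_left huv)
        simp only [if_neg huv, hinl]
        exact ⟨h1, h2⟩

theorem HasPathRep.isPathGraph [Finite V] (h : HasPathRep G) : IsPathGraph G := by
  have := Fintype.ofFinite V
  obtain ⟨W, hW, T, φ, p, hφ, hp⟩ := h.exists_private Finset.univ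
  refine ⟨W, hW, T, φ, hφ.isTree, fun v => (isPathSet_iff hφ.isTree).2 (hφ.exists_seg v trivial),
    ?_, fun v w => hφ.adj_iff v trivial w trivial⟩
  intro v w hvw
  by_contra hne
  exact (hp w (Finset.mem_univ _)).2 v hne (hvw ▸ (hp w (Finset.mem_univ _)).1)

theorem IsPathGraph.hasPathRep (h : IsPathGraph G) : HasPathRep G := by
  obtain ⟨W, hW, T, φ, hT, hφ, -, hadj⟩ := h
  exact ⟨W, hW, T, φ, hT, fun v _ => (isPathSet_iff hT).1 (hφ v), fun v _ w _ => hadj v w⟩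

theorem HasPathRep.add_pendants [Finite V] (h : HasPathRep G) : HasPathRep (plus G) := by
  have := Fintype.ofFinite V
  obtain ⟨W, hW, T, φ, p, hφ, hp⟩ := h.exists_private Finset.univ
  have hp' : ∀ u v, p v ∈ φ u ↔ u = v := fun u v =>
    ⟨fun h => by_contra fun hne => (hp v (Finset.mem_univ _)).2 u hne h,
      fun h => h ▸ (hp v (Finset.mem_univ _)).1⟩
  refine ⟨W, hW, T, Sum.elim φ fun v => {p v}, hφ.isTree, ?_, ?_⟩
  · rintro (v | v) _
    · exact hφ.exists_seg v trivial
    · exact ⟨p v, p v, (seg_self _).symm⟩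
  · rintro (v | v) _ (w | w) _ hne
    · exact hφ.adj_iff v trivial w trivial fun h => hne (congrArg _ h)
    · change v = w ↔ _
      simp [hp']
    · change v = w ↔ _
      simp [hp', eq_comm]
    · change False ↔ _
      simp only [Sum.elim_inr, false_iff]
      rintro ⟨_, rfl, hz⟩
      have : p v ∈ φ w := by
        rw [show p v = p w from hz, hp']
      exact hne (congrArg _ ((hp' w v).1 this).symm)

end

/-! ### The attachedness graphs of `G⁺` -/

section

variable {V : Type u} {G : SimpleGraph V} {Q : Set V}

/-- A single vertex of `Q` leaves no room for antipodality. This covers isolated vertices of `G`,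
whose singleton cliques are no longer maximal in `G⁺`. -/
theorem hasGoodColoring_of_subsingleton (hQ : Q.Subsingleton) : HasGoodColoring G Q := by
  have key : ∀ c d, Attached G Q c d → Dominated G Q c d := by
    intro c d h
    rw [attached_iff_nbr] at h
    refine dominated_iff_nbr.2 ⟨h, fun L _ => ?_⟩
    by_cases hL : (nbr G Q c ∩ L).Nonempty
    · obtain ⟨x, hx, hxL⟩ := hL
      exact Or.inl fun y hy => hQ hx.1 hy.1 ▸ hxL
    · exact Or.inr (Set.not_nonempty_iff_eq_empty.1 hL)
  exact ⟨PUnit, fun _ => PUnit.unit, fun h => absurd (key _ _ h.2.1) h.2.2.1,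
    fun _ _ _ => Or.inl rfl⟩

/-- The inclusion of `G` into `G⁺`. -/
def plusInl (G : SimpleGraph V) : G ↪g plus G where
  toFun := Sum.inl
  inj' := Sum.inl_injective
  map_rel_iff' := Iff.rfl

theorem isClique_plusInl {K : Set V} (hK : G.IsClique K) :
    (plus G).IsClique (plusInl G '' K) := by
  rintro _ ⟨x, hx, rfl⟩ _ ⟨y, hy, rfl⟩ hne
  exact hK hx hy fun h => hne (congrArg _ h)

theorem isMaxClique_plusInl {K : Set V} (hK : IsMaxClique G K) (h : K.Nontrivial) :
    IsMaxClique (plus G) (plusInl G '' K) := by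
  refine ⟨⟨isClique_plusInl hK.prop.1, Set.subset_univ _⟩, ?_⟩
  rintro L ⟨hL, -⟩ hKL (z | z) hz
  · refine ⟨z, hK.mem_of_forall fun y hy hne => ?_, rfl⟩
    exact hL hz (hKL ⟨y, hy, rfl⟩) fun h => hne (Sum.inl_injective h).symm
  · exfalso
    obtain ⟨x, hx, y, hy, hxy⟩ := h
    have h1 : z = x := hL hz (hKL ⟨x, hx, rfl⟩) Sum.inr_ne_inl
    have h2 : z = y := hL hz (hKL ⟨y, hy, rfl⟩) Sum.inr_ne_inl
    exact hxy (h1.symm.trans h2)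

theorem HasPathRep.hasGoodColoring_plus [Finite V] (h : HasPathRep G) (hQ : IsMaxClique G Q) :
    HasGoodColoring (plus G) (plusInl G '' Q) := by
  rcases Q.subsingleton_or_nontrivial with hs | hs
  · exact hasGoodColoring_of_subsingleton (hs.image _)
  · obtain ⟨W, hW, T, φ, hφ⟩ := h.add_pendants
    exact hφ.hasGoodColoring (isMaxClique_plusInl hQ hs)

/-- Both `v` and `v⁺` are labeled with the component of `v`; the label `none` is reserved for `Q`
and its pendant vertices. -/
theorem exists_compMap_plusInl_retraction (G : SimpleGraph V) (Q : Set V) :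
    ∃ R : V ⊕ V → Option (Comp G Q),
      (∀ x y, x ∉ plusInl G '' Q → y ∉ plusInl G '' Q → (plus G).Adj x y → R x = R y) ∧
      (∀ c x, R (Sum.inl x) = some c ↔ x ∈ compSet G Q c) ∧
      ∀ x ∈ Q, R (Sum.inr x) = none := by
  classical
  let ρ : V → Option (Comp G Q) := fun x =>
    if h : x ∉ Q then some ((G.induce Qᶜ).connectedComponentMk ⟨x, h⟩) else none
  have hρ : ∀ c x, ρ x = some c ↔ x ∈ compSet G Q c := by
    intro c x
    rw [mem_compSet]
    by_cases hx : x ∈ Q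
    · simp [ρ, hx]
    · simp [ρ, hx]
  have hne : ∀ x, (Sum.inl x : V ⊕ V) ∉ plusInl G '' Q → x ∉ Q := fun x hx h => hx ⟨x, h, rfl⟩
  refine ⟨Sum.elim ρ ρ, ?_, hρ, fun x hx => by simp [ρ, hx]⟩
  rintro (x | x) (y | y) hx hy hxy
  · obtain ⟨c, hc⟩ := exists_mem_compSet (G := G) (hne x hx)
    change ρ x = ρ y
    rw [(hρ c x).2 hc, (hρ c y).2 (mem_compSet_of_adj hc hxy (hne y hy))]
  · exact congrArg ρ hxy
  · exact congrArg ρ hxy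
  · exact hxy.elim

theorem compMap_plusInl_injective : Function.Injective (compMap (plusInl G) Q) := by
  obtain ⟨R, hR, hR', -⟩ := exists_compMap_plusInl_retraction G Q
  exact compMap_injective _ R hR fun c x => (hR' c x).2

theorem inl_mem_compSet_compMap_iff {c : Comp G Q} {x : V} :
    Sum.inl x ∈ compSet (plus G) (plusInl G '' Q) (compMap (plusInl G) Q c) ↔
      x ∈ compSet G Q c := by
  refine ⟨fun h => ?_, mem_compSet_compMap (plusInl G)⟩
  have hx : x ∉ Q := fun hx => notMem_of_mem_compSet h ⟨x, hx, rfl⟩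
  obtain ⟨d, hd⟩ := exists_mem_compSet (G := G) hx
  rwa [← compMap_plusInl_injective (compSet_eq_of_mem (mem_compSet_compMap (plusInl G) hd) h)]

theorem inr_notMem_compSet_compMap {c : Comp G Q} {x : V} (hx : x ∈ Q) :
    Sum.inr x ∉ compSet (plus G) (plusInl G '' Q) (compMap (plusInl G) Q c) := by
  obtain ⟨R, hR, hR', hR''⟩ := exists_compMap_plusInl_retraction G Q
  intro h
  obtain ⟨y, hy⟩ := compSet_nonempty c
  have := eq_of_mem_compSet hR h (mem_compSet_compMap (plusInl G) hy)
  rw [hR'' x hx] at this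
  exact absurd (this.trans ((hR' c y).2 hy)) (by simp)

/-- A relevant clique contains a vertex of `Q` and one of the component, whereas a pendant vertex
has a single neighbor; hence no pendant vertex belongs to it. -/
theorem isRelevant_compMap_plusInl_iff (hQ : G.IsClique Q) {c : Comp G Q} {K' : Set (V ⊕ V)} :
    IsRelevant (plus G) (plusInl G '' Q) (compMap (plusInl G) Q c) K' ↔
      ∃ K, IsRelevant G Q c K ∧ K' = plusInl G '' K := by
  rw [isRelevant_iff (isClique_plusInl hQ)]
  constructor
  · rintro ⟨hK', ⟨_, hx, x, hxQ, rfl⟩, z, hzK, hzc⟩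
    have hxz : (plus G).Adj (Sum.inl x) z := hK'.prop.1 hx hzK fun h =>
      notMem_of_mem_compSet hzc ⟨x, hxQ, h⟩
    rcases z with y | y
    · have hyc := inl_mem_compSet_compMap_iff.1 hzc
      have hinr : ∀ w, Sum.inr w ∉ K' := by
        intro w hw
        have h1 : w = x := hK'.prop.1 hw hx Sum.inr_ne_inl
        have h2 : w = y := hK'.prop.1 hw hzK Sum.inr_ne_inl
        exact notMem_of_mem_compSet hyc (h2 ▸ h1 ▸ hxQ)
      have hK : K' = plusInl G '' (Sum.inl ⁻¹' K') := by
        ext (w | w)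
        · exact ⟨fun h => ⟨w, h, rfl⟩, fun ⟨v, hv, hvw⟩ => hvw ▸ hv⟩
        · exact ⟨fun h => absurd h (hinr w), fun ⟨v, hv, hvw⟩ => absurd hvw Sum.inl_ne_inr⟩
      refine ⟨Sum.inl ⁻¹' K', (isRelevant_iff hQ).2 ⟨⟨⟨?_, Set.subset_univ _⟩, ?_⟩,
        ⟨x, hx, hxQ⟩, y, hzK, hyc⟩, hK⟩
      · exact fun v hv w hw hne => hK'.prop.1 hv hw fun h => hne (Sum.inl_injective h)
      · rintro L ⟨hL, -⟩ hKL v hv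
        refine hK'.le_of_ge ⟨isClique_plusInl hL, Set.subset_univ _⟩ ?_ ⟨v, hv, rfl⟩
        rw [hK]
        exact Set.image_mono hKL
    · have hxy : x = y := hxz
      exact absurd hzc (inr_notMem_compSet_compMap (hxy ▸ hxQ))
  · rintro ⟨K, hK, rfl⟩
    obtain ⟨hK, ⟨x, hxK, hxQ⟩, y, hyK, hyc⟩ := (isRelevant_iff hQ).1 hK
    refine ⟨isMaxClique_plusInl hK ⟨x, hxK, y, hyK, ?_⟩, ⟨_, ⟨x, hxK, rfl⟩, x, hxQ, rfl⟩,
      _, ⟨y, hyK, rfl⟩, mem_compSet_compMap _ hyc⟩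
    rintro rfl
    exact notMem_of_mem_compSet hyc hxQ

theorem nbr_compMap_plusInl (hQ : G.IsClique Q) (c : Comp G Q) :
    nbr (plus G) (plusInl G '' Q) (compMap (plusInl G) Q c) = plusInl G '' nbr G Q c := by
  ext z
  constructor
  · rintro ⟨⟨x, hxQ, rfl⟩, K', hK', hx⟩
    obtain ⟨K, hK, rfl⟩ := (isRelevant_compMap_plusInl_iff hQ).1 hK'
    obtain ⟨y, hy, hyx⟩ := hx
    exact ⟨x, ⟨hxQ, K, hK, (plusInl G).injective hyx ▸ hy⟩, rfl⟩
  · rintro ⟨x, ⟨hxQ, K, hK, hxK⟩, rfl⟩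
    exact ⟨⟨x, hxQ, rfl⟩, _, (isRelevant_compMap_plusInl_iff hQ).2 ⟨K, hK, rfl⟩, x, hxK, rfl⟩

theorem attached_compMap_plusInl_iff (hQ : G.IsClique Q) {c d : Comp G Q} :
    Attached (plus G) (plusInl G '' Q) (compMap (plusInl G) Q c) (compMap (plusInl G) Q d) ↔
      Attached G Q c d := by
  rw [attached_iff_nbr, attached_iff_nbr, nbr_compMap_plusInl hQ, nbr_compMap_plusInl hQ,
    ← Set.image_inter (plusInl G).injective, Set.image_nonempty]

theorem dominated_compMap_plusInl_iff (hQ : G.IsClique Q) {c d : Comp G Q} :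
    Dominated (plus G) (plusInl G '' Q) (compMap (plusInl G) Q c) (compMap (plusInl G) Q d) ↔
      Dominated G Q c d := by
  rw [dominated_iff_nbr, dominated_iff_nbr, nbr_compMap_plusInl hQ, nbr_compMap_plusInl hQ,
    ← Set.image_inter (plusInl G).injective, Set.image_nonempty]
  refine and_congr_right fun _ => ?_
  have key : ∀ L : Set V, (plusInl G '' nbr G Q c ⊆ plusInl G '' L ∨
      plusInl G '' nbr G Q c ∩ plusInl G '' L = ∅) ↔ (nbr G Q c ⊆ L ∨ nbr G Q c ∩ L = ∅) := by
    intro L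
    rw [Set.image_subset_image_iff (plusInl G).injective, ← Set.image_inter (plusInl G).injective,
      Set.image_eq_empty]
  constructor
  · intro h L hL
    exact (key L).1 (h _ ((isRelevant_compMap_plusInl_iff hQ).2 ⟨L, hL, rfl⟩))
  · intro h L' hL'
    obtain ⟨L, hL, rfl⟩ := (isRelevant_compMap_plusInl_iff hQ).1 hL'
    exact (key L).2 (h L hL)

theorem antip_adj_compMap_plusInl_iff (hQ : G.IsClique Q) {c d : Comp G Q} :
    (attachednessGraph (plus G) (plusInl G '' Q)).antip.Adj (compMap (plusInl G) Q c)
      (compMap (plusInl G) Q d) ↔ (attachednessGraph G Q).antip.Adj c d := by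
  change (_ ≠ _ ∧ Antipodal _ _ _ _) ↔ (_ ≠ _ ∧ Antipodal _ _ _ _)
  rw [Antipodal, Antipodal, attached_compMap_plusInl_iff hQ, dominated_compMap_plusInl_iff hQ,
    dominated_compMap_plusInl_iff hQ, compMap_plusInl_injective.ne_iff]

theorem dom_adj_compMap_plusInl_iff (hQ : G.IsClique Q) {c d : Comp G Q} :
    (attachednessGraph (plus G) (plusInl G '' Q)).dom.Adj (compMap (plusInl G) Q c)
      (compMap (plusInl G) Q d) ↔ (attachednessGraph G Q).dom.Adj c d := by
  change (_ ≠ _ ∧ (Dominated _ _ _ _ ∨ Dominated _ _ _ _)) ↔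
    (_ ≠ _ ∧ (Dominated _ _ _ _ ∨ Dominated _ _ _ _))
  rw [dominated_compMap_plusInl_iff hQ, dominated_compMap_plusInl_iff hQ,
    compMap_plusInl_injective.ne_iff]

/-- The attachedness graphs of `G` are induced subgraphs of those of `G⁺`. -/
theorem HasInducedCopy.attachednessGraph_plus (hQ : G.IsClique Q) {U : Type*} {S : TwoColoredGraph U}
    (h : HasInducedCopy S (attachednessGraph G Q)) :
    HasInducedCopy S (attachednessGraph (plus G) (plusInl G '' Q)) := by
  obtain ⟨f, hf, h1, h2⟩ := h
  refine ⟨compMap (plusInl G) Q ∘ f, compMap_plusInl_injective.comp hf, fun i j => ?_,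
    fun i j => ?_⟩
  · rw [h1, ← antip_adj_compMap_plusInl_iff hQ]
    rfl
  · rw [h2, ← dom_adj_compMap_plusInl_iff hQ]
    rfl

/-- A full antipodal triangle of `G` and a pendant vertex form a wheel in `G⁺`. -/
theorem HasFullAntipodalTriangle.hasInducedCopy_plus [Finite V] (hQ : G.IsClique Q)
    (h : HasFullAntipodalTriangle G Q) :
    HasInducedCopy (wheelZero 1) (attachednessGraph (plus G) (plusInl G '' Q)) := by
  obtain ⟨c₁, c₂, c₃, h12, h23, h13, v, hvQ, h1, h2, h3⟩ := h
  obtain ⟨c₀, hc₀⟩ := exists_mem_compSet (G := plus G) (Q := plusInl G '' Q) (x := Sum.inr v)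
    (fun ⟨_, _, h⟩ => Sum.inl_ne_inr h)
  have hcs : ∀ z ∈ compSet (plus G) (plusInl G '' Q) c₀, z = Sum.inr v := by
    intro z hz
    refine (eq_of_mem_compSet (R := fun z => z = Sum.inr v) ?_ hz hc₀).mpr rfl
    have hne : ∀ x y, x ∉ plusInl G '' Q → (plus G).Adj x y → y ≠ Sum.inr v := by
      rintro (x | x) _ hx hxy rfl
      · exact hx ⟨x, (show x = v from hxy) ▸ hvQ, rfl⟩
      · exact hxy
    intro x y hx hy hxy
    exact propext (iff_of_false (hne y x hy hxy.symm) (hne x y hx hxy))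
  have hnbr : ∀ z ∈ nbr (plus G) (plusInl G '' Q) c₀, z = Sum.inl v := by
    intro z hz
    obtain ⟨⟨x, hxQ, rfl⟩, y, hy, hxy⟩ := (mem_nbr_iff (isClique_plusInl hQ)).1 hz
    rw [hcs y hy] at hxy
    exact congrArg Sum.inl (show x = v from hxy)
  have hv₀ : Sum.inl v ∈ nbr (plus G) (plusInl G '' Q) c₀ :=
    (mem_nbr_iff (isClique_plusInl hQ)).2 ⟨⟨v, hvQ, rfl⟩, _, hc₀, rfl⟩
  let g : Fin 3 → Comp G Q := ![c₁, c₂, c₃]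
  have hg : ∀ i j, (attachednessGraph G Q).antip.Adj (g i) (g j) ↔ i ≠ j := by
    intro i j
    refine ⟨fun h hij => (hij ▸ h).ne rfl, fun h => ?_⟩
    fin_cases i <;> fin_cases j <;> first | exact absurd rfl h | skip
    · exact h12
    · exact h13
    · exact h12.symm
    · exact h23
    · exact h13.symm
    · exact h23.symm
  have hgv : ∀ i, IsNeighboring G Q (g i) v := by
    intro i
    fin_cases i
    · exact h1
    · exact h2
    · exact h3
  have hne : ∀ i, c₀ ≠ compMap (plusInl G) Q (g i) := by
    rintro i rfl
    exact inr_notMem_compSet_compMap hvQ hc₀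
  -- The member of `v⁺` sees only `v`, and a relevant clique either contains `v` or misses it, so
  -- every member seeing `v` dominates it.
  have hdom : ∀ i, (attachednessGraph (plus G) (plusInl G '' Q)).dom.Adj c₀
      (compMap (plusInl G) Q (g i)) := by
    refine fun i => ⟨hne i, Or.inl (dominated_iff_nbr.2 ⟨⟨Sum.inl v, hv₀, ?_⟩, fun L _ => ?_⟩)⟩
    · rw [nbr_compMap_plusInl hQ]
      exact ⟨v, ⟨hvQ, hgv i⟩, rfl⟩
    · by_cases hL : Sum.inl v ∈ L
      · exact Or.inl fun z hz => hnbr z hz ▸ hL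
      · refine Or.inr (Set.eq_empty_iff_forall_notMem.2 ?_)
        rintro z ⟨hz, hzL⟩
        exact hL (hnbr z hz ▸ hzL)
  have hrim : ∀ i j : Fin 3, (rim (2 * 1 + 1)).Adj (some i) (some j) ↔ i ≠ j := by
    intro i j
    rw [rim_adj_some]
    change (SimpleGraph.cycleGraph 3).Adj i j ↔ i ≠ j
    rw [SimpleGraph.cycleGraph_three_eq_top, SimpleGraph.top_adj]
  let M := attachednessGraph (plus G) (plusInl G '' Q)
  let f : Option (Fin 3) → Comp (plus G) (plusInl G '' Q) := fun i =>
    i.elim c₀ fun i => compMap (plusInl G) Q (g i)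
  have hf : ∀ i j : Fin 3, M.antip.Adj (f (some i)) (f (some j)) ↔ i ≠ j := fun i j =>
    (antip_adj_compMap_plusInl_iff hQ).trans (hg i j)
  refine ⟨f, ?_, ?_, ?_⟩
  · rintro (_ | i) (_ | j) hij
    · rfl
    · exact absurd hij (hne j)
    · exact absurd hij.symm (hne i)
    · by_contra hcon
      exact ((hf i j).2 fun h => hcon (congrArg _ h)).ne hij
  · rintro (_ | i) (_ | j)
    · exact iff_of_false not_rim_adj_none (M.antip.irrefl)
    · exact iff_of_false not_rim_adj_none fun h => M.disj _ _ h (hdom j)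
    · exact iff_of_false (fun h => not_rim_adj_none h.symm) fun h => M.disj _ _ h (hdom i).symm
    · exact (hrim i j).trans (hf i j).symm
  · rintro (_ | i) (_ | j)
    · exact iff_of_false (fun h => h.1 rfl) (M.dom.irrefl)
    · exact iff_of_true ⟨by simp, by simp, not_rim_adj_none⟩ (hdom j)
    · exact iff_of_true ⟨by simp, by simp, fun h => not_rim_adj_none h.symm⟩ (hdom i).symm
    · refine iff_of_false (fun h => by simpa using h.2.1) fun h => ?_
      by_cases hij : i = j
      · subst hij
        exact M.dom.irrefl h
      · exact M.disj _ _ ((hf i j).2 hij) h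

end

end PathGraphs

theorem theorem4p4 {V : Type*} [Finite V] (G : SimpleGraph V) (hG : PathGraphs.IsChordal G) :
    List.TFAE [
      PathGraphs.IsPathGraph G,
      ∀ Q : Set V, PathGraphs.IsCliqueSeparator G Q →
        ¬ PathGraphs.HasFullAntipodalTriangle G Q ∧
        ∀ S ∈ PathGraphs.familyZero,
          ¬ PathGraphs.HasCopy S.2 (PathGraphs.attachednessGraph G Q),
      ∀ Q : Set V, PathGraphs.IsCliqueSeparator G Q →
        ∀ S ∈ PathGraphs.familyZero,
          ¬ PathGraphs.HasCopy S.2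
            (PathGraphs.attachednessGraph (PathGraphs.plus G) (Sum.inl '' Q)),
      ∀ Q : Set V, PathGraphs.IsCliqueSeparator G Q →
        ¬ PathGraphs.HasFullAntipodalTriangle G Q ∧
        ∀ S ∈ PathGraphs.family,
          ¬ PathGraphs.HasInducedCopy S.2 (PathGraphs.attachednessGraph G Q),
      ∀ Q : Set V, PathGraphs.IsCliqueSeparator G Q →
        ∀ S ∈ PathGraphs.family,
          ¬ PathGraphs.HasInducedCopy S.2
            (PathGraphs.attachednessGraph (PathGraphs.plus G) (Sum.inl '' Q))] := by
  tfae_have 1 → 2 := fun h Q hQ => by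
    obtain ⟨W, hW, T, φ, hφ⟩ := h.hasPathRep
    have hc := hφ.hasGoodColoring hQ.1
    exact ⟨hc.not_hasFullAntipodalTriangle, hc.not_hasCopy⟩
  tfae_have 2 → 4 := fun h Q hQ =>
    ⟨(h Q hQ).1, PathGraphs.not_hasInducedCopy_of_not_hasCopy (h Q hQ).2⟩
  tfae_have 4 → 1 := fun h => PathGraphs.HasPathRep.isPathGraph (hG.hasPathRep fun Q hQ =>
    PathGraphs.hasGoodColoring_of_not_hasInducedCopy (h Q hQ).1 (h Q hQ).2)
  tfae_have 1 → 3 := fun h Q hQ => (h.hasPathRep.hasGoodColoring_plus hQ.1).not_hasCopy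
  tfae_have 3 → 5 := fun h Q hQ => PathGraphs.not_hasInducedCopy_of_not_hasCopy (h Q hQ)
  tfae_have 5 → 4 := fun h Q hQ =>
    ⟨fun ht => h Q hQ _ (Or.inl (PathGraphs.wheelZero_mem_familyZero le_rfl))
      (ht.hasInducedCopy_plus hQ.1.prop.1),
      fun S hS hc => h Q hQ S hS (hc.attachednessGraph_plus hQ.1.prop.1)⟩
  tfae_finish
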